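/- Let $\mathbb F$ be the field with $2$ elements, let $V$ be a vector space over $\mathbb F$ of dimension $n=6$ with a non-degenerate symplectic (alternating) form, let $p$ be a $1$-dimensional subspace of $V$, and let $H$ be a complement of $p$ in $V$. For a subspace $U$ put $\mathrm{Rad}(U)=U\cap U^\perp$. The pre-geometry $\Pi(p,H)$ over the type set $\{1,2,3,4\}$ has as objects of type $i$ the $i$-dimensional subspaces $U\le H$ with $U\not\subseteq p^\perp$ and $\dim\mathrm{Rad}(U)\le 2$ such that $\mathrm{Rad}(U)=0$ or $\mathrm{Rad}(U)\not\subseteq p^\perp$. Objects $U,W$ with $\dim U<\dim W$ are incident if $U\subseteq W$ and either $\dim W$ is odd or $U\cap\mathrm{Rad}(W\cap p^\perp)=0$; every object is incident with itself. A path is a walk $x_0,\dots,x_k$ of successively distinct, incident objects; two paths are homotopic if one is obtained from the other by repeatedly inserting or eliminating cycles of length $2$ or $3$; the fundamental group based at $x$ is the group of homotopy classes of cycles based at $x$, under concatenation. A pre-geometry is simply connected if it is connected and its fundamental groups are trivial. The pre-geometry $\bar\Pi(p)$ is defined as follows. Its points are the $1$-spaces $q$ of $V$ with $q\not\perp p$,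 and $\psi(q)=\langle p,q\rangle\cap H$ is a point of $\Pi(p,H)$. For a point $q$ of $\Pi(p,H)$ the fiber is $\psi^{-1}(q)=\{q^-,q^+\}$ with $q^-=q$; for a set $A$ of points put $A^{\pm}=\{q^\pm : q\in A\}$. For each object $X$ of $\Pi(p,H)$, with set of points also denoted $X$, there is a partition $X=X_0\uplus X_1$: * if $X$ is a point or a non-degenerate line, $X_0=X$; * if $X$ is a totally isotropic line, $X_0$ consists of one of its two points; * if $X$ is a plane, $X_0=\{\mathrm{Rad}(X)\}$; * if $X$ is a non-degenerate $4$-space, put $r=\mathrm{Rad}(X\cap p^\perp)$ and let $p_1$ be a point of $X$; then $X_0$ consists of $p_1$ and, on each of the three lines of $X$ through $r$ other than $\langle r,p_1\rangle$ and not contained in $p^\perp$, the point different from $r$ that is not perpendicular to $p_1$; * if $X$ is a degenerate $4$-space, $X_0$ is the set of points of $X$ in $\mathrm{Rad}(X)$. Each object $X$ of $\Pi(p,H)$ gives two objects $X_+$ and $X_-$ of $\bar\Pi(p)$, of the same type as $X$, with point sets $X_0^+\uplus X_1^-$ and $X_0^-\uplus X_1^+$; the unordered pair $\{X_+,X_-\}$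 does not depend on the choices made. Two objects of $\bar\Pi(p)$ are incident if the underlying objects of $\Pi(p,H)$ are incident and one of the two point sets contains the other. Let $\Psi\colon\bar\Pi(p)\to\Pi(p,H)$, $X_\pm\mapsto X$. Then $\Pi(p,H)$ is connected and its fundamental group, at every base object, is isomorphic to $\mathbb Z/2\mathbb Z$. Moreover $\Psi$ is a $2$-covering of geometries and $\bar\Pi(p)$ is simply connected. Here a geometry is a pre-geometry in which every type occurs and every flag (set of pairwise incident objects) lies in a flag containing an object of every type. A type and incidence preserving map $\pi$ of geometries is a $2$-covering if, for every non-empty flag $F$ of the target, the set of flags $\bar F$ with $\pi(\bar F)=F$ consists of exactly two disjoint flags, and, for every non-empty flag $\bar F$ of the source, $\pi$ restricts to an isomorphism from the residue of $\bar F$ (the objects outside $\bar F$ incident with all of $\bar F$) onto the residue of $\pi(\bar F)$. -/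

import Mathlib

universe u v w

/-- A pre-geometry over the type set `I`. -/
structure PreGeometry (I : Type u) where
  Obj : Type v
  typ : Obj → I
  inc : Obj → Obj → Prop
  inc_refl : ∀ x, inc x x
  inc_symm : ∀ x y, inc x y → inc y x
  eq_or_typ_ne : ∀ x y, inc x y → x = y ∨ typ x ≠ typ y

namespace PreGeometry

variable {I : Type u}

/-- A flag: a (possibly empty) collection of pairwise incident objects. -/
def IsFlag (Γ : PreGeometry.{u, v} I) (F : Set Γ.Obj) : Prop :=
  ∀ x ∈ F, ∀ y ∈ F, Γ.inc x y

/-- A chamber: a flag whose type is the whole type set. -/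
def IsChamber (Γ : PreGeometry.{u, v} I) (C : Set Γ.Obj) : Prop :=
  Γ.IsFlag C ∧ Γ.typ '' C = Set.univ

/-- A geometry: every type occurs, and every flag is contained in a chamber. -/
def IsGeometry (Γ : PreGeometry.{u, v} I) : Prop :=
  Function.Surjective Γ.typ ∧ ∀ F, Γ.IsFlag F → ∃ C, F ⊆ C ∧ Γ.IsChamber C

/-- The objects of the residue of the flag `F`; types and incidence of the residue are the
restrictions of those of `Γ`. -/
def resObj (Γ : PreGeometry.{u, v} I) (F : Set Γ.Obj) : Set Γ.Obj :=
  {x | x ∉ F ∧ ∀ y ∈ F, Γ.inc x y}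

/-- The incidence graph; as a simple graph, it joins distinct incident objects. -/
def incGraph (Γ : PreGeometry.{u, v} I) : SimpleGraph Γ.Obj where
  Adj x y := x ≠ y ∧ Γ.inc x y
  symm := ⟨fun x y h => ⟨h.1.symm, Γ.inc_symm x y h.2⟩⟩
  loopless := ⟨fun _ h => h.1 rfl⟩

def Connected (Γ : PreGeometry.{u, v} I) : Prop := Γ.incGraph.Connected

/-- A path without repetitions of consecutive objects is a walk of the incidence graph. -/
abbrev Path (Γ : PreGeometry.{u, v} I) (x y : Γ.Obj) : Type v := Γ.incGraph.Walk x y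

/-- The second path arises from the first by inserting a cycle of length `2` or `3`. -/
inductive Insertion (Γ : PreGeometry.{u, v} I) {x y : Γ.Obj} :
    Γ.Path x y → Γ.Path x y → Prop
  | insert {z : Γ.Obj} (γ : Γ.Path x z) (c : Γ.Path z z) (δ : Γ.Path z y)
      (hc : c.length = 2 ∨ c.length = 3) :
      Insertion Γ (γ.append δ) (γ.append (c.append δ))

/-- Homotopy of paths: repeated insertion and elimination of cycles of length `2` or `3`. -/
def homotopySetoid (Γ : PreGeometry.{u, v} I) (x y : Γ.Obj) : Setoid (Γ.Path x y) :=
  Relation.EqvGen.setoid Γ.Insertion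

theorem Insertion.append_left {Γ : PreGeometry.{u, v} I} {x y z : Γ.Obj} (ε : Γ.Path x y)
    {γ δ : Γ.Path y z} (h : Γ.Insertion γ δ) : Γ.Insertion (ε.append γ) (ε.append δ) := by
  cases h with
  | insert a c b hc =>
    have := Insertion.insert (ε.append a) c b hc
    simpa only [SimpleGraph.Walk.append_assoc] using this

theorem Insertion.append_right {Γ : PreGeometry.{u, v} I} {x y z : Γ.Obj}
    {γ δ : Γ.Path x y} (h : Γ.Insertion γ δ) (ε : Γ.Path y z) :
    Γ.Insertion (γ.append ε) (δ.append ε) := by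
  cases h with
  | insert a c b hc =>
    have := Insertion.insert a c (b.append ε) hc
    simpa only [SimpleGraph.Walk.append_assoc] using this

theorem Insertion.reverse {Γ : PreGeometry.{u, v} I} {x y : Γ.Obj}
    {γ δ : Γ.Path x y} (h : Γ.Insertion γ δ) : Γ.Insertion γ.reverse δ.reverse := by
  cases h with
  | insert a c b hc =>
    have := Insertion.insert b.reverse c.reverse a.reverse (by simpa using hc)
    simpa only [SimpleGraph.Walk.reverse_append, SimpleGraph.Walk.append_assoc] using this

theorem eqvGen_map {α β : Type v} {r : α → α → Prop} {s : β → β → Prop} (f : α → β)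
    (hf : ∀ a b, r a b → s (f a) (f b)) {a b : α} (h : Relation.EqvGen r a b) :
    Relation.EqvGen s (f a) (f b) := by
  induction h with
  | rel _ _ h => exact .rel _ _ (hf _ _ h)
  | refl _ => exact .refl _
  | symm _ _ _ ih => exact .symm _ _ ih
  | trans _ _ _ _ _ ih₁ ih₂ => exact .trans _ _ _ ih₁ ih₂

theorem homotopy_append {Γ : PreGeometry.{u, v} I} {x y z : Γ.Obj}
    {γ γ' : Γ.Path x y} {δ δ' : Γ.Path y z}
    (h : (Γ.homotopySetoid x y).r γ γ') (h' : (Γ.homotopySetoid y z).r δ δ') :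
    (Γ.homotopySetoid x z).r (γ.append δ) (γ'.append δ') :=
  Relation.EqvGen.trans _ _ _
    (eqvGen_map (fun ε : Γ.Path x y => ε.append δ) (fun _ _ k => k.append_right δ) h)
    (eqvGen_map (fun ε : Γ.Path y z => γ'.append ε) (fun _ _ k => k.append_left γ') h')

theorem homotopy_reverse_append {Γ : PreGeometry.{u, v} I} {x y : Γ.Obj} (γ : Γ.Path x y) :
    (Γ.homotopySetoid y y).r (γ.reverse.append γ) SimpleGraph.Walk.nil := by
  induction γ with
  | nil => exact Relation.EqvGen.refl _
  | cons h γ ih =>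
    refine Relation.EqvGen.trans _ _ _ (Relation.EqvGen.symm _ _ (Relation.EqvGen.rel _ _ ?_)) ih
    have := Insertion.insert γ.reverse
      (SimpleGraph.Walk.cons h.symm (SimpleGraph.Walk.cons h SimpleGraph.Walk.nil)) γ (Or.inl rfl)
    simpa [← SimpleGraph.Walk.append_assoc] using this

/-- The fundamental group based at `x`: homotopy classes of cycles based at `x`. -/
def FundamentalGroup (Γ : PreGeometry.{u, v} I) (x : Γ.Obj) : Type v :=
  Quotient (Γ.homotopySetoid x x)

/-- The group operation is concatenation. -/
instance (Γ : PreGeometry.{u, v} I) (x : Γ.Obj) : Group (Γ.FundamentalGroup x) where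
  mul := Quotient.map₂ (fun γ δ => γ.append δ) fun _ _ h _ _ h' => homotopy_append h h'
  one := Quotient.mk _ SimpleGraph.Walk.nil
  inv := Quotient.map (fun γ => γ.reverse) fun _ _ h =>
    eqvGen_map _ (fun _ _ k => k.reverse) h
  mul_assoc := by
    rintro ⟨a⟩ ⟨b⟩ ⟨c⟩
    exact congrArg (Quotient.mk _) (SimpleGraph.Walk.append_assoc a b c).symm
  one_mul := by
    rintro ⟨a⟩
    exact congrArg (Quotient.mk _) (SimpleGraph.Walk.nil_append a)
  mul_one := by
    rintro ⟨a⟩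
    exact congrArg (Quotient.mk _) (SimpleGraph.Walk.append_nil a)
  inv_mul_cancel := by
    rintro ⟨a⟩
    exact Quotient.sound (homotopy_reverse_append a)

def SimplyConnected (Γ : PreGeometry.{u, v} I) : Prop :=
  Γ.Connected ∧ ∀ x : Γ.Obj, Subsingleton (Γ.FundamentalGroup x)

/-- `π` is a `k`-covering of geometries. -/
structure IsCovering (k : ℕ) (Γ' : PreGeometry.{u, v} I) (Γ : PreGeometry.{u, w} I)
    (π : Γ'.Obj → Γ.Obj) : Prop where
  geometry_cover : Γ'.IsGeometry
  geometry_base : Γ.IsGeometry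
  map_typ : ∀ x, Γ.typ (π x) = Γ'.typ x
  map_inc : ∀ x y, Γ'.inc x y → Γ.inc (π x) (π y)
  /-- The fiber over a non-empty flag consists of exactly `k` pairwise disjoint flags. -/
  fiber : ∀ F, F.Nonempty → Γ.IsFlag F →
    {F' | Γ'.IsFlag F' ∧ π '' F' = F}.encard = k ∧
    {F' | Γ'.IsFlag F' ∧ π '' F' = F}.PairwiseDisjoint id
  /-- For a non-empty flag `F'`, `π` restricts to an isomorphism of the residue of `F'` onto the
  residue of `π '' F'`. -/
  residue : ∀ F', F'.Nonempty → Γ'.IsFlag F' →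
    Set.BijOn π (Γ'.resObj F') (Γ.resObj (π '' F')) ∧
    ∀ x ∈ Γ'.resObj F', ∀ y ∈ Γ'.resObj F', Γ'.inc x y ↔ Γ.inc (π x) (π y)

end PreGeometry

namespace SymplecticResidue

open Module LinearMap.BilinForm

variable {F : Type u} {V : Type v} [Field F] [AddCommGroup V] [Module F V]

/-- The radical `U ∩ U^⊥` of a subspace. -/
def rad (s : LinearMap.BilinForm F V) (U : Submodule F V) : Submodule F V :=
  U ⊓ s.orthogonal U

/-- The subspaces `U` of `H` that are objects of `Π(p,H)`: the subspaces `U` not contained in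
`p^⊥`, of dimension between `1` and `dim V - 2`, that do not contain `Rad(V)` (of dimension at
most `1`, so `U` meets it trivially), and whose radical has dimension at most `2` and is zero or
not contained in `p^⊥`. -/
def IsObj (s : LinearMap.BilinForm F V) (p H U : Submodule F V) : Prop :=
  U ≤ H ∧ ¬ U ≤ s.orthogonal p ∧
  U ⊓ rad s ⊤ = ⊥ ∧ finrank F (rad s U) ≤ 2 ∧ (rad s U = ⊥ ∨ ¬ rad s U ≤ s.orthogonal p) ∧
  finrank F U ∈ Set.Icc 1 (finrank F V - 2)

/-- Incidence of `U` with `W` in `Π(p,H)` when `dim U < dim W`: `U` lies in `W` and, if `dim W` is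
even, `U` meets the radical of `W ∩ p^⊥` trivially. -/
def IncLT (s : LinearMap.BilinForm F V) (p U W : Submodule F V) : Prop :=
  finrank F U < finrank F W ∧ U ≤ W ∧
  (Odd (finrank F W) ∨ U ⊓ rad s (W ⊓ s.orthogonal p) = ⊥)

/-- The pre-geometry `Π(p,H)`; the type of an object is its dimension. -/
noncomputable def residueGeometry (s : LinearMap.BilinForm F V) (p H : Submodule F V) :
    PreGeometry.{0, v} (Set.Icc 1 (finrank F V - 2)) where
  Obj := {U : Submodule F V // IsObj s p H U}
  typ U := ⟨finrank F U.1, U.2.2.2.2.2.2⟩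
  inc U W := U = W ∨ IncLT s p U.1 W.1 ∨ IncLT s p W.1 U.1
  inc_refl _ := Or.inl rfl
  inc_symm _ _ h := h.elim (fun e => Or.inl e.symm) fun e => Or.inr e.symm
  eq_or_typ_ne U W h := by
    rcases h with h | h | h
    · exact Or.inl h
    · exact Or.inr fun e => absurd (congrArg Subtype.val e) (ne_of_lt h.1)
    · exact Or.inr fun e => absurd (congrArg Subtype.val e) (ne_of_gt h.1)

/-- The points of the cover: the points `q` of `V` such that the line `pq` is non-degenerate, that
is, `q` is not perpendicular to `p`. -/
def IsPoint (s : LinearMap.BilinForm F V) (p q : Submodule F V) : Prop :=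
  finrank F q = 1 ∧ ¬ q ≤ s.orthogonal p

/-- The map `q ↦ ⟨p,q⟩ ∩ H` on points. -/
def proj (p H q : Submodule F V) : Submodule F V := (p ⊔ q) ⊓ H

/-- The point-shadow of an object `X` of `Π(p,H)`. -/
def shadow (s : LinearMap.BilinForm F V) (p X : Submodule F V) : Set (Submodule F V) :=
  {q | IsPoint s p q ∧ q ≤ X}

/-- For a set `A` of points of `Π(p,H)`, the set `A^-` of the points `q^- = q`, `q ∈ A`. -/
def lower (A : Set (Submodule F V)) : Set (Submodule F V) := A

/-- For a set `A` of points of `Π(p,H)`, the set `A^+` of the points `q^+`, `q ∈ A`, where `q^+` is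
the point over `q` that is different from `q`. -/
def upper (s : LinearMap.BilinForm F V) (p H : Submodule F V) (A : Set (Submodule F V)) :
    Set (Submodule F V) :=
  {x | IsPoint s p x ∧ proj p H x ∈ A ∧ x ≠ proj p H x}

/-- `IsPart s p X X₀` says that `X₀` is the first part of a partition `X₀ ⊎ X₁` of the point-shadow
of the object `X` used to lift `X` to the cover (some choices are free; they only affect which part
is called first). -/
inductive IsPart (s : LinearMap.BilinForm F V) (p X : Submodule F V) :
    Set (Submodule F V) → Prop
  | point (hX : finrank F X = 1) : IsPart s p X (shadow s p X)
  | hyperbolicLine (hX : finrank F X = 2) (hr : rad s X = ⊥) : IsPart s p X (shadow s p X)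
  | isotropicLine (hX : finrank F X = 2) (hr : rad s X = X) (x₀ : Submodule F V)
      (hx₀ : x₀ ∈ shadow s p X) : IsPart s p X {x₀}
  | plane (hX : finrank F X = 3) : IsPart s p X {rad s X}
  /-- With `r` the radical of `X ∩ p^⊥` and `p₁` a point of `X`, the set `X₀` consists of `p₁` and,
  from each line of `X` through `r` that is not in `p^⊥` and not `r p₁`, the point that is not
  perpendicular to `p₁`. -/
  | nondegenerateSolid (hX : finrank F X = 4) (hr : rad s X = ⊥) (p₁ : Submodule F V)
      (hp₁ : p₁ ∈ shadow s p X) :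
      IsPart s p X {x | x ∈ shadow s p X ∧
        (x = p₁ ∨ ¬ x ≤ rad s (X ⊓ s.orthogonal p) ⊔ p₁ ∧ ¬ x ≤ s.orthogonal p₁)}
  | degenerateSolid (hX : finrank F X = 4) (hr : finrank F (rad s X) = 2) :
      IsPart s p X {x | x ∈ shadow s p X ∧ x ≤ rad s X}

/-- `S` is the point-shadow `X₀^+ ⊎ X₁^-` of `X_+` or the point-shadow `X₀^- ⊎ X₁^+` of `X_-`. -/
def IsLift (s : LinearMap.BilinForm F V) (p H X : Submodule F V)
    (S : Set (Submodule F V)) : Prop :=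
  ∃ X₀, IsPart s p X X₀ ∧
    (S = upper s p H X₀ ∪ lower (shadow s p X \ X₀) ∨
      S = lower X₀ ∪ upper s p H (shadow s p X \ X₀))

/-- The pre-geometry covering `Π(p,H)`. An object is an object `X` of `Π(p,H)` together with one of
the two point-shadows over `X`; two objects over different objects of `Π(p,H)` are incident when
the latter are incident and one point-shadow contains the other. -/
noncomputable def doubleCover (s : LinearMap.BilinForm F V) (p H : Submodule F V) :
    PreGeometry.{0, v} (Set.Icc 1 (finrank F V - 2)) where
  Obj := {X : (residueGeometry s p H).Obj × Set (Submodule F V) // IsLift s p H X.1.1 X.2}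
  typ X := (residueGeometry s p H).typ X.1.1
  inc X Y := X = Y ∨ (X.1.1 ≠ Y.1.1 ∧ (residueGeometry s p H).inc X.1.1 Y.1.1 ∧
    (X.1.2 ⊆ Y.1.2 ∨ Y.1.2 ⊆ X.1.2))
  inc_refl _ := Or.inl rfl
  inc_symm _ _ h := h.elim (fun e => Or.inl e.symm) fun e =>
    Or.inr ⟨e.1.symm, (residueGeometry s p H).inc_symm _ _ e.2.1, e.2.2.symm⟩
  eq_or_typ_ne _ _ h := h.imp_right fun e =>
    ((residueGeometry s p H).eq_or_typ_ne _ _ e.2.1).resolve_left e.1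

/-- The map from the cover to `Π(p,H)`. -/
def coverMap (s : LinearMap.BilinForm F V) (p H : Submodule F V) :
    (doubleCover s p H).Obj → (residueGeometry s p H).Obj :=
  fun X => X.1.1

end SymplecticResidue

/-! Everything is deduced from the cover. If the cover has two objects over each object, lifts
incidences uniquely, closes up over triangles and is simply connected, then lifting cycles puts
every fundamental group of `Π(p,H)` in bijection with a fiber of two objects, and a group of order
two is cyclic (`IsDoubleCover.card_fundamentalGroup`).

Let `e` span `p` and let `r` span `H^⊥`. Then `r` lies in `H` but not in `p^⊥`, and `⟨e,r⟩^⊥` is a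
symplectic 4-space over the field with two elements. The points of `H` off `p^⊥` are the vectors `r
+ x` with `x` in this 4-space, and two of them are perpendicular when `form x y = 0`. An object is
determined by its trace on this affine space. The traces are the points, the pairs of points, the
affine planes with hyperbolic direction space, and the affine hyperplanes `form x t = ε` with `t ≠
0` (`Frame.shape`). Incidence is inclusion of traces, except that an object incident with a larger
hyperplane must not contain two points that differ by `t`; pairs not so excluded are called joined
(`Frame.incLT_iff`).

The points of the cover are the vectors `ε e + r + x`, and two of them are non-perpendicular when `ε
+ δ + form x y = 1`. Three pairwise joined points of an object satisfy `form x y + form y z + form x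
z = 1` (`Frame.form_of_joined`), which is the condition for lifting them to pairwise
non-perpendicular points. The prescribed partitions describe the two ways of choosing one point from
every fiber over an object so that joined points become non-perpendicular (`Frame.isPart_form`,
`Frame.section_of_isLift`). Such a section is determined by any one of its points, and pairwise
incident objects have a common point; this gives the double cover.

For simple connectedness, consider the graph on the 32 points of the cover in which
non-perpendicular points over different points are adjacent. An edge spans a line and a triangle
lies in a plane, so triangles are null-homotopic. The layers of this graph around `(0,0)` are so
well connected that triangles generate all cycles (`exists_potential`). The resulting choice of
homotopy classes on points extends to all objects, since the joined points of an object form a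
connected graph. -/

namespace PreGeometry

/-! ### Homotopy classes of paths and a criterion for simple connectedness -/

open SimpleGraph

variable {I : Type u}

/-- Homotopy classes of paths from `x` to `y`. -/
def PathClass (Γ : PreGeometry.{u, v} I) (x y : Γ.Obj) : Type v :=
  Quotient (Γ.homotopySetoid x y)

section PathClass

variable {Γ : PreGeometry.{u, v} I}

/-- Extend a homotopy class of paths by a path. -/
def PathClass.comp {x y z : Γ.Obj} (c : Γ.PathClass x y) (δ : Γ.Path y z) : Γ.PathClass x z :=
  Quotient.map (fun γ : Γ.Path x y => γ.append δ)
    (fun _ _ h => homotopy_append h (Relation.EqvGen.refl _)) c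

theorem PathClass.comp_append {x y z t : Γ.Obj} (c : Γ.PathClass x y) (δ : Γ.Path y z)
    (ε : Γ.Path z t) : c.comp (δ.append ε) = (c.comp δ).comp ε := by
  induction c using Quotient.inductionOn with
  | h γ => exact congrArg (Quotient.mk _) (Walk.append_assoc γ δ ε)

theorem PathClass.comp_nil {x y : Γ.Obj} (c : Γ.PathClass x y) : c.comp Walk.nil = c := by
  induction c using Quotient.inductionOn with
  | h γ => exact congrArg (Quotient.mk _) (Walk.append_nil γ)

theorem PathClass.comp_short_cycle {x y : Γ.Obj} (c : Γ.PathClass x y) (δ : Γ.Path y y)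
    (hδ : δ.length = 2 ∨ δ.length = 3) : c.comp δ = c := by
  induction c using Quotient.inductionOn with
  | h γ =>
    refine Quotient.sound (Relation.EqvGen.symm _ _ (Relation.EqvGen.rel _ _ ?_))
    have := Insertion.insert γ δ Walk.nil hδ
    simpa using this

open Classical in
/-- Extend a homotopy class of paths by one step to an incident object, which may be the last
object of the paths. -/
noncomputable def PathClass.move {x y z : Γ.Obj} (c : Γ.PathClass x y) (h : Γ.inc y z) :
    Γ.PathClass x z :=
  if e : y = z then e ▸ c else c.comp (Walk.cons (show Γ.incGraph.Adj y z from ⟨e, h⟩) Walk.nil)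

theorem PathClass.move_of_ne {x y z : Γ.Obj} (c : Γ.PathClass x y) (h : Γ.incGraph.Adj y z) :
    c.move h.2 = c.comp (Walk.cons h Walk.nil) := dif_neg h.1

theorem PathClass.move_self {x y : Γ.Obj} (c : Γ.PathClass x y) (h : Γ.inc y y) :
    c.move h = c := dif_pos rfl

/-- Three pairwise incident objects, some of which may coincide, bound a cycle of length at most
three, and this cycle may be eliminated. Allowing trivial moves removes case distinctions later on.
-/
theorem PathClass.move_move {x y z t : Γ.Obj} (c : Γ.PathClass x y) (h : Γ.inc y z)
    (h' : Γ.inc z t) (h'' : Γ.inc y t) : (c.move h).move h' = c.move h'' := by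
  by_cases e : y = z
  · subst e; rw [move_self]
  by_cases e' : z = t
  · subst e'; rw [move_self]
  have a : Γ.incGraph.Adj y z := ⟨e, h⟩
  have a' : Γ.incGraph.Adj z t := ⟨e', h'⟩
  rw [move_of_ne c a, move_of_ne _ a', ← comp_append]
  by_cases e'' : y = t
  · subst e''
    rw [move_self]
    exact comp_short_cycle _ _ (Or.inl rfl)
  · have a'' : Γ.incGraph.Adj y t := ⟨e'', h''⟩
    rw [move_of_ne c a'']
    have h3 := comp_short_cycle c
      (Walk.cons a (Walk.cons a' (Walk.cons a''.symm Walk.nil))) (Or.inr rfl)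
    -- The triangle through `y`, `z`, `t` is inserted before the direct step from `y` to `t`; the
    -- detour from `t` to `y` and back is then eliminated.
    conv_rhs => rw [← h3]
    rw [← comp_append]
    have h2 := comp_short_cycle (c.comp (Walk.cons a (Walk.cons a' Walk.nil)))
      (Walk.cons a''.symm (Walk.cons a'' Walk.nil)) (Or.inl rfl)
    rw [← comp_append] at h2
    exact h2.symm

theorem PathClass.move_move_symm {x y z : Γ.Obj} (c : Γ.PathClass x y) (h : Γ.inc y z)
    (h' : Γ.inc z y) : (c.move h).move h' = c := by
  rw [move_move c h h' (Γ.inc_refl y), move_self]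

/-- A pre-geometry is simply connected if one can choose homotopy classes of paths from a base
object to all objects in a way compatible with incidence. -/
theorem simplyConnected_of_potential (x₀ : Γ.Obj) (g : ∀ x, Γ.PathClass x₀ x)
    (hg : ∀ x y (h : Γ.inc x y), (g x).move h = g y) : Γ.SimplyConnected := by
  have hr : ∀ x, Γ.incGraph.Reachable x₀ x := fun x => by
    obtain ⟨γ, -⟩ := Quotient.exists_rep (g x)
    exact ⟨γ⟩
  have key : ∀ {x y : Γ.Obj} (γ : Γ.Path x y), (g x).comp γ = g y := by
    intro x y γ
    induction γ with
    | nil => exact PathClass.comp_nil _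
    | @cons a b c h γ ih =>
      rw [← ih, ← hg a b h.2, PathClass.move_of_ne _ h, ← PathClass.comp_append]
      rfl
  refine ⟨(connected_iff _).2 ⟨fun x y => (hr x).symm.trans (hr y), ⟨x₀⟩⟩, fun x => ⟨fun a b => ?_⟩⟩
  obtain ⟨ε, hε⟩ := Quotient.exists_rep (g x)
  -- Transport along `γ` fixes the chosen class at `x`, so `ε` followed by `γ` is homotopic to `ε`;
  -- cancelling `ε` on the left makes `γ` null-homotopic.
  have null : ∀ γ : Γ.Path x x, (Γ.homotopySetoid x x).r γ Walk.nil := by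
    intro γ
    have h1 : (Γ.homotopySetoid x₀ x).r (ε.append γ) ε := by
      have := key γ
      rw [← hε] at this
      exact Quotient.exact this
    have h2 := homotopy_append (Relation.EqvGen.refl ε.reverse) h1
    rw [Walk.append_assoc] at h2
    have h3 := homotopy_append (homotopy_reverse_append ε)
      (Relation.EqvGen.refl γ)
    exact Relation.EqvGen.trans _ _ _ (Relation.EqvGen.symm _ _ h3)
      (Relation.EqvGen.trans _ _ _ h2 (homotopy_reverse_append ε))
  induction a using Quotient.inductionOn with
  | h a =>
    induction b using Quotient.inductionOn with
    | h b =>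
      exact Quotient.sound (Relation.EqvGen.trans _ _ _ (null a)
        (Relation.EqvGen.symm _ _ (null b)))

end PathClass

/-! ### Double covers: lifting of flags and paths, order of the fundamental group -/

/-- A double cover: fibers have two objects, incident objects lift to incident objects, and
pairwise incidence of three objects lifts. -/
structure IsDoubleCover (Γ' : PreGeometry.{u, v} I) (Γ : PreGeometry.{u, w} I)
    (π : Γ'.Obj → Γ.Obj) : Prop where
  map_typ : ∀ x, Γ.typ (π x) = Γ'.typ x
  map_inc : ∀ x y, Γ'.inc x y → Γ.inc (π x) (π y)
  fiber_two : ∀ x, ∃ a b, a ≠ b ∧ ∀ y, π y = x ↔ y = a ∨ y = b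
  lift : ∀ x y, Γ.inc (π x) y → ∃ y', π y' = y ∧ Γ'.inc x y'
  triangle : ∀ x y z, Γ'.inc x y → Γ'.inc y z → Γ.inc (π x) (π z) → Γ'.inc x z

namespace IsDoubleCover

variable {Γ' : PreGeometry.{u, v} I} {Γ : PreGeometry.{u, w} I} {π : Γ'.Obj → Γ.Obj}

theorem surjective (h : IsDoubleCover Γ' Γ π) : Function.Surjective π := fun x => by
  obtain ⟨a, b, -, hab⟩ := h.fiber_two x
  exact ⟨a, (hab a).2 (Or.inl rfl)⟩

theorem eq_of_inc (h : IsDoubleCover Γ' Γ π) {x y : Γ'.Obj} (hi : Γ'.inc x y)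
    (he : π x = π y) : x = y :=
  (Γ'.eq_or_typ_ne x y hi).resolve_right fun hne => hne (by rw [← h.map_typ, ← h.map_typ, he])

/-- Lifts of an incidence are unique: by the triangle property, two lifts with the same image are
incident, and incident objects of equal type coincide. -/
theorem eq_of_inc_inc (h : IsDoubleCover Γ' Γ π) {x y z : Γ'.Obj} (hy : Γ'.inc x y)
    (hz : Γ'.inc x z) (he : π y = π z) : y = z :=
  h.eq_of_inc (h.triangle y x z (Γ'.inc_symm _ _ hy) hz (he ▸ Γ.inc_refl _)) he

/-- The flag over a flag `F` through a given object. -/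
theorem isFlag_lift (h : IsDoubleCover Γ' Γ π) {F : Set Γ.Obj} (hF : Γ.IsFlag F) {x : Γ'.Obj}
    (hx : π x ∈ F) : Γ'.IsFlag {y | Γ'.inc x y ∧ π y ∈ F} ∧
      π '' {y | Γ'.inc x y ∧ π y ∈ F} = F := by
  refine ⟨fun y hy z hz => h.triangle y x z (Γ'.inc_symm _ _ hy.1) hz.1 (hF _ hy.2 _ hz.2), ?_⟩
  ext z
  constructor
  · rintro ⟨y, hy, rfl⟩
    exact hy.2
  · intro hz
    obtain ⟨y, rfl, hy⟩ := h.lift x z (hF _ hx _ hz)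
    exact ⟨y, ⟨hy, hz⟩, rfl⟩

theorem eq_lift (h : IsDoubleCover Γ' Γ π) {F' : Set Γ'.Obj} (hF' : Γ'.IsFlag F') {x : Γ'.Obj}
    (hx : x ∈ F') : F' = {y | Γ'.inc x y ∧ π y ∈ π '' F'} := by
  ext y
  constructor
  · exact fun hy => ⟨hF' _ hx _ hy, y, hy, rfl⟩
  · rintro ⟨hy, z, hz, e⟩
    rwa [h.eq_of_inc_inc hy (hF' _ hx _ hz) e.symm]

theorem isFlag_image (h : IsDoubleCover Γ' Γ π) {F' : Set Γ'.Obj} (hF' : Γ'.IsFlag F') :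
    Γ.IsFlag (π '' F') := by
  rintro _ ⟨x, hx, rfl⟩ _ ⟨y, hy, rfl⟩
  exact h.map_inc _ _ (hF' _ hx _ hy)

theorem isGeometry (h : IsDoubleCover Γ' Γ π) (hΓ : Γ.IsGeometry) : Γ'.IsGeometry := by
  have key : ∀ F, F.Nonempty → Γ'.IsFlag F → ∃ C, F ⊆ C ∧ Γ'.IsChamber C := by
    rintro F ⟨x, hx⟩ hF
    obtain ⟨C, hFC, hC, hCt⟩ := hΓ.2 _ (h.isFlag_image hF)
    have hxC : π x ∈ C := hFC ⟨x, hx, rfl⟩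
    obtain ⟨h1, h2⟩ := h.isFlag_lift hC hxC
    refine ⟨{y | Γ'.inc x y ∧ π y ∈ C}, fun y hy => ⟨hF _ hx _ hy, hFC (Set.mem_image_of_mem π hy)⟩, h1, ?_⟩
    rw [← hCt]
    conv_rhs => rw [← h2]
    rw [Set.image_image]
    exact Set.image_congr fun y _ => (h.map_typ y).symm
  refine ⟨fun i => ?_, fun F hF => ?_⟩
  · obtain ⟨x, rfl⟩ := hΓ.1 i
    obtain ⟨y, rfl⟩ := h.surjective x
    exact ⟨y, (h.map_typ y).symm⟩
  · rcases F.eq_empty_or_nonempty with rfl | hne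
    · obtain ⟨C, -, hC, hCt⟩ := hΓ.2 ∅ (fun x hx => hx.elim)
      -- A chamber can be empty only over an empty type set; then the empty flag is already a
      -- chamber of the cover.
      rcases C.eq_empty_or_nonempty with rfl | ⟨x, -⟩
      · exact ⟨∅, le_rfl, hF, by rw [← hCt, Set.image_empty, Set.image_empty]⟩
      · obtain ⟨y, -⟩ := h.surjective x
        obtain ⟨C', -, hC'⟩ := key {y} ⟨y, rfl⟩ (by
          rintro _ rfl _ rfl
          exact Γ'.inc_refl _)
        exact ⟨C', Set.empty_subset _, hC'⟩
    · exact key F hne hF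

/-- A lifted flag is determined by its member over one fixed object `x` of `F`, so the two objects
over `x` give the two flags. A common member of these would be incident with both objects over `x`,
against uniqueness of lifts. -/
theorem isCovering (h : IsDoubleCover Γ' Γ π) (hΓ : Γ.IsGeometry) : IsCovering 2 Γ' Γ π where
  geometry_cover := h.isGeometry hΓ
  geometry_base := hΓ
  map_typ := h.map_typ
  map_inc := h.map_inc
  fiber F hne hF := by
    obtain ⟨x, hx⟩ := hne
    obtain ⟨a, b, hab, hfib⟩ := h.fiber_two x
    have ha : π a = x := (hfib a).2 (Or.inl rfl)
    have hb : π b = x := (hfib b).2 (Or.inr rfl)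
    have hset : {F' | Γ'.IsFlag F' ∧ π '' F' = F} =
        {{y | Γ'.inc a y ∧ π y ∈ F}, {y | Γ'.inc b y ∧ π y ∈ F}} := by
      ext F'
      constructor
      · rintro ⟨hF', rfl⟩
        obtain ⟨c, hc, hcx⟩ := hx
        rcases (hfib c).1 hcx with rfl | rfl
        · exact Or.inl (h.eq_lift hF' hc)
        · exact Or.inr (h.eq_lift hF' hc)
      · rintro (rfl | rfl)
        · exact h.isFlag_lift hF (ha ▸ hx)
        · exact h.isFlag_lift hF (hb ▸ hx)
    have hdisj : Disjoint {y | Γ'.inc a y ∧ π y ∈ F} {y | Γ'.inc b y ∧ π y ∈ F} := by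
      rw [Set.disjoint_left]
      rintro y ⟨hay, -⟩ ⟨hby, -⟩
      exact hab (h.eq_of_inc_inc (Γ'.inc_symm _ _ hay) (Γ'.inc_symm _ _ hby) (ha.trans hb.symm))
    rw [hset]
    refine ⟨?_, ?_⟩
    · rw [Set.encard_pair]
      · rfl
      · intro e
        rw [← e, disjoint_self] at hdisj
        have : a ∈ {y | Γ'.inc a y ∧ π y ∈ F} := ⟨Γ'.inc_refl _, ha ▸ hx⟩
        rw [hdisj] at this
        exact this
    · rintro _ (rfl | rfl) _ (rfl | rfl) hne
      · exact absurd rfl hne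
      · exact hdisj
      · exact hdisj.symm
      · exact absurd rfl hne
  residue F' hne hF' := by
    obtain ⟨f, hf⟩ := hne
    refine ⟨⟨?_, ?_, ?_⟩, ?_⟩
    · rintro x ⟨hx, hxF⟩
      refine ⟨?_, ?_⟩
      · rintro ⟨y, hy, e⟩
        exact hx (h.eq_of_inc (hxF y hy) e.symm ▸ hy)
      · rintro _ ⟨y, hy, rfl⟩
        exact h.map_inc _ _ (hxF y hy)
    · rintro x ⟨-, hx⟩ y ⟨-, hy⟩ e
      exact h.eq_of_inc_inc (Γ'.inc_symm _ _ (hx f hf)) (Γ'.inc_symm _ _ (hy f hf)) e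
    · rintro z ⟨hz, hzF⟩
      obtain ⟨x, rfl, hx⟩ := h.lift f z (Γ.inc_symm _ _ (hzF _ ⟨f, hf, rfl⟩))
      exact ⟨x, ⟨fun hxF => hz ⟨x, hxF, rfl⟩, fun y hy =>
        h.triangle x f y (Γ'.inc_symm _ _ hx) (hF' _ hf _ hy) (hzF _ ⟨y, hy, rfl⟩)⟩, rfl⟩
    · rintro x ⟨-, hx⟩ y ⟨-, hy⟩
      exact ⟨h.map_inc x y, fun hi => h.triangle x f y (hx f hf) (Γ'.inc_symm _ _ (hy f hf)) hi⟩

/-- The covering map as a homomorphism of incidence graphs. -/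
def graphHom (h : IsDoubleCover Γ' Γ π) : Γ'.incGraph →g Γ.incGraph where
  toFun := π
  map_rel' hxy := ⟨fun e => hxy.1 (h.eq_of_inc hxy.2 e), h.map_inc _ _ hxy.2⟩

theorem homotopic_map (h : IsDoubleCover Γ' Γ π) {x y : Γ'.Obj} {γ δ : Γ'.Path x y}
    (hγ : (Γ'.homotopySetoid x y).r γ δ) :
    (Γ.homotopySetoid (π x) (π y)).r (γ.map h.graphHom) (δ.map h.graphHom) := by
  induction hγ with
  | rel _ _ k =>
    refine Relation.EqvGen.rel _ _ ?_
    cases k with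
    | insert a c b hc =>
      have := Insertion.insert (Γ := Γ) (a.map h.graphHom) (c.map h.graphHom) (b.map h.graphHom)
        (by simpa using hc)
      rw [Walk.map_append, Walk.map_append, Walk.map_append]
      exact this
  | refl _ => exact .refl _
  | symm _ _ _ ih => exact .symm _ _ ih
  | trans _ _ _ _ _ ih₁ ih₂ => exact .trans _ _ _ ih₁ ih₂

theorem exists_next (h : IsDoubleCover Γ' Γ π) {x y : Γ.Obj} (hxy : Γ.incGraph.Adj x y)
    (a : {a // π a = x}) : ∃ b : {b // π b = y}, Γ'.inc a.1 b.1 := by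
  obtain ⟨a, rfl⟩ := a
  obtain ⟨b, hb, hab⟩ := h.lift a y hxy.2
  exact ⟨⟨b, hb⟩, hab⟩

/-- The end of the lift of a path to a given start. -/
noncomputable def liftEnd (h : IsDoubleCover Γ' Γ π) :
    {x y : Γ.Obj} → Γ.Path x y → {a // π a = x} → {b // π b = y}
  | _, _, .nil, a => a
  | _, _, .cons hxy γ, a => h.liftEnd γ (h.exists_next hxy a).choose

/-- The choice in `liftEnd` is immaterial because the lift of each step is unique. -/
theorem liftEnd_cons (h : IsDoubleCover Γ' Γ π) {x y z : Γ.Obj} (hxy : Γ.incGraph.Adj x y)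
    (γ : Γ.Path y z) (a : {a // π a = x}) (b : {b // π b = y}) (hab : Γ'.inc a.1 b.1) :
    h.liftEnd (.cons hxy γ) a = h.liftEnd γ b := by
  rw [liftEnd]
  congr 1
  exact Subtype.ext (h.eq_of_inc_inc (h.exists_next hxy a).choose_spec hab
    ((h.exists_next hxy a).choose.2.trans b.2.symm))

theorem liftEnd_append (h : IsDoubleCover Γ' Γ π) {x y z : Γ.Obj} (γ : Γ.Path x y)
    (δ : Γ.Path y z) (a : {a // π a = x}) :
    h.liftEnd (γ.append δ) a = h.liftEnd δ (h.liftEnd γ a) := by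
  induction γ with
  | nil => rfl
  | cons hxy γ ih => rw [Walk.cons_append, liftEnd, ih, liftEnd]

/-- A step and its return lift to the same incidence, and the triangle property closes up cycles of
length three. This makes the end of a lift a homotopy invariant. -/
theorem liftEnd_short_cycle (h : IsDoubleCover Γ' Γ π) {x : Γ.Obj} (γ : Γ.Path x x)
    (hγ : γ.length = 2 ∨ γ.length = 3) (a : {a // π a = x}) : h.liftEnd γ a = a := by
  cases γ with
  | nil => rfl
  | cons h₁ γ =>
    obtain ⟨b, hab⟩ := h.exists_next h₁ a
    rw [h.liftEnd_cons h₁ γ a b hab]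
    cases γ with
    | nil => simp at hγ
    | cons h₂ γ =>
      cases γ with
      | nil => rw [h.liftEnd_cons h₂ _ b a (Γ'.inc_symm _ _ hab)]; rfl
      | cons h₃ γ =>
        cases γ with
        | nil =>
          obtain ⟨c, hbc⟩ := h.exists_next h₂ b
          rw [h.liftEnd_cons h₂ _ b c hbc, h.liftEnd_cons h₃ _ c a]
          · rfl
          · refine Γ'.inc_symm _ _ (h.triangle _ _ _ hab hbc ?_)
            rw [a.2, c.2]
            exact Γ.inc_symm _ _ h₃.2
        | cons h₄ γ => simp at hγ

theorem liftEnd_congr (h : IsDoubleCover Γ' Γ π) {x y : Γ.Obj} {γ δ : Γ.Path x y}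
    (hγ : (Γ.homotopySetoid x y).r γ δ) (a : {a // π a = x}) : h.liftEnd γ a = h.liftEnd δ a := by
  induction hγ with
  | rel _ _ k =>
    cases k with
    | insert α c β hc => rw [liftEnd_append, liftEnd_append, liftEnd_append,
        h.liftEnd_short_cycle c hc]
  | refl _ => rfl
  | symm _ _ _ ih => exact ih.symm
  | trans _ _ _ _ _ ih₁ ih₂ => exact ih₁.trans ih₂

theorem exists_lift_path (h : IsDoubleCover Γ' Γ π) {x y : Γ.Obj} (γ : Γ.Path x y)
    (a : {a // π a = x}) : ∃ γ' : Γ'.Path a.1 (h.liftEnd γ a).1,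
      (γ'.map h.graphHom).copy a.2 (h.liftEnd γ a).2 = γ := by
  induction γ with
  | nil =>
    obtain ⟨a, rfl⟩ := a
    exact ⟨Walk.nil, rfl⟩
  | cons hxy γ ih =>
    obtain ⟨b, hab⟩ := h.exists_next hxy a
    obtain ⟨γ', hγ'⟩ := ih b
    rw [h.liftEnd_cons hxy γ a b hab]
    obtain ⟨a, rfl⟩ := a
    obtain ⟨b, rfl⟩ := b
    refine ⟨.cons ⟨fun e => hxy.1 (congrArg π e), hab⟩ γ', ?_⟩
    conv_rhs => rw [← hγ']
    have key : ∀ (e : Γ'.Obj) (δ : Γ'.Path b e) (z : Γ.Obj) (hz : π e = z),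
        ((Walk.cons (show Γ'.incGraph.Adj a b from ⟨fun e => hxy.1 (congrArg π e), hab⟩) δ).map
          h.graphHom).copy rfl hz = Walk.cons hxy ((δ.map h.graphHom).copy rfl hz) := by
      rintro _ _ _ rfl
      rfl
    exact key _ _ _ _

theorem liftEnd_map (h : IsDoubleCover Γ' Γ π) {a b : Γ'.Obj} (γ : Γ'.Path a b) :
    h.liftEnd (γ.map h.graphHom) ⟨a, rfl⟩ = ⟨b, rfl⟩ := by
  induction γ with
  | nil => rfl
  | cons hab γ ih =>
    rw [Walk.map_cons]
    exact (h.liftEnd_cons _ _ ⟨_, rfl⟩ ⟨_, rfl⟩ hab.2).trans ih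

theorem connected (h : IsDoubleCover Γ' Γ π) (hs : Γ'.SimplyConnected) : Γ.Connected := by
  refine (connected_iff _).2 ⟨fun x y => ?_, hs.1.nonempty.map π⟩
  obtain ⟨a, rfl⟩ := h.surjective x
  obtain ⟨b, rfl⟩ := h.surjective y
  exact (hs.1.preconnected a b).map h.graphHom

/-- A class is sent to the end of its lift from a fixed `a`. Two lifts with the same end are
homotopic since the cover is simply connected, which gives injectivity; paths in the connected cover
from `a` to the objects of the fiber give surjectivity. -/
theorem card_fundamentalGroup (h : IsDoubleCover Γ' Γ π) (hs : Γ'.SimplyConnected) (x : Γ.Obj) :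
    Nat.card (Γ.FundamentalGroup x) = 2 := by
  obtain ⟨a, b, hab, hfib⟩ := h.fiber_two x
  have ha : π a = x := (hfib a).2 (Or.inl rfl)
  have hcard : Nat.card {c // π c = x} = 2 := by
    have : {c | π c = x} = {a, b} := Set.ext hfib
    change Nat.card {c | π c = x} = 2
    rw [this, Nat.card_coe_set_eq, Set.ncard_pair hab]
  rw [← hcard]
  let Φ : Γ.FundamentalGroup x → {c // π c = x} :=
    Quotient.lift (fun γ => h.liftEnd γ ⟨a, ha⟩) fun γ δ hγ => h.liftEnd_congr hγ ⟨a, ha⟩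
  refine Nat.card_eq_of_bijective Φ ⟨fun c d => ?_, ?_⟩
  · induction c using Quotient.inductionOn with
    | h γ =>
      induction d using Quotient.inductionOn with
      | h δ =>
        intro e
        change h.liftEnd γ ⟨a, ha⟩ = h.liftEnd δ ⟨a, ha⟩ at e
        obtain ⟨γ', hγ'⟩ := h.exists_lift_path γ ⟨a, ha⟩
        obtain ⟨δ', hδ'⟩ := h.exists_lift_path δ ⟨a, ha⟩
        revert γ' δ'
        rw [← e]
        generalize h.liftEnd γ ⟨a, ha⟩ = c
        obtain ⟨c, hc⟩ := c
        intro γ' hγ' δ' hδ'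
        have hcycle : ∀ ε : Γ'.Path a a, (Γ'.homotopySetoid a a).r ε Walk.nil := fun ε =>
          Quotient.exact ((hs.2 a).elim (Quotient.mk _ ε) (Quotient.mk _ Walk.nil))
        have h1 : (Γ'.homotopySetoid a c).r γ' δ' := by
          have e1 := homotopy_append (hcycle (γ'.append δ'.reverse)) (Relation.EqvGen.refl δ')
          have e2 := homotopy_append (Relation.EqvGen.refl γ') (homotopy_reverse_append δ')
          rw [Walk.append_nil, Walk.append_assoc] at e2
          exact Relation.EqvGen.trans _ _ _ (Relation.EqvGen.symm _ _ e2) e1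
        have h2 := h.homotopic_map h1
        subst hγ' hδ'
        refine Quotient.sound ?_
        have key : ∀ (y z : Γ.Obj) (hy : π a = y) (hz : π c = z), (Γ.homotopySetoid y z).r
            ((γ'.map h.graphHom).copy hy hz) ((δ'.map h.graphHom).copy hy hz) := by
          rintro _ _ rfl rfl
          exact h2
        exact key _ _ _ _
  · rintro ⟨c, hc⟩
    obtain ⟨γ⟩ := hs.1.preconnected a c
    subst ha
    refine ⟨Quotient.mk _ ((γ.map h.graphHom).copy rfl hc), ?_⟩
    change h.liftEnd _ _ = _
    have := h.liftEnd_map γ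
    have key : ∀ (y : Γ.Obj) (hy : π c = y), h.liftEnd ((γ.map h.graphHom).copy rfl hy) ⟨a, rfl⟩ =
        ⟨c, hy⟩ := by
      rintro _ rfl
      exact this
    exact key _ hc

theorem fundamentalGroup_equiv (h : IsDoubleCover Γ' Γ π) (hs : Γ'.SimplyConnected) (x : Γ.Obj) :
    Nonempty (Γ.FundamentalGroup x ≃* Multiplicative (ZMod 2)) :=
  ⟨mulEquivOfPrimeCardEq (p := 2) (h.card_fundamentalGroup hs x) (by simp)⟩

end IsDoubleCover

end PreGeometry

/-! ### Symplectic coordinates adapted to `p` and `H` -/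

namespace SymplecticResidue

open Module LinearMap.BilinForm

variable {F : Type u} {V : Type v} [Field F] [AddCommGroup V] [Module F V]

/-- Coordinates of vectors of a symplectic `4`-space over the field with two elements. -/
abbrev Coords : Type := ZMod 2 × ZMod 2 × ZMod 2 × ZMod 2

/-- The symplectic form on `Coords`. -/
def form (x y : Coords) : ZMod 2 :=
  x.1 * y.2.1 + x.2.1 * y.1 + x.2.2.1 * y.2.2.2 + x.2.2.2 * y.2.2.1

/-- The symplectic form on the orthogonal sum of a hyperbolic plane and `Coords`. -/
def form6 (a b : ZMod 2 × ZMod 2 × Coords) : ZMod 2 :=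
  a.1 * b.2.1 + a.2.1 * b.1 + form a.2.2 b.2.2

/-- Coordinates of `V` with respect to a symplectic basis adapted to `p` and `H`. -/
structure Frame (s : LinearMap.BilinForm F V) (p H : Submodule F V) where
  φ : ZMod 2 ≃+* F
  vec : (ZMod 2 × ZMod 2 × Coords) ≃+ V
  s_vec : ∀ a b, s (vec a) (vec b) = φ (form6 a b)
  p_eq : p = Submodule.span F {vec (1, 0, 0)}
  mem_H : ∀ a, vec a ∈ H ↔ a.1 = 0

/-- Every nonzero vector of `S` is non-orthogonal to a vector of `S`. -/
def NondegOn (s : LinearMap.BilinForm F V) (S : Submodule F V) : Prop :=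
  ∀ k ∈ S, k ≠ 0 → ∃ l ∈ S, s k l ≠ 0

/-- Splitting off a hyperbolic plane: `v ↦ v - s k v • l + s l v • k` projects `S` onto the vectors
orthogonal to `k` and `l`, and changes `v` only by an element of the span of `k` and `l`. -/
theorem NondegOn.inf_orthogonal [FiniteDimensional F V] {s : LinearMap.BilinForm F V}
    (hs : s.IsAlt) {S : Submodule F V} (hS : NondegOn s S) {k l : V} (hk : k ∈ S) (hl : l ∈ S)
    (hkl : s k l = 1) :
    NondegOn s (S ⊓ s.orthogonal (Submodule.span F {k, l})) ∧
      finrank F S ≤ finrank F ↥(S ⊓ s.orthogonal (Submodule.span F {k, l})) + 2 := by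
  have hlk : s l k = -1 := by rw [← hs.neg_eq, hkl]
  have hmem : ∀ v, v ∈ s.orthogonal (Submodule.span F {k, l}) ↔ s k v = 0 ∧ s l v = 0 := by
    intro v
    constructor
    · intro h
      exact ⟨h k (Submodule.subset_span (by simp)), h l (Submodule.subset_span (by simp))⟩
    · rintro ⟨h1, h2⟩ n hn
      obtain ⟨a, b, rfl⟩ := Submodule.mem_span_pair.1 hn
      simp [h1, h2]
  have hproj : ∀ v ∈ S, v - s k v • l + s l v • k ∈
      S ⊓ s.orthogonal (Submodule.span F {k, l}) := by
    intro v hv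
    refine ⟨S.add_mem (S.sub_mem hv (S.smul_mem _ hl)) (S.smul_mem _ hk), (hmem _).2 ?_⟩
    simp [hkl, hlk, hs.self_eq_zero]
  constructor
  · rintro v ⟨hv, hv'⟩ hv0
    obtain ⟨w, hw, hvw⟩ := hS v hv hv0
    refine ⟨_, hproj w hw, ?_⟩
    have h1 := (hmem v).1 hv'
    have h2 : s v k = 0 := (hs.eq_iff).1 h1.1
    have h3 : s v l = 0 := (hs.eq_iff).1 h1.2
    simpa [h2, h3] using hvw
  · have hle : S ≤ (S ⊓ s.orthogonal (Submodule.span F {k, l})) ⊔ Submodule.span F {k, l} := by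
      intro v hv
      refine Submodule.mem_sup.2 ⟨_, hproj v hv, s k v • l - s l v • k, ?_, by abel⟩
      exact Submodule.mem_span_pair.2 ⟨-s l v, s k v, by simp; abel⟩
    have h1 := Submodule.finrank_mono hle
    have h2 := Submodule.finrank_add_le_finrank_add_finrank
      (S ⊓ s.orthogonal (Submodule.span F {k, l})) (Submodule.span F {k, l})
    have h3 : finrank F ↥(Submodule.span F {k, l}) ≤ 2 := by
      classical
      have := finrank_span_finset_le_card (R := F) ({k, l} : Finset V)
      simp only [Finset.coe_insert, Finset.coe_singleton] at this
      exact this.trans Finset.card_le_two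
    omega

theorem eq_one_of_ne_zero (hF : Nat.card F = 2) {c : F} (hc : c ≠ 0) : c = 1 := by
  have : Finite F := Nat.finite_of_card_ne_zero (by omega)
  have := Fintype.ofFinite F
  rw [Nat.card_eq_fintype_card] at hF
  have h := FiniteField.pow_card_sub_one_eq_one c hc
  simpa [hF] using h

theorem NondegOn.exists_pair [FiniteDimensional F V] (hF : Nat.card F = 2)
    {s : LinearMap.BilinForm F V} {S : Submodule F V} (hS : NondegOn s S)
    (h : 0 < finrank F S) : ∃ k ∈ S, ∃ l ∈ S, s k l = 1 := by
  obtain ⟨k, hk, hk0⟩ := S.ne_bot_iff.1 (Submodule.one_le_finrank_iff.1 h)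
  obtain ⟨l, hl, hkl⟩ := hS k hk hk0
  exact ⟨k, hk, l, hl, eq_one_of_ne_zero hF hkl⟩

/-- The first hyperbolic pair is `e`, spanning `p`, and `r`, spanning `H^⊥`. Then `H` is the
hyperplane `r^⊥`, so the coefficient of `e` detects `H` and the coefficient of `r` detects `p^⊥`.
Two further hyperbolic pairs complete the basis. -/
theorem exists_frame (hF : Nat.card F = 2) (hV : finrank F V = 6)
    (s : LinearMap.BilinForm F V) (hs : s.IsAlt) (hnd : s.Nondegenerate)
    (p H : Submodule F V) (hp : finrank F p = 1) (hpH : IsCompl p H) : Nonempty (Frame s p H) := by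
  have : FiniteDimensional F V := FiniteDimensional.of_finrank_pos (by omega)
  have : Finite F := Nat.finite_of_card_ne_zero (by omega)
  have : Finite V := Module.finite_of_finite F
  have := Fintype.ofFinite F
  have hFc : Fintype.card F = 2 := by rw [← Nat.card_eq_fintype_card, hF]
  let φ : ZMod 2 ≃+* F := ZMod.ringEquivOfPrime F Nat.prime_two hFc
  obtain ⟨e, he, he0⟩ := p.ne_bot_iff.1 (Submodule.one_le_finrank_iff.1 hp.ge)
  have hpe : p = Submodule.span F {e} := by
    symm
    refine Submodule.eq_of_le_of_finrank_eq ((Submodule.span_singleton_le_iff_mem _ _).2 he) ?_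
    rw [hp, finrank_span_singleton he0]
  have hH : finrank F H = 5 := by
    have := Submodule.finrank_add_eq_of_isCompl hpH
    omega
  have hperp : finrank F (s.orthogonal H) = 1 := by
    rw [LinearMap.BilinForm.finrank_orthogonal hnd, hV, hH]
  obtain ⟨r, hr, hr0⟩ := (s.orthogonal H).ne_bot_iff.1 (Submodule.one_le_finrank_iff.1 hperp.ge)
  have hdec : ∀ v, ∃ c : F, ∃ h ∈ H, v = c • e + h := by
    intro v
    have hv : v ∈ p ⊔ H := by rw [hpH.sup_eq_top]; trivial
    obtain ⟨a, ha, h, hh, rfl⟩ := Submodule.mem_sup.1 hv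
    rw [hpe] at ha
    obtain ⟨c, rfl⟩ := Submodule.mem_span_singleton.1 ha
    exact ⟨c, h, hh, rfl⟩
  have hrH : ∀ h ∈ H, s h r = 0 := fun h hh => hr h hh
  have hndT : NondegOn s ⊤ := by
    intro k _ hk
    by_contra! hcon
    exact hk (hnd.1 k fun l => hcon l trivial)
  -- If `s e r` were zero, `r` would be orthogonal to `p` and to `H`, hence to all of `V`.
  have her : s e r = 1 := by
    refine eq_one_of_ne_zero hF fun h0 => hr0 (hnd.2 r fun v => ?_)
    obtain ⟨c, h, hh, rfl⟩ := hdec v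
    simp [h0, hrH h hh]
  have hmemH : ∀ v, v ∈ H ↔ s v r = 0 := by
    intro v
    refine ⟨hrH v, fun hv => ?_⟩
    obtain ⟨c, h, hh, rfl⟩ := hdec v
    have : c = 0 := by simpa [her, hrH h hh] using hv
    simpa [this] using hh
  obtain ⟨n1, d1⟩ := hndT.inf_orthogonal hs (k := e) (l := r) trivial trivial her
  set S1 := (⊤ : Submodule F V) ⊓ s.orthogonal (Submodule.span F {e, r}) with hS1
  rw [finrank_top, hV] at d1
  obtain ⟨e1, he1, f1, hf1, h1⟩ := n1.exists_pair hF (by omega)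
  obtain ⟨n2, d2⟩ := n1.inf_orthogonal hs he1 hf1 h1
  set S2 := S1 ⊓ s.orthogonal (Submodule.span F {e1, f1}) with hS2
  obtain ⟨e2, he2, f2, hf2, h2⟩ := n2.exists_pair hF (by omega)
  have o1 : ∀ v ∈ S1, s e v = 0 ∧ s r v = 0 := fun v hv =>
    ⟨hv.2 e (Submodule.subset_span (by simp)), hv.2 r (Submodule.subset_span (by simp))⟩
  have o2 : ∀ v ∈ S2, s e1 v = 0 ∧ s f1 v = 0 := fun v hv =>
    ⟨hv.2 e1 (Submodule.subset_span (by simp)), hv.2 f1 (Submodule.subset_span (by simp))⟩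
  have flip : ∀ {a b : V}, s a b = 0 → s b a = 0 := fun h => (hs.eq_iff).1 h
  have neg1 : (-1 : F) = 1 := by
    rw [← map_one φ, ← map_neg φ]
    exact congrArg φ (by decide)
  have flip1 : ∀ {a b : V}, s a b = 1 → s b a = 1 := fun {a b} h => by
    rw [← hs.neg_eq, h, neg1]
  let f : (ZMod 2 × ZMod 2 × Coords) →+ V :=
    { toFun := fun a => φ a.1 • e + φ a.2.1 • r + φ a.2.2.1 • e1 + φ a.2.2.2.1 • f1 +
        φ a.2.2.2.2.1 • e2 + φ a.2.2.2.2.2 • f2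
      map_zero' := by simp
      map_add' := fun a b => by
        simp only [Prod.fst_add, Prod.snd_add, map_add, add_smul]
        abel }
  have sf : ∀ a b, s (f a) (f b) = φ (form6 a b) := by
    intro a b
    have a1 := o1 e1 he1
    have a2 := o1 f1 hf1
    have a3 := o1 e2 he2.1
    have a4 := o1 f2 hf2.1
    have a5 := o2 e2 he2
    have a6 := o2 f2 hf2
    change s (φ a.1 • e + φ a.2.1 • r + φ a.2.2.1 • e1 + φ a.2.2.2.1 • f1 +
        φ a.2.2.2.2.1 • e2 + φ a.2.2.2.2.2 • f2) (φ b.1 • e + φ b.2.1 • r + φ b.2.2.1 • e1 +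
        φ b.2.2.2.1 • f1 + φ b.2.2.2.2.1 • e2 + φ b.2.2.2.2.2 • f2) = _
    simp only [map_add, LinearMap.add_apply, map_smul, LinearMap.smul_apply, hs.self_eq_zero,
      a1, a2, a3, a4, a5, a6, flip a1.1, flip a1.2, flip a2.1, flip a2.2, flip a3.1, flip a3.2,
      flip a4.1, flip a4.2, flip a5.1, flip a5.2, flip a6.1, flip a6.2, h1, h2, her, flip1 h1,
      flip1 h2, flip1 her, form6, form, map_mul, smul_eq_mul]
    ring
  have nondeg : ∀ a, (∀ b, form6 a b = 0) → a = 0 := by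
    rintro ⟨a1, a2, a3, a4, a5, a6⟩ h
    have b1 := h (0, 1, 0)
    have b2 := h (1, 0, 0)
    have b3 := h (0, 0, 0, 1, 0, 0)
    have b4 := h (0, 0, 1, 0, 0, 0)
    have b5 := h (0, 0, 0, 0, 0, 1)
    have b6 := h (0, 0, 0, 0, 1, 0)
    simp [form6, form] at b1 b2 b3 b4 b5 b6
    simp [b1, b2, b3, b4, b5, b6]
  -- A coordinate vector in the kernel is orthogonal to everything under the non-degenerate `form6`.
  -- Bijectivity then follows by counting 64 vectors on both sides.
  have finj : Function.Injective f := by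
    rw [injective_iff_map_eq_zero]
    intro a ha
    refine nondeg a fun b => φ.injective ?_
    rw [← sf, ha]
    simp
  have fbij : Function.Bijective f := by
    refine (Nat.bijective_iff_injective_and_card f).2 ⟨finj, ?_⟩
    rw [Module.natCard_eq_pow_finrank (K := F) (V := V), hV, hF]
    simp
  refine ⟨φ, AddEquiv.ofBijective f fbij, sf, ?_, ?_⟩
  · rw [hpe]
    congr
    simp [f]
  · intro a
    have hfr : f (0, 1, 0) = r := by simp [f]
    change f a ∈ H ↔ _
    rw [hmemH, ← hfr, sf]
    simp [form6, form]

/-! ### The symplectic form on the 4-space of coordinates -/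

theorem zmod_two_cases (c : ZMod 2) : c = 0 ∨ c = 1 := by
  revert c; decide

theorem zmod_two_ne_zero {c : ZMod 2} : c ≠ 0 ↔ c = 1 := by
  revert c; decide

theorem coords_add_self (x : Coords) : x + x = 0 := by
  revert x; decide

theorem coords_add_add_cancel (x y : Coords) : x + (x + y) = y := by
  rw [← add_assoc, coords_add_self, zero_add]

theorem coords_add_eq_zero {x y : Coords} : x + y = 0 ↔ x = y := by
  constructor
  · intro h
    rw [← coords_add_add_cancel x y, h, add_zero]
  · rintro rfl
    exact coords_add_self x

theorem form_add_left (x y z : Coords) : form (x + y) z = form x z + form y z := by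
  simp only [form, Prod.fst_add, Prod.snd_add]; ring

theorem form_add_right (x y z : Coords) : form x (y + z) = form x y + form x z := by
  simp only [form, Prod.fst_add, Prod.snd_add]; ring

theorem form_self (x : Coords) : form x x = 0 := by
  revert x; decide

theorem form_comm (x y : Coords) : form x y = form y x := by
  simp only [form]; ring

theorem form_zero_left (x : Coords) : form 0 x = 0 := by
  simp [form]

theorem form_zero_right (x : Coords) : form x 0 = 0 := by
  simp [form]

-- The radical of the hyperplane `t^⊥` is `(t^⊥)^⊥ = ⟨t⟩`.
set_option synthInstance.maxSize 1000 in
theorem eq_zero_or_eq_of_form : ∀ t : Coords, t ≠ 0 → ∀ d, form d t = 0 →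
    (∀ e, form e t = 0 → form d e = 0) → d = 0 ∨ d = t := by
  decide +kernel

/-- An affine hyperplane missing the origin spans the whole space. -/
theorem eq_zero_of_form : ∀ t : Coords, t ≠ 0 → ∀ d,
    (∀ e, form e t = 1 → form d e = 0) → d = 0 := by
  decide +kernel

theorem card_form_eq : ∀ t : Coords, t ≠ 0 → ∀ ε,
    (Finset.univ.filter fun x => form x t = ε).card = 8 := by
  decide +kernel

theorem ncard_form_eq {t : Coords} (ht : t ≠ 0) (ε : ZMod 2) :
    {x | form x t = ε}.ncard = 8 := by
  rw [← card_form_eq t ht ε, ← Set.ncard_coe_finset]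
  congr
  ext
  simp

theorem exists_form_eq {t : Coords} (ht : t ≠ 0) (ε : ZMod 2) : ∃ x, form x t = ε := by
  have : {x | form x t = ε}.Nonempty := by
    rw [← Set.ncard_pos, ncard_form_eq ht]
    norm_num
  exact this

theorem mem_rad (s : LinearMap.BilinForm F V) (hs : s.IsAlt) (U : Submodule F V) (v : V) :
    v ∈ rad s U ↔ v ∈ U ∧ ∀ u ∈ U, s v u = 0 :=
  and_congr_right fun _ => forall₂_congr fun _ _ => hs.eq_iff

/-! ### Subspaces of `H` and their traces on the affine space `H \ p^⊥` -/

namespace Frame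

variable {s : LinearMap.BilinForm F V} {p H : Submodule F V}

/-- The vectors of `H` not in `p^⊥`. -/
def pt (f : Frame s p H) (x : Coords) : V := f.vec (0, 1, x)

/-- The vectors of `H` in `p^⊥`. -/
def dir (f : Frame s p H) (x : Coords) : V := f.vec (0, 0, x)

/-- The trace of a subspace on the affine space `H \ p^⊥`. -/
def trace (f : Frame s p H) (U : Submodule F V) : Set Coords := {x | f.pt x ∈ U}

theorem mem_trace (f : Frame s p H) {U : Submodule F V} {x : Coords} :
    x ∈ f.trace U ↔ f.pt x ∈ U := Iff.rfl

theorem isAlt (f : Frame s p H) : s.IsAlt := by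
  intro v
  obtain ⟨a, rfl⟩ := f.vec.surjective v
  have : form6 a a = 0 := by
    rw [form6, form_self, mul_comm a.2.1, add_zero]
    generalize a.1 * a.2.1 = c
    revert c; decide
  rw [f.s_vec, this, map_zero]

theorem scalar_cases (f : Frame s p H) (c : F) : c = 0 ∨ c = 1 := by
  obtain ⟨z, rfl⟩ := f.φ.surjective c
  rcases zmod_two_cases z with rfl | rfl <;> simp

theorem mem_span_singleton (f : Frame s p H) {v w : V} :
    w ∈ Submodule.span F {v} ↔ w = 0 ∨ w = v := by
  rw [Submodule.mem_span_singleton]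
  constructor
  · rintro ⟨c, rfl⟩
    rcases f.scalar_cases c with rfl | rfl <;> simp
  · rintro (rfl | rfl)
    exacts [⟨0, zero_smul _ _⟩, ⟨1, one_smul _ _⟩]

theorem mem_orthogonal_p (f : Frame s p H) (a) : f.vec a ∈ s.orthogonal p ↔ a.2.1 = 0 := by
  have hp : ∀ v, v ∈ p ↔ v = 0 ∨ v = f.vec (1, 0, 0) := fun v => by
    rw [← f.mem_span_singleton, ← f.p_eq]
  rw [LinearMap.BilinForm.mem_orthogonal_iff]
  constructor
  · intro h
    have h1 := h _ ((hp _).2 (Or.inr rfl))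
    change s _ _ = 0 at h1
    rw [f.s_vec, map_eq_zero_iff _ f.φ.injective] at h1
    simpa [form6, form] using h1
  · intro h n hn
    change s n _ = 0
    rcases (hp n).1 hn with rfl | rfl
    · simp
    · rw [f.s_vec, map_eq_zero_iff _ f.φ.injective]
      simpa [form6, form] using h

/-- On `H` the form depends only on the `Coords` part, since `pt 0` spans `H^⊥`. The same holds for
the next three lemmas. -/
theorem s_pt_pt (f : Frame s p H) (x y : Coords) : s (f.pt x) (f.pt y) = f.φ (form x y) := by
  simp [pt, f.s_vec, form6]

theorem s_dir_pt (f : Frame s p H) (x y : Coords) : s (f.dir x) (f.pt y) = f.φ (form x y) := by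
  simp [pt, dir, f.s_vec, form6]

theorem s_dir_dir (f : Frame s p H) (x y : Coords) : s (f.dir x) (f.dir y) = f.φ (form x y) := by
  simp [dir, f.s_vec, form6]

theorem s_pt_dir (f : Frame s p H) (x y : Coords) : s (f.pt x) (f.dir y) = f.φ (form x y) := by
  simp [pt, dir, f.s_vec, form6]

theorem pt_add_pt (f : Frame s p H) (x y : Coords) : f.pt x + f.pt y = f.dir (x + y) := by
  rw [pt, pt, ← map_add]
  rfl

theorem pt_add_dir (f : Frame s p H) (x y : Coords) : f.pt x + f.dir y = f.pt (x + y) := by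
  rw [pt, dir, ← map_add]
  rfl

theorem dir_add_dir (f : Frame s p H) (x y : Coords) : f.dir x + f.dir y = f.dir (x + y) := by
  rw [dir, dir, ← map_add]
  rfl

theorem pt_injective (f : Frame s p H) : Function.Injective f.pt := fun x y h => by
  have := f.vec.injective h
  simpa using this

theorem dir_injective (f : Frame s p H) : Function.Injective f.dir := fun x y h => by
  have := f.vec.injective h
  simpa using this

theorem dir_zero (f : Frame s p H) : f.dir 0 = 0 := map_zero f.vec

theorem pt_mem_H (f : Frame s p H) (x : Coords) : f.pt x ∈ H := (f.mem_H _).2 rfl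

theorem pt_notMem_orthogonal (f : Frame s p H) (x : Coords) : f.pt x ∉ s.orthogonal p := by
  simp [pt, f.mem_orthogonal_p]

theorem dir_mem_orthogonal (f : Frame s p H) (x : Coords) : f.dir x ∈ s.orthogonal p := by
  simp [dir, f.mem_orthogonal_p]

theorem eq_pt_or_dir (f : Frame s p H) {v : V} (hv : v ∈ H) :
    (∃ x, v = f.pt x) ∨ ∃ x, v = f.dir x := by
  obtain ⟨⟨α, β, x⟩, rfl⟩ := f.vec.surjective v
  have h : α = 0 := (f.mem_H _).1 hv
  subst h
  rcases zmod_two_cases β with rfl | rfl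
  exacts [Or.inr ⟨x, rfl⟩, Or.inl ⟨x, rfl⟩]

theorem exists_eq_dir (f : Frame s p H) {v : V} (hv : v ∈ H) (hp : v ∈ s.orthogonal p) :
    ∃ x, v = f.dir x := by
  refine (f.eq_pt_or_dir hv).resolve_left ?_
  rintro ⟨x, rfl⟩
  exact f.pt_notMem_orthogonal x hp

theorem exists_eq_pt (f : Frame s p H) {v : V} (hv : v ∈ H) (hp : v ∉ s.orthogonal p) :
    ∃ x, v = f.pt x := by
  refine (f.eq_pt_or_dir hv).resolve_right ?_
  rintro ⟨x, rfl⟩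
  exact hp (f.dir_mem_orthogonal x)

theorem trace_nonempty (f : Frame s p H) {U : Submodule F V} (hU : U ≤ H)
    (hp : ¬ U ≤ s.orthogonal p) : (f.trace U).Nonempty := by
  obtain ⟨v, hv, hvp⟩ := SetLike.not_le_iff_exists.1 hp
  obtain ⟨x, rfl⟩ := f.exists_eq_pt (hU hv) hvp
  exact ⟨x, hv⟩

theorem not_le_orthogonal (f : Frame s p H) {U : Submodule F V} {x : Coords}
    (h : x ∈ f.trace U) : ¬ U ≤ s.orthogonal p := fun hp => f.pt_notMem_orthogonal x (hp h)

theorem dir_mem_iff (f : Frame s p H) {U : Submodule F V} {x y : Coords} (hx : x ∈ f.trace U) :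
    f.dir y ∈ U ↔ x + y ∈ f.trace U := by
  constructor
  · intro h
    rw [mem_trace, ← pt_add_dir]
    exact U.add_mem hx h
  · intro h
    have := U.add_mem hx h
    rwa [pt_add_pt, coords_add_add_cancel] at this

theorem dir_add_mem (f : Frame s p H) {U : Submodule F V} {x y : Coords} (hx : x ∈ f.trace U)
    (hy : y ∈ f.trace U) : f.dir (x + y) ∈ U := by
  rw [← pt_add_pt]
  exact U.add_mem hx hy

theorem add_add_mem_trace (f : Frame s p H) {U : Submodule F V} {x y z : Coords}
    (hx : x ∈ f.trace U) (hy : y ∈ f.trace U) (hz : z ∈ f.trace U) : x + y + z ∈ f.trace U := by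
  rw [add_assoc]
  exact (f.dir_mem_iff hx).1 (f.dir_add_mem hy hz)

/-- A subspace of `H` not contained in `p^⊥` is generated by its vectors off `p^⊥`: every direction
is a sum of two of them. -/
theorem le_iff_trace_subset (f : Frame s p H) {U W : Submodule F V} (hU : U ≤ H)
    (hp : ¬ U ≤ s.orthogonal p) : U ≤ W ↔ f.trace U ⊆ f.trace W := by
  constructor
  · exact fun h x hx => h hx
  · intro h v hv
    rcases f.eq_pt_or_dir (hU hv) with ⟨x, rfl⟩ | ⟨x, rfl⟩
    · exact h hv
    · obtain ⟨y, hy⟩ := f.trace_nonempty hU hp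
      have := f.dir_add_mem (h hy) (h ((f.dir_mem_iff hy).1 hv))
      rwa [coords_add_add_cancel] at this

theorem natCard_eq_two (f : Frame s p H) : Nat.card F = 2 := by
  rw [← Nat.card_congr f.φ.toEquiv]
  simp

theorem finiteDimensional (f : Frame s p H) : FiniteDimensional F V := by
  have : Finite V := Finite.of_equiv _ f.vec.toEquiv
  infer_instance

theorem finite (f : Frame s p H) : Finite V := Finite.of_equiv _ f.vec.toEquiv

/-- Translation by one trace point matches the vectors of `U` in `p^⊥` with those outside, so the
trace is half of `U`. -/
theorem two_pow_finrank (f : Frame s p H) {U : Submodule F V} (hU : U ≤ H)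
    (hp : ¬ U ≤ s.orthogonal p) : 2 ^ finrank F U = 2 * (f.trace U).ncard := by
  have := f.finite
  have := f.finiteDimensional
  obtain ⟨x, hx⟩ := f.trace_nonempty hU hp
  have h : (U : Set V) = f.pt '' f.trace U ∪ (fun y => f.dir (x + y)) '' f.trace U := by
    ext v
    constructor
    · intro hv
      rcases f.eq_pt_or_dir (hU hv) with ⟨y, rfl⟩ | ⟨y, rfl⟩
      · exact Or.inl ⟨y, hv, rfl⟩
      · exact Or.inr ⟨x + y, (f.dir_mem_iff hx).1 hv, by simp only [coords_add_add_cancel]⟩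
    · rintro (⟨y, hy, rfl⟩ | ⟨y, hy, rfl⟩)
      exacts [hy, f.dir_add_mem hx hy]
  have hd : Disjoint (f.pt '' f.trace U) ((fun y => f.dir (x + y)) '' f.trace U) := by
    rw [Set.disjoint_left]
    rintro _ ⟨y, -, rfl⟩ ⟨z, -, e⟩
    apply f.pt_notMem_orthogonal y
    rw [← e]
    exact f.dir_mem_orthogonal _
  have := Module.natCard_eq_pow_finrank (K := F) (V := U)
  rw [f.natCard_eq_two] at this
  rw [← this]
  change Nat.card (U : Set V) = _
  rw [Nat.card_coe_set_eq, h, Set.ncard_union_eq hd, Set.ncard_image_of_injective _ f.pt_injective,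
    Set.ncard_image_of_injective _ (fun y z e => add_left_cancel (f.dir_injective e)), two_mul]

/-- The subspace of `H` with a given trace. -/
def ofTrace (f : Frame s p H) (A : Set Coords) (hA : A.Nonempty)
    (h : ∀ x ∈ A, ∀ y ∈ A, ∀ z ∈ A, x + y + z ∈ A) : Submodule F V where
  carrier := {v | (∃ x ∈ A, v = f.pt x) ∨ ∃ x ∈ A, ∃ y ∈ A, v = f.dir (x + y)}
  zero_mem' := by
    obtain ⟨x, hx⟩ := hA
    exact Or.inr ⟨x, hx, x, hx, by rw [coords_add_self, dir_zero]⟩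
  add_mem' := by
    rintro _ _ (⟨x, hx, rfl⟩ | ⟨x, hx, y, hy, rfl⟩) (⟨z, hz, rfl⟩ | ⟨z, hz, t, ht, rfl⟩)
    · exact Or.inr ⟨x, hx, z, hz, f.pt_add_pt x z⟩
    · exact Or.inl ⟨x + z + t, h x hx z hz t ht, by rw [pt_add_dir, add_assoc]⟩
    · exact Or.inl ⟨x + y + z, h x hx y hy z hz, by rw [add_comm, pt_add_dir, add_comm]⟩
    · exact Or.inr ⟨x + y + z, h x hx y hy z hz, t, ht, by rw [dir_add_dir]; congr 1; abel⟩
  smul_mem' := by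
    intro c v hv
    rcases f.scalar_cases c with rfl | rfl
    · obtain ⟨x, hx⟩ := hA
      exact Or.inr ⟨x, hx, x, hx, by rw [coords_add_self, dir_zero, zero_smul]⟩
    · rwa [one_smul]

theorem trace_ofTrace (f : Frame s p H) (A : Set Coords) (hA : A.Nonempty)
    (h : ∀ x ∈ A, ∀ y ∈ A, ∀ z ∈ A, x + y + z ∈ A) : f.trace (f.ofTrace A hA h) = A := by
  ext x
  constructor
  · rintro (⟨y, hy, e⟩ | ⟨y, hy, z, hz, e⟩)
    · rwa [f.pt_injective e]
    · exact absurd (e ▸ f.dir_mem_orthogonal _) (f.pt_notMem_orthogonal x)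
  · exact fun hx => Or.inl ⟨x, hx, rfl⟩

theorem ofTrace_le (f : Frame s p H) (A : Set Coords) (hA : A.Nonempty)
    (h : ∀ x ∈ A, ∀ y ∈ A, ∀ z ∈ A, x + y + z ∈ A) : f.ofTrace A hA h ≤ H := by
  rintro _ (⟨y, hy, rfl⟩ | ⟨y, hy, z, hz, rfl⟩)
  exacts [f.pt_mem_H y, (f.mem_H _).2 rfl]

theorem pt_mem_rad (f : Frame s p H) {U : Submodule F V} (hU : U ≤ H) {x : Coords} :
    f.pt x ∈ rad s U ↔ x ∈ f.trace U ∧ ∀ y ∈ f.trace U, form x y = 0 := by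
  rw [mem_rad s f.isAlt]
  refine and_congr_right fun hx => ⟨fun h y hy => ?_, fun h v hv => ?_⟩
  · have := h _ hy
    rwa [s_pt_pt, map_eq_zero_iff _ f.φ.injective] at this
  · rcases f.eq_pt_or_dir (hU hv) with ⟨y, rfl⟩ | ⟨y, rfl⟩
    · rw [s_pt_pt, h y hv, map_zero]
    · have := h _ ((f.dir_mem_iff hx).1 hv)
      rw [form_add_right, form_self, zero_add] at this
      rw [s_pt_dir, this, map_zero]

theorem dir_mem_rad (f : Frame s p H) {U : Submodule F V} (hU : U ≤ H)
    (hp : ¬ U ≤ s.orthogonal p) {x : Coords} :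
    f.dir x ∈ rad s U ↔ f.dir x ∈ U ∧ ∀ y ∈ f.trace U, form x y = 0 := by
  obtain ⟨z, hz⟩ := f.trace_nonempty hU hp
  rw [mem_rad s f.isAlt]
  refine and_congr_right fun hx => ⟨fun h y hy => ?_, fun h v hv => ?_⟩
  · have := h _ hy
    rwa [s_dir_pt, map_eq_zero_iff _ f.φ.injective] at this
  · rcases f.eq_pt_or_dir (hU hv) with ⟨y, rfl⟩ | ⟨y, rfl⟩
    · rw [s_dir_pt, h y hv, map_zero]
    · have := h _ ((f.dir_mem_iff hz).1 hv)
      rw [form_add_right, h z hz, zero_add] at this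
      rw [s_dir_dir, this, map_zero]

theorem rad_eq_bot (f : Frame s p H) {U : Submodule F V} (hU : U ≤ H)
    (hp : ¬ U ≤ s.orthogonal p) (h1 : ∀ x ∈ f.trace U, ∃ y ∈ f.trace U, form x y ≠ 0)
    (h2 : ∀ x, f.dir x ∈ U → x ≠ 0 → ∃ y ∈ f.trace U, form x y ≠ 0) : rad s U = ⊥ := by
  rw [eq_bot_iff]
  intro v hv
  rcases f.eq_pt_or_dir (hU hv.1) with ⟨x, rfl⟩ | ⟨x, rfl⟩
  · rw [f.pt_mem_rad hU] at hv
    obtain ⟨y, hy, hxy⟩ := h1 x hv.1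
    exact absurd (hv.2 y hy) hxy
  · rw [f.dir_mem_rad hU hp] at hv
    by_cases hx : x = 0
    · rw [hx, dir_zero]
      exact Submodule.zero_mem _
    · obtain ⟨y, hy, hxy⟩ := h2 x hv.1 hx
      exact absurd (hv.2 y hy) hxy

/-- The directions in a solid with normal `t` form `t^⊥`, whatever `ε` is, and its radical is `⟨t⟩`.
Hence the point `r` in the definition of incidence and of the partitions is the direction `t`. -/
theorem dir_mem_rad_inf (f : Frame s p H) {U : Submodule F V} (hU : U ≤ H) {t : Coords} (ht : t ≠ 0)
    {ε : ZMod 2} (h : f.trace U = {x | form x t = ε}) (d : Coords) :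
    f.dir d ∈ rad s (U ⊓ s.orthogonal p) ↔ d = 0 ∨ d = t := by
  have hmem : ∀ e, f.dir e ∈ U ⊓ s.orthogonal p ↔ form e t = 0 := by
    intro e
    obtain ⟨x, hx⟩ := exists_form_eq ht ε
    have hxU : x ∈ f.trace U := by rw [h]; exact hx
    rw [Submodule.mem_inf, and_iff_left (f.dir_mem_orthogonal e), f.dir_mem_iff hxU, h,
      Set.mem_ofPred_eq, form_add_left, hx]
    simp
  rw [mem_rad s f.isAlt, hmem]
  constructor
  · rintro ⟨h1, h2⟩
    refine eq_zero_or_eq_of_form t ht d h1 fun e he => ?_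
    have := h2 _ ((hmem e).2 he)
    rwa [s_dir_dir, map_eq_zero_iff _ f.φ.injective] at this
  · intro hd
    have key : form d t = 0 ∧ ∀ e, form e t = 0 → form d e = 0 := by
      rcases hd with rfl | rfl
      · exact ⟨form_zero_left _, fun e _ => form_zero_left _⟩
      · exact ⟨form_self _, fun e he => by rw [form_comm, he]⟩
    refine ⟨key.1, fun v hv => ?_⟩
    obtain ⟨e, rfl⟩ := f.exists_eq_dir (hU hv.1) hv.2
    rw [s_dir_dir, key.2 e ((hmem e).1 hv), map_zero]

theorem finrank_eq (f : Frame s p H) : finrank F V = 6 := by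
  have := f.finite
  have := f.finiteDimensional
  have h := Module.natCard_eq_pow_finrank (K := F) (V := V)
  rw [f.natCard_eq_two, ← Nat.card_congr f.vec.toEquiv] at h
  simp only [Nat.card_prod, Nat.card_zmod] at h
  exact Nat.pow_right_injective le_rfl (h.symm.trans (by norm_num))

theorem nondegenerate (f : Frame s p H) : s.Nondegenerate := by
  have key : ∀ v, (∀ w, s v w = 0) → v = 0 := by
    intro v h
    obtain ⟨⟨a1, a2, a3, a4, a5, a6⟩, rfl⟩ := f.vec.surjective v
    have h' : ∀ b, form6 (a1, a2, a3, a4, a5, a6) b = 0 := fun b => by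
      have := h (f.vec b)
      rwa [f.s_vec, map_eq_zero_iff _ f.φ.injective] at this
    have b1 := h' (0, 1, 0)
    have b2 := h' (1, 0, 0)
    have b3 := h' (0, 0, 0, 1, 0, 0)
    have b4 := h' (0, 0, 1, 0, 0, 0)
    have b5 := h' (0, 0, 0, 0, 0, 1)
    have b6 := h' (0, 0, 0, 0, 1, 0)
    simp [form6, form] at b1 b2 b3 b4 b5 b6
    simp only [b1, b2, b3, b4, b5, b6]
    exact map_zero f.vec
  exact ⟨key, fun v h => key v fun w => (f.isAlt.eq_iff).1 (h w)⟩

theorem rad_top (f : Frame s p H) : rad s ⊤ = ⊥ := by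
  rw [eq_bot_iff]
  intro v hv
  rw [mem_rad s f.isAlt] at hv
  exact f.nondegenerate.1 v fun w => hv.2 w trivial

end Frame

/-! ### The traces of the objects of `Π(p,H)` -/

set_option synthInstance.maxSize 1000 in
theorem form_eq_one_of_form_eq_zero : ∀ t : Coords, t ≠ 0 → ∀ u, form u t = 0 → u ≠ 0 → u ≠ t →
    ∀ v, form v t = 0 → v ≠ 0 → v ≠ t → u + v ≠ 0 → u + v ≠ t → form u v = 1 := by
  decide +kernel

set_option synthInstance.maxSize 1000 in
theorem exists_form_eq_ne : ∀ t : Coords, t ≠ 0 → ∀ x : Coords, ∃ z, form z t = form x t ∧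
    x + z ≠ 0 ∧ x + z ≠ t := by
  decide +kernel

/-- The right side is symmetric in the three points, so hyperbolicity of the direction space may be
tested from any of them. -/
theorem form_add_add_eq_one_iff {x y z : Coords} :
    form (x + y) (x + z) = 1 ↔ form x y + form y z + form x z = 1 := by
  simp only [form_add_left, form_add_right, form_self, form_comm y x]
  generalize form x y = a
  generalize form y z = b
  generalize form x z = c
  revert a b c; decide

theorem form_of_mem_plane {a b c x y z : Coords} (h : form (a + b) (a + c) = 1)
    (hx : x ∈ ({a, b, c, a + b + c} : Set Coords)) (hy : y ∈ ({a, b, c, a + b + c} : Set Coords))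
    (hz : z ∈ ({a, b, c, a + b + c} : Set Coords)) (hxy : x ≠ y) (hxz : x ≠ z) (hyz : y ≠ z) :
    form (x + y) (x + z) = 1 := by
  rw [form_add_add_eq_one_iff] at h ⊢
  obtain ⟨P, hP⟩ : ∃ P, form a b = P := ⟨_, rfl⟩
  obtain ⟨Q, hQ⟩ : ∃ Q, form b c = Q := ⟨_, rfl⟩
  obtain ⟨R, hR⟩ : ∃ R, form a c = R := ⟨_, rfl⟩
  have hP' : form b a = P := (form_comm _ _).trans hP
  have hQ' : form c b = Q := (form_comm _ _).trans hQ
  have hR' : form c a = R := (form_comm _ _).trans hR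
  rw [hP, hQ, hR] at h
  rcases hx with rfl | rfl | rfl | rfl <;> rcases hy with rfl | rfl | rfl | rfl <;>
    rcases hz with rfl | rfl | rfl | rfl <;>
    first
    | exact absurd rfl hxy
    | exact absurd rfl hxz
    | exact absurd rfl hyz
    | (simp only [form_add_left, form_add_right, form_self, hP, hQ, hR, hP', hQ', hR']
       clear * - h
       revert P Q R
       decide)

namespace Frame

variable {s : LinearMap.BilinForm F V} {p H : Submodule F V}

theorem finrank_of_ncard (f : Frame s p H) {U : Submodule F V} (hU : U ≤ H)
    (hp : ¬ U ≤ s.orthogonal p) {k : ℕ} (h : (f.trace U).ncard = 2 ^ k) :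
    finrank F U = k + 1 := by
  have := f.two_pow_finrank hU hp
  rw [h, ← pow_succ'] at this
  exact Nat.pow_right_injective le_rfl this

theorem ncard_of_finrank (f : Frame s p H) {U : Submodule F V} (hU : U ≤ H)
    (hp : ¬ U ≤ s.orthogonal p) {k : ℕ} (h : finrank F U = k + 1) :
    (f.trace U).ncard = 2 ^ k := by
  have := f.two_pow_finrank hU hp
  rw [h, pow_succ'] at this
  omega

theorem rad_eq_self (f : Frame s p H) {U : Submodule F V} (hU : U ≤ H)
    (hp : ¬ U ≤ s.orthogonal p) (h : ∀ x ∈ f.trace U, ∀ y ∈ f.trace U, form x y = 0) :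
    rad s U = U := by
  refine le_antisymm inf_le_left ?_
  rw [f.le_iff_trace_subset hU hp]
  exact fun x hx => (f.pt_mem_rad hU).2 ⟨hx, h x hx⟩

theorem isObj (f : Frame s p H) {U : Submodule F V} (hU : U ≤ H) {x : Coords}
    (hx : x ∈ f.trace U) (hr : finrank F (rad s U) ≤ 2)
    (h : rad s U = ⊥ ∨ ∃ x ∈ f.trace U, ∀ y ∈ f.trace U, form x y = 0) {k : ℕ}
    (hk : finrank F U = k + 1) (hk' : k ≤ 3) : IsObj s p H U := by
  refine ⟨hU, f.not_le_orthogonal hx, by rw [f.rad_top, inf_bot_eq], hr, ?_, ?_, ?_⟩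
  · refine h.imp_right ?_
    rintro ⟨y, hy⟩ hle
    exact f.pt_notMem_orthogonal y (hle ((f.pt_mem_rad hU).2 hy))
  · omega
  · rw [f.finrank_eq]
    omega

theorem exists_point (f : Frame s p H) (a : Coords) :
    ∃ U, IsObj s p H U ∧ finrank F U = 1 ∧ f.trace U = {a} := by
  have := f.finiteDimensional
  have hA : ∀ x ∈ ({a} : Set Coords), ∀ y ∈ ({a} : Set Coords), ∀ z ∈ ({a} : Set Coords),
      x + y + z ∈ ({a} : Set Coords) := by
    rintro _ rfl _ rfl _ rfl
    simp [coords_add_self]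
  have ht := f.trace_ofTrace {a} ⟨a, rfl⟩ hA
  have hle := f.ofTrace_le {a} ⟨a, rfl⟩ hA
  generalize f.ofTrace {a} ⟨a, rfl⟩ hA = U at ht hle
  have ha : a ∈ f.trace U := by rw [ht]; rfl
  have hd : finrank F U = 1 := f.finrank_of_ncard (k := 0) hle (f.not_le_orthogonal ha) (by
    rw [ht, Set.ncard_singleton, pow_zero])
  refine ⟨U, f.isObj hle ha ?_ (Or.inr ⟨a, ha, ?_⟩) hd (by norm_num), hd, ht⟩
  · exact (Submodule.finrank_mono inf_le_left).trans (by omega)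
  · rw [ht]
    rintro _ rfl
    exact form_self _

theorem dir_mem_of_trace_pair (f : Frame s p H) {U : Submodule F V} {a b d : Coords}
    (ht : f.trace U = {a, b}) (hd : f.dir d ∈ U) (h0 : d ≠ 0) : d = a + b := by
  have ha : a ∈ f.trace U := by rw [ht]; exact Or.inl rfl
  have := (f.dir_mem_iff ha).1 hd
  rw [ht] at this
  rcases this with h | h
  · exact absurd (by simpa using h) h0
  · have h : a + d = b := h
    rw [← h, coords_add_add_cancel]

theorem line_rad (f : Frame s p H) {U : Submodule F V} (hU : U ≤ H) {a b : Coords}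
    (ht : f.trace U = {a, b}) :
    (form a b = 0 → rad s U = U) ∧ (form a b = 1 → rad s U = ⊥) := by
  have ha : a ∈ f.trace U := by rw [ht]; exact Or.inl rfl
  have hb : b ∈ f.trace U := by rw [ht]; exact Or.inr rfl
  constructor
  · intro h
    refine f.rad_eq_self hU (f.not_le_orthogonal ha) ?_
    rw [ht]
    rintro _ (rfl | rfl) _ (rfl | rfl)
    exacts [form_self _, h, (form_comm _ _).trans h, form_self _]
  · intro h
    refine f.rad_eq_bot hU (f.not_le_orthogonal ha) ?_ ?_
    · intro x hx
      rw [ht] at hx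
      rcases hx with rfl | rfl
      · exact ⟨b, hb, by rw [h]; decide⟩
      · exact ⟨a, ha, by rw [form_comm, h]; decide⟩
    · intro d hd h0
      refine ⟨a, ha, ?_⟩
      rw [f.dir_mem_of_trace_pair ht hd h0, form_add_left, form_self, form_comm, h]
      decide

theorem exists_line (f : Frame s p H) {a b : Coords} (hab : a ≠ b) :
    ∃ U, IsObj s p H U ∧ finrank F U = 2 ∧ f.trace U = {a, b} := by
  have := f.finiteDimensional
  have hA : ∀ x ∈ ({a, b} : Set Coords), ∀ y ∈ ({a, b} : Set Coords),
      ∀ z ∈ ({a, b} : Set Coords), x + y + z ∈ ({a, b} : Set Coords) := by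
    have e1 : a + b + a = b := by rw [add_comm, coords_add_add_cancel]
    have e2 : b + a + b = a := by rw [add_comm, coords_add_add_cancel]
    have e3 : a + b + b = a := by rw [add_assoc, coords_add_self, add_zero]
    have e4 : b + a + a = b := by rw [add_assoc, coords_add_self, add_zero]
    rintro _ (rfl | rfl) _ (rfl | rfl) _ (rfl | rfl) <;>
      simp [coords_add_self, e1, e2, e3, e4]
  have ht := f.trace_ofTrace {a, b} ⟨a, Or.inl rfl⟩ hA
  have hle := f.ofTrace_le {a, b} ⟨a, Or.inl rfl⟩ hA
  generalize f.ofTrace {a, b} ⟨a, Or.inl rfl⟩ hA = U at ht hle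
  have ha : a ∈ f.trace U := by rw [ht]; exact Or.inl rfl
  have hd : finrank F U = 2 := f.finrank_of_ncard (k := 1) hle (f.not_le_orthogonal ha) (by
    rw [ht, Set.ncard_pair hab, pow_one])
  obtain ⟨h0, h1⟩ := f.line_rad hle ht
  refine ⟨U, f.isObj hle ha ?_ ?_ hd (by norm_num), hd, ht⟩
  · exact (Submodule.finrank_mono inf_le_left).trans (by omega)
  · rcases zmod_two_cases (form a b) with h | h
    · refine Or.inr ⟨a, ha, ?_⟩
      rw [ht]
      rintro _ (rfl | rfl)
      exacts [form_self _, h]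
    · exact Or.inl (h1 h)

theorem plane_ne {a b c : Coords} (h : form (a + b) (a + c) = 1) : a ≠ b ∧ a ≠ c ∧ b ≠ c := by
  refine ⟨?_, ?_, ?_⟩ <;> rintro rfl <;>
    simp [coords_add_self, form_zero_left, form_zero_right, form_self] at h

theorem plane_ncard {a b c : Coords} (hab : a ≠ b) (hac : a ≠ c) (hbc : b ≠ c) :
    ({a, b, c, a + b + c} : Set Coords).ncard = 4 := by
  have h1 : a ≠ a + b + c := fun h => hbc (coords_add_eq_zero.1 (by
    rw [add_assoc] at h; simpa using h.symm))
  have h2 : b ≠ a + b + c := fun h => hac (coords_add_eq_zero.1 (by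
    rw [add_comm a b, add_assoc] at h; simpa using h.symm))
  have h3 : c ≠ a + b + c := fun h => hab (coords_add_eq_zero.1 (by simpa using h.symm))
  rw [Set.ncard_insert_of_notMem (by simp [*]), Set.ncard_insert_of_notMem (by simp [*]),
    Set.ncard_pair h3]

/-- In an affine plane of hyperbolic type exactly one point is perpendicular to all others. -/
theorem exists_plane_rad {a b c : Coords} (h : form (a + b) (a + c) = 1) :
    ∃ d ∈ ({a, b, c, a + b + c} : Set Coords),
      ∀ y ∈ ({a, b, c, a + b + c} : Set Coords), form d y = 0 := by
  rw [form_add_add_eq_one_iff] at h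
  have hba := form_comm b a
  have hca := form_comm c a
  have hcb := form_comm c b
  simp only [Set.mem_insert_iff, Set.mem_singleton_iff, forall_eq_or_imp, forall_eq]
  by_cases h1 : form a b = 0 ∧ form a c = 0
  · exact ⟨a, by simp, by simp [form_add_right, form_self, h1]⟩
  by_cases h2 : form a b = 0 ∧ form b c = 0
  · exact ⟨b, by simp, by simp [form_add_right, form_self, h2, hba]⟩
  by_cases h3 : form a c = 0 ∧ form b c = 0
  · exact ⟨c, by simp, by simp [form_add_right, form_self, h3, hca, hcb]⟩
  · have h4 : form a b = 1 ∧ form b c = 1 ∧ form a c = 1 := by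
      generalize form a b = x at *
      generalize form b c = y at *
      generalize form a c = z at *
      clear * - h h1 h2 h3
      revert x y z
      decide
    have h5 : (1 : ZMod 2) + 1 = 0 := by decide
    exact ⟨a + b + c, by simp, by
      simp [form_add_left, form_self, h4, hba, hca, hcb, h5]⟩

theorem exists_plane (f : Frame s p H) {a b c : Coords} (h : form (a + b) (a + c) = 1) :
    ∃ U, IsObj s p H U ∧ finrank F U = 3 ∧ f.trace U = {a, b, c, a + b + c} := by
  have := f.finiteDimensional
  obtain ⟨hab, hac, hbc⟩ := plane_ne h
  obtain ⟨d, hd, hdA⟩ := exists_plane_rad h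
  have hmem : ∀ x, x ∈ ({a, b, c, a + b + c} : Set Coords) ↔
      a + x = 0 ∨ a + x = a + b ∨ a + x = a + c ∨ a + x = (a + b) + (a + c) := by
    intro x
    have e : a + b + (a + c) = a + (a + b + c) := by abel
    rw [e, coords_add_eq_zero]
    simp only [add_right_inj, Set.mem_insert_iff, Set.mem_singleton_iff, eq_comm (a := x)]
  have hA : ∀ x ∈ ({a, b, c, a + b + c} : Set Coords), ∀ y ∈ ({a, b, c, a + b + c} : Set Coords),
      ∀ z ∈ ({a, b, c, a + b + c} : Set Coords),
      x + y + z ∈ ({a, b, c, a + b + c} : Set Coords) := by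
    intro x hx y hy z hz
    rw [hmem] at *
    -- With `a` as origin, closure under sums of three points becomes closure of the group generated
    -- by two directions.
    have e : a + (x + y + z) = (a + x) + (a + y) + (a + z) := by
      have := coords_add_self a
      calc a + (x + y + z) = (a + a) + a + (x + y + z) := by rw [this, zero_add]
        _ = _ := by abel
    rw [e]
    generalize a + b = u at *
    generalize a + c = v at *
    have e2 : u + v + u = v := by rw [add_comm, coords_add_add_cancel]
    have e3 : u + v + v = u := by rw [add_assoc, coords_add_self, add_zero]
    have e4 : v + u = u + v := add_comm _ _
    have e5 : v + (u + v) = u := by rw [add_comm, e3]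
    rcases hx with hx | hx | hx | hx <;> rcases hy with hy | hy | hy | hy <;>
      rcases hz with hz | hz | hz | hz <;> rw [hx, hy, hz] <;>
      simp only [zero_add, add_zero, coords_add_self, coords_add_add_cancel, e2, e3, e4, e5,
        true_or, or_true]
  have hne : ({a, b, c, a + b + c} : Set Coords).Nonempty := ⟨a, Or.inl rfl⟩
  have ht := f.trace_ofTrace _ hne hA
  have hle := f.ofTrace_le _ hne hA
  generalize f.ofTrace _ hne hA = U at ht hle
  have ha : a ∈ f.trace U := by rw [ht]; exact Or.inl rfl
  have hd3 : finrank F U = 3 := f.finrank_of_ncard (k := 2) hle (f.not_le_orthogonal ha) (by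
    rw [ht, plane_ncard hab hac hbc]; norm_num)
  refine ⟨U, f.isObj hle ha ?_ (Or.inr ⟨d, by rwa [ht], by rwa [ht]⟩) hd3 (by norm_num), hd3, ht⟩
  -- A plane equal to its radical would have all its points perpendicular, against hyperbolicity; so
  -- the radical has dimension at most two.
  have hlt : rad s U < U := by
    refine lt_of_le_of_ne inf_le_left fun e => ?_
    have h0 : ∀ x ∈ f.trace U, ∀ y ∈ f.trace U, form x y = 0 := by
      intro x hx
      rw [mem_trace, ← e, f.pt_mem_rad hle] at hx
      exact hx.2
    rw [ht] at h0
    rw [form_add_add_eq_one_iff, h0 a (by simp) b (by simp), h0 b (by simp) c (by simp),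
      h0 a (by simp) c (by simp)] at h
    revert h; decide
  have := Submodule.finrank_lt_finrank_of_lt hlt
  omega

/-- For `ε = 0` the radical points are `0` and `t`, because `(t^⊥)^⊥ = ⟨t⟩`. For `ε = 1` each point
`y` is non-perpendicular to `y + t`, and no nonzero direction is orthogonal to the whole trace. -/
theorem solid_rad (f : Frame s p H) {U : Submodule F V} (hU : U ≤ H) {t : Coords} (ht : t ≠ 0)
    {ε : ZMod 2} (h : f.trace U = {x | form x t = ε}) :
    (ε = 0 → f.trace (rad s U) = {0, t} ∧ finrank F (rad s U) = 2) ∧ (ε = 1 → rad s U = ⊥) := by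
  constructor
  · rintro rfl
    have h1 : f.trace (rad s U) = {0, t} := by
      ext x
      rw [mem_trace, f.pt_mem_rad hU, h]
      constructor
      · rintro ⟨h1, h2⟩
        exact eq_zero_or_eq_of_form t ht x h1 h2
      · rintro (rfl | rfl)
        · exact ⟨form_zero_left _, fun e _ => form_zero_left _⟩
        · exact ⟨form_self _, fun e he => (form_comm _ _).trans he⟩
    have h0 : (0 : Coords) ∈ f.trace (rad s U) := by rw [h1]; exact Or.inl rfl
    exact ⟨h1, f.finrank_of_ncard (U := rad s U) (k := 1) (inf_le_left.trans hU)
      (f.not_le_orthogonal h0) (by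
      rw [h1, Set.ncard_pair ht.symm, pow_one])⟩
  · rintro rfl
    obtain ⟨x, hx⟩ := exists_form_eq ht 1
    have hxU : x ∈ f.trace U := by rw [h]; exact hx
    refine f.rad_eq_bot hU (f.not_le_orthogonal hxU) ?_ ?_
    · intro y hy
      rw [h] at hy ⊢
      have hy : form y t = 1 := hy
      refine ⟨y + t, ?_, ?_⟩
      · change form (y + t) t = 1
        rw [form_add_left, form_self, hy, add_zero]
      · rw [form_add_right, form_self, hy]
        decide
    · intro d _ hd
      by_contra! hcon
      rw [h] at hcon
      exact hd (eq_zero_of_form t ht d hcon)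

theorem exists_solid (f : Frame s p H) {t : Coords} (ht : t ≠ 0) (ε : ZMod 2) :
    ∃ U, IsObj s p H U ∧ finrank F U = 4 ∧ f.trace U = {x | form x t = ε} := by
  have := f.finiteDimensional
  have hA : ∀ x ∈ {x | form x t = ε}, ∀ y ∈ {x | form x t = ε}, ∀ z ∈ {x | form x t = ε},
      x + y + z ∈ {x | form x t = ε} := by
    intro x hx y hy z hz
    change form x t = ε at hx
    change form y t = ε at hy
    change form z t = ε at hz
    change form (x + y + z) t = ε
    rw [form_add_left, form_add_left, hx, hy, hz]
    clear * -
    revert ε; decide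
  have hne : {x | form x t = ε}.Nonempty := exists_form_eq ht ε
  have hT := f.trace_ofTrace _ hne hA
  have hle := f.ofTrace_le _ hne hA
  generalize f.ofTrace _ hne hA = U at hT hle
  obtain ⟨x, hx⟩ := hne
  have ha : x ∈ f.trace U := by rw [hT]; exact hx
  have hd : finrank F U = 4 := f.finrank_of_ncard (k := 3) hle (f.not_le_orthogonal ha) (by
    rw [hT, ncard_form_eq ht]; norm_num)
  obtain ⟨h0, h1⟩ := f.solid_rad hle ht hT
  refine ⟨U, f.isObj hle ha ?_ ?_ hd (by norm_num), hd, hT⟩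
  · rcases zmod_two_cases ε with h | h
    · exact (h0 h).2.le
    · rw [h1 h, finrank_bot]
      norm_num
  · rcases zmod_two_cases ε with h | h
    · refine Or.inr ⟨0, ?_, fun y _ => form_zero_left y⟩
      rw [hT, h]
      exact form_zero_left t
    · exact Or.inl (h1 h)

/-- `U^⊥` is 2-dimensional and contains `H^⊥`, spanned by `vec (0, 1, 0)`. Orthogonality to any
further vector `vec (ε, β, t)` of `U^⊥` is the equation `form x t = ε` on the trace, and counting
shows that no other equation is needed. -/
theorem exists_normal (f : Frame s p H) {U : Submodule F V} (hU : U ≤ H)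
    (hp : ¬ U ≤ s.orthogonal p) (hd : finrank F U = 4) :
    ∃ t ε, t ≠ 0 ∧ f.trace U = {x | form x t = ε} := by
  have := f.finite
  have := f.finiteDimensional
  obtain ⟨y, hy⟩ := f.trace_nonempty hU hp
  have h4 : finrank F (s.orthogonal U) = 2 := by
    rw [LinearMap.BilinForm.finrank_orthogonal f.nondegenerate, f.finrank_eq, hd]
  have hr : ∀ u ∈ U, s u (f.vec (0, 1, 0)) = 0 := by
    intro u hu
    obtain ⟨a, rfl⟩ := f.vec.surjective u
    have h := (f.mem_H a).1 (hU hu)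
    rw [f.s_vec, map_eq_zero_iff _ f.φ.injective]
    simp [form6, form, h]
  obtain ⟨v, hv, hv'⟩ : ∃ v ∈ s.orthogonal U, v ∉ Submodule.span F {f.vec (0, 1, 0)} := by
    by_contra! hcon
    have h1 := Submodule.finrank_mono hcon
    have h2 : finrank F (Submodule.span F {f.vec (0, 1, 0)}) ≤ 1 := by
      have := finrank_span_finset_le_card (R := F) ({f.vec (0, 1, 0)} : Finset V)
      rwa [Finset.coe_singleton, Finset.card_singleton] at this
    omega
  rw [f.mem_span_singleton] at hv'
  obtain ⟨⟨ε, β, t⟩, rfl⟩ := f.vec.surjective v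
  have hform : ∀ x ∈ f.trace U, form x t = ε := by
    intro x hx
    have h : s (f.pt x) (f.vec (ε, β, t)) = 0 := hv _ hx
    rw [pt, f.s_vec, map_eq_zero_iff _ f.φ.injective] at h
    simp only [form6, zero_mul, one_mul, zero_add] at h
    generalize form x t = c at *
    clear * - h
    revert ε c; decide
  have ht : t ≠ 0 := by
    rintro rfl
    have h := hform y hy
    rw [form_zero_right] at h
    subst h
    rcases zmod_two_cases β with rfl | rfl
    · exact hv' (Or.inl (map_zero f.vec))
    · exact hv' (Or.inr rfl)
  refine ⟨t, ε, ht, Set.eq_of_subset_of_ncard_le hform ?_ (Set.toFinite _)⟩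
  rw [ncard_form_eq ht, f.ncard_of_finrank (k := 3) hU hp hd]
  norm_num

/-- This is where the conditions on the radical enter. If the direction space is not hyperbolic,
then either the plane is totally isotropic, with radical of dimension three, or no point is radical
while some nonzero direction is; in the latter case the radical is nonzero and contained in `p^⊥`.
-/
theorem plane_form (f : Frame s p H) {U : Submodule F V} (hU : IsObj s p H U)
    (hd : finrank F U = 3) {a b c : Coords} (hab : a ≠ b) (hac : a ≠ c) (hbc : b ≠ c)
    (ht : f.trace U = {a, b, c, a + b + c}) : form (a + b) (a + c) = 1 := by
  have := f.finiteDimensional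
  obtain ⟨hle, hp, -, hr2, hr, -⟩ := hU
  by_contra h
  rw [form_add_add_eq_one_iff] at h
  have key : ∀ x y z : ZMod 2, x + y + z ≠ 1 → (x = 0 ∧ y = 0 ∧ z = 0) ∨
      (x = 1 ∧ y = 1 ∧ z = 0) ∨ (x = 1 ∧ y = 0 ∧ z = 1) ∨ (x = 0 ∧ y = 1 ∧ z = 1) := by decide
  have h11 : (1 : ZMod 2) + 1 = 0 := by decide
  have ha : a ∈ f.trace U := by rw [ht]; simp
  have hb : b ∈ f.trace U := by rw [ht]; simp
  have hc : c ∈ f.trace U := by rw [ht]; simp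
  have hba := form_comm b a
  have hca := form_comm c a
  have hcb := form_comm c b
  have hall : ∀ P : Coords → Prop, (∀ x ∈ f.trace U, P x) ↔ P a ∧ P b ∧ P c ∧ P (a + b + c) := by
    intro P
    rw [ht]
    simp only [Set.mem_insert_iff, Set.mem_singleton_iff, forall_eq_or_imp, forall_eq]
  rcases key _ _ _ h with ⟨h1, h2, h3⟩ | h'
  · have : rad s U = U := by
      refine f.rad_eq_self hle hp ?_
      simp only [hall]
      simp [form_add_left, form_add_right, form_self, h1, h2, h3, hba, hca, hcb]
    rw [this] at hr2
    omega
  · have hnone : ∀ x ∈ f.trace U, ∃ y ∈ f.trace U, form x y ≠ 0 := by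
      intro x hx
      by_contra! hcon
      have e1 := hcon a ha
      have e2 := hcon b hb
      have e3 := hcon c hc
      rw [ht] at hx
      clear hcon
      rcases hx with rfl | rfl | rfl | rfl <;>
        rcases h' with ⟨h1, h2, h3⟩ | ⟨h1, h2, h3⟩ | ⟨h1, h2, h3⟩ <;>
        simp [form_add_left, form_self, hba, hca, hcb, h1, h2, h3] at e1 e2 e3
    rcases hr with hr | hr
    · have hbot : ∀ x y, x ∈ f.trace U → y ∈ f.trace U → x ≠ y →
          (∀ z ∈ f.trace U, form (x + y) z = 0) → False := by
        intro x y hx hy hxy hz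
        have : f.dir (x + y) ∈ rad s U := (f.dir_mem_rad hle hp).2 ⟨f.dir_add_mem hx hy, hz⟩
        rw [hr, Submodule.mem_bot, ← f.dir_zero] at this
        exact hxy (coords_add_eq_zero.1 (f.dir_injective this))
      rcases h' with ⟨h1, h2, h3⟩ | ⟨h1, h2, h3⟩ | ⟨h1, h2, h3⟩
      · refine hbot a c ha hc hac ?_
        simp only [hall]
        simp [form_add_left, form_add_right, form_self, h1, h2, h3, hca, hcb, h11]
      · refine hbot b c hb hc hbc ?_
        simp only [hall]
        simp [form_add_left, form_add_right, form_self, h1, h2, h3, hba, hca, hcb, h11]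
      · refine hbot a b ha hb hab ?_
        simp only [hall]
        simp [form_add_left, form_add_right, form_self, h1, h2, h3, hba, h11]
    · obtain ⟨x, hx⟩ := f.trace_nonempty (inf_le_left.trans hle) hr
      obtain ⟨hx, hx0⟩ := (f.pt_mem_rad hle).1 hx
      obtain ⟨y, hy, hxy⟩ := hnone x hx
      exact hxy (hx0 y hy)

/-- The traces of the objects of `Π(p,H)`. -/
theorem shape (f : Frame s p H) {U : Submodule F V} (hU : IsObj s p H U) :
    (finrank F U = 1 ∧ ∃ a, f.trace U = {a}) ∨
    (finrank F U = 2 ∧ ∃ a b, a ≠ b ∧ f.trace U = {a, b}) ∨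
    (finrank F U = 3 ∧ ∃ a b c, form (a + b) (a + c) = 1 ∧ f.trace U = {a, b, c, a + b + c}) ∨
    (finrank F U = 4 ∧ ∃ t ε, t ≠ 0 ∧ f.trace U = {x | form x t = ε}) := by
  have hle := hU.1
  have hp := hU.2.1
  have hdim := hU.2.2.2.2.2
  rw [f.finrank_eq] at hdim
  obtain ⟨h1, h2⟩ := hdim
  have : finrank F U = 0 + 1 ∨ finrank F U = 1 + 1 ∨ finrank F U = 2 + 1 ∨ finrank F U = 3 + 1 := by
    omega
  rcases this with hd | hd | hd | hd
  · exact Or.inl ⟨hd, Set.ncard_eq_one.1 (f.ncard_of_finrank hle hp hd)⟩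
  · refine Or.inr (Or.inl ⟨hd, ?_⟩)
    obtain ⟨a, b, hab, h⟩ := Set.ncard_eq_two.1 (f.ncard_of_finrank hle hp hd)
    exact ⟨a, b, hab, h⟩
  · refine Or.inr (Or.inr (Or.inl ⟨hd, ?_⟩))
    have hn := f.ncard_of_finrank hle hp hd
    obtain ⟨a, b, c, ha, hb, hc, hab, hac, hbc⟩ :=
      (Set.two_lt_ncard_iff (Set.toFinite _)).1 (show 2 < (f.trace U).ncard by rw [hn]; norm_num)
    have ht : f.trace U = {a, b, c, a + b + c} := by
      symm
      refine Set.eq_of_subset_of_ncard_le ?_ ?_ (Set.toFinite _)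
      · rintro _ (rfl | rfl | rfl | rfl)
        exacts [ha, hb, hc, f.add_add_mem_trace ha hb hc]
      · rw [hn, plane_ncard hab hac hbc]
        norm_num
    exact ⟨a, b, c, f.plane_form hU hd hab hac hbc ht, ht⟩
  · exact Or.inr (Or.inr (Or.inr ⟨hd, f.exists_normal hle hp hd⟩))

/-! ### Joined points and incidence -/

/-- Two points of an object are joined by a line incident with it (or equal to it). -/
def Joined (f : Frame s p H) (U : Submodule F V) (x y : Coords) : Prop :=
  finrank F U = 4 → f.dir (x + y) ∉ rad s (U ⊓ s.orthogonal p)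

theorem joined_comm (f : Frame s p H) {U : Submodule F V} {x y : Coords} :
    f.Joined U x y ↔ f.Joined U y x := by
  rw [Joined, add_comm, Joined]

theorem joined_of_finrank_ne (f : Frame s p H) {U : Submodule F V} (h : finrank F U ≠ 4)
    (x y : Coords) : f.Joined U x y := fun h' => absurd h' h

theorem joined_iff (f : Frame s p H) {U : Submodule F V} (hU : U ≤ H) (hd : finrank F U = 4)
    {t : Coords} (ht : t ≠ 0) {ε : ZMod 2} (h : f.trace U = {x | form x t = ε}) {x y : Coords} :
    f.Joined U x y ↔ x + y ≠ 0 ∧ x + y ≠ t := by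
  rw [Joined, f.dir_mem_rad_inf hU ht h, not_or]
  exact ⟨fun k => k hd, fun k _ => k⟩

/-- The points of a solid fall into pairs `{x, x + t}`, and only the two points of a pair are not
joined; any point of another pair is joined to both. -/
theorem joined_or (f : Frame s p H) {U : Submodule F V} (hU : IsObj s p H U) {x y : Coords}
    (hx : x ∈ f.trace U) (hxy : x ≠ y) : f.Joined U x y ∨
      ∃ z ∈ f.trace U, x ≠ z ∧ z ≠ y ∧ f.Joined U x z ∧ f.Joined U z y := by
  by_cases hd : finrank F U = 4
  · obtain ⟨t, ε, ht, h⟩ := f.exists_normal hU.1 hU.2.1 hd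
    simp only [f.joined_iff hU.1 hd ht h]
    rw [h] at hx ⊢
    by_cases e : x + y = t
    · right
      obtain ⟨z, hz, h1, h2⟩ := exists_form_eq_ne t ht x
      have hzy : z + y = (x + z) + t := by
        rw [← e, add_comm x z, add_assoc, coords_add_add_cancel]
      have h3 : z + y ≠ 0 := fun h0 => h2 (coords_add_eq_zero.1 (hzy ▸ h0))
      have h4 : z + y ≠ t := fun h0 => h1 (by
        rw [hzy] at h0
        simpa using h0)
      exact ⟨z, hz.trans hx, fun h0 => h1 (coords_add_eq_zero.2 h0),
        fun h0 => h3 (coords_add_eq_zero.2 h0), ⟨h1, h2⟩, h3, h4⟩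
    · exact Or.inl ⟨fun h0 => hxy (coords_add_eq_zero.1 h0), e⟩
  · exact Or.inl (f.joined_of_finrank_ne hd x y)

/-- The crucial identity. For planes it is hyperbolicity of the direction space. In a solid the two
directions represent different nonzero elements of the hyperbolic plane `t^⊥/⟨t⟩`. -/
theorem form_of_joined (f : Frame s p H) {U : Submodule F V} (hU : IsObj s p H U) {x y z : Coords}
    (hx : x ∈ f.trace U) (hy : y ∈ f.trace U) (hz : z ∈ f.trace U) (hxy : x ≠ y) (hxz : x ≠ z)
    (hyz : y ≠ z) (jxy : f.Joined U x y) (jxz : f.Joined U x z) (jyz : f.Joined U y z) :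
    form (x + y) (x + z) = 1 := by
  rcases f.shape hU with ⟨-, a, h⟩ | ⟨-, a, b, -, h⟩ | ⟨-, a, b, c, h', h⟩ | ⟨hd, t, ε, ht, h⟩
  · rw [h] at hx hy
    exact absurd (hx.trans hy.symm) hxy
  · rw [h] at hx hy hz
    rcases hx with rfl | rfl <;> rcases hy with rfl | rfl <;> rcases hz with rfl | rfl <;>
      first | exact absurd rfl hxy | exact absurd rfl hxz | exact absurd rfl hyz
  · rw [h] at hx hy hz
    exact form_of_mem_plane h' hx hy hz hxy hxz hyz
  · rw [f.joined_iff hU.1 hd ht h] at jxy jxz jyz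
    rw [h] at hx hy hz
    change form x t = ε at hx
    change form y t = ε at hy
    change form z t = ε at hz
    have e : x + y + (x + z) = y + z := by
      rw [add_comm x y, add_assoc, coords_add_add_cancel]
    have hε : ε + ε = 0 := by
      clear * -
      revert ε; decide
    exact form_eq_one_of_form_eq_zero t ht _ (by rw [form_add_left, hx, hy, hε]) jxy.1 jxy.2 _
      (by rw [form_add_left, hx, hz, hε]) jxz.1 jxz.2 (e ▸ jyz.1) (e ▸ jyz.2)

/-- Incidence in terms of traces. -/
theorem incLT_iff (f : Frame s p H) {U W : Submodule F V} (hU : IsObj s p H U)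
    (hW : IsObj s p H W) : IncLT s p U W ↔ finrank F U < finrank F W ∧ f.trace U ⊆ f.trace W ∧
      ∀ x ∈ f.trace U, ∀ y ∈ f.trace U, x ≠ y → f.Joined W x y := by
  rw [IncLT, f.le_iff_trace_subset hU.1 hU.2.1]
  refine and_congr_right fun hlt => and_congr_right fun hsub => ⟨?_, ?_⟩
  · rintro h x hx y hy hxy hd hr
    rcases h with h | h
    · rw [hd] at h
      revert h; decide
    · have : f.dir (x + y) ∈ U ⊓ rad s (W ⊓ s.orthogonal p) := ⟨f.dir_add_mem hx hy, hr⟩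
      rw [h, Submodule.mem_bot, ← f.dir_zero] at this
      exact hxy (coords_add_eq_zero.1 (f.dir_injective this))
  · intro h
    obtain ⟨x, hx⟩ := f.trace_nonempty hU.1 hU.2.1
    by_cases hodd : Odd (finrank F W)
    · exact Or.inl hodd
    · refine Or.inr (eq_bot_iff.2 ?_)
      rintro v ⟨hv, hv'⟩
      obtain ⟨d, rfl⟩ := f.exists_eq_dir (hU.1 hv) hv'.1.2
      have hxd := (f.dir_mem_iff hx).1 hv
      have : x = x + d := by
        by_contra hne
        rcases f.shape hW with ⟨hd, -⟩ | ⟨hd, -⟩ | ⟨hd, -⟩ | ⟨hd, -⟩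
        · exact hodd (by rw [hd]; decide)
        -- Below a line there are only points, whose traces do not contain two different elements.
        · have hU1 : finrank F U = 0 + 1 := by
            have := hU.2.2.2.2.2.1
            omega
          have := f.ncard_of_finrank hU.1 hU.2.1 hU1
          obtain ⟨a, ha⟩ := Set.ncard_eq_one.1 this
          rw [ha] at hx hxd
          exact hne (hx.trans hxd.symm)
        · exact hodd (by rw [hd]; decide)
        · exact h x hx _ hxd hne hd (by rwa [coords_add_add_cancel])
      have : d = 0 := by simpa using this.symm
      rw [this, f.dir_zero]
      exact Submodule.zero_mem _

/-- In terms of traces the last condition concerns pairs of points and is inherited by subsets. -/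
theorem incLT_trans (f : Frame s p H) {U W X : Submodule F V} (hU : IsObj s p H U)
    (hW : IsObj s p H W) (hX : IsObj s p H X) (h : IncLT s p U W) (h' : IncLT s p W X) :
    IncLT s p U X := by
  rw [f.incLT_iff hU hW] at h
  rw [f.incLT_iff hW hX] at h'
  rw [f.incLT_iff hU hX]
  exact ⟨h.1.trans h'.1, h.2.1.trans h'.2.1, fun x hx y hy => h'.2.2 x (h.2.1 hx) y (h.2.1 hy)⟩

end Frame

/-! ### `Π(p,H)` is a geometry -/

set_option synthInstance.maxSize 1000 in
theorem exists_form_eq_zero_zero : ∀ u v : Coords, ∃ t : Coords, t ≠ 0 ∧ form u t = 0 ∧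
    form v t = 0 := by
  decide +kernel

namespace Frame

variable {s : LinearMap.BilinForm F V} {p H : Submodule F V}

theorem line_lt (f : Frame s p H) {U W : Submodule F V} (hU : IsObj s p H U)
    (hW : IsObj s p H W) (hd : finrank F U = 2) (hd' : 2 < finrank F W) {a b : Coords}
    (h : f.trace U = {a, b}) (ha : a ∈ f.trace W) (hb : b ∈ f.trace W) (hab : f.Joined W a b) :
    IncLT s p U W := by
  rw [f.incLT_iff hU hW, hd, h]
  refine ⟨hd', ?_, ?_⟩
  · rintro _ (rfl | rfl)
    exacts [ha, hb]
  · rintro _ (rfl | rfl) _ (rfl | rfl) hxy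
    exacts [absurd rfl hxy, hab, f.joined_comm.1 hab, absurd rfl hxy]

theorem point_lt (f : Frame s p H) {U W : Submodule F V} (hU : IsObj s p H U)
    (hW : IsObj s p H W) (hd : finrank F U = 1) (hd' : 1 < finrank F W) {a : Coords}
    (h : f.trace U = {a}) (ha : a ∈ f.trace W) : IncLT s p U W := by
  rw [f.incLT_iff hU hW, hd, h]
  refine ⟨hd', Set.singleton_subset_iff.2 ha, ?_⟩
  rintro _ rfl _ rfl hxy
  exact absurd rfl hxy

/-- For a plane in a solid, incidence is plain inclusion: if `t` were a direction of the plane, it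
would be orthogonal to all its directions, against hyperbolicity. -/
theorem plane_lt (f : Frame s p H) {U W : Submodule F V} (hU : IsObj s p H U)
    (hW : IsObj s p H W) (hd : finrank F U = 3) (hd' : finrank F W = 4) {a b c : Coords}
    (h' : form (a + b) (a + c) = 1) (h : f.trace U = {a, b, c, a + b + c})
    (ha : a ∈ f.trace W) (hb : b ∈ f.trace W) (hc : c ∈ f.trace W) : IncLT s p U W := by
  have hsub : f.trace U ⊆ f.trace W := by
    rw [h]
    rintro _ (rfl | rfl | rfl | rfl)
    exacts [ha, hb, hc, f.add_add_mem_trace ha hb hc]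
  rw [f.incLT_iff hU hW, hd, hd']
  refine ⟨by norm_num, hsub, ?_⟩
  intro x hx y hy hxy
  obtain ⟨t, ε, ht, hT⟩ := f.exists_normal hW.1 hW.2.1 hd'
  rw [f.joined_iff hW.1 hd' ht hT]
  refine ⟨fun e => hxy (coords_add_eq_zero.1 e), fun e => ?_⟩
  obtain ⟨z, hz, hzxy⟩ : ∃ z ∈ f.trace U, z ∉ ({x, y} : Set Coords) := by
    refine Set.exists_mem_notMem_of_ncard_lt_ncard ?_
    rw [f.ncard_of_finrank (k := 2) hU.1 hU.2.1 hd]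
    exact (Set.ncard_insert_le _ _).trans_lt (by rw [Set.ncard_singleton]; norm_num)
  have hzx : x ≠ z := fun e => hzxy (Or.inl e.symm)
  have hzy : y ≠ z := fun e => hzxy (Or.inr e.symm)
  have hxW := hsub hx
  have hzW := hsub hz
  rw [hT] at hxW hzW
  change form x t = ε at hxW
  change form z t = ε at hzW
  rw [h] at hx hy hz
  have := form_of_mem_plane h' hx hy hz hxy hzx hzy
  rw [e, form_comm, form_add_left, hxW, hzW] at this
  clear * - this
  revert ε; decide

theorem exists_point_lt (f : Frame s p H) {W : Submodule F V} (hW : IsObj s p H W)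
    (hd : 1 < finrank F W) : ∃ U, IsObj s p H U ∧ finrank F U = 1 ∧ IncLT s p U W := by
  obtain ⟨a, ha⟩ := f.trace_nonempty hW.1 hW.2.1
  obtain ⟨U, hU, hdU, hT⟩ := f.exists_point a
  exact ⟨U, hU, hdU, f.point_lt hU hW hdU hd hT ha⟩

theorem trace_point (f : Frame s p H) {U : Submodule F V} (hU : IsObj s p H U)
    (hd : finrank F U = 1) : ∃ a, f.trace U = {a} :=
  Set.ncard_eq_one.1 (f.ncard_of_finrank (k := 0) hU.1 hU.2.1 hd)

theorem trace_line (f : Frame s p H) {U : Submodule F V} (hU : IsObj s p H U)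
    (hd : finrank F U = 2) : ∃ a b, a ≠ b ∧ f.trace U = {a, b} :=
  Set.ncard_eq_two.1 (f.ncard_of_finrank (k := 1) hU.1 hU.2.1 hd)

theorem trace_plane (f : Frame s p H) {U : Submodule F V} (hU : IsObj s p H U)
    (hd : finrank F U = 3) :
    ∃ a b c, form (a + b) (a + c) = 1 ∧ f.trace U = {a, b, c, a + b + c} := by
  rcases f.shape hU with ⟨h, -⟩ | ⟨h, -⟩ | ⟨-, h⟩ | ⟨h, -⟩
  · omega
  · omega
  · exact h
  · omega

theorem exists_line_between (f : Frame s p H) {U W : Submodule F V} (hU : IsObj s p H U)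
    (hW : IsObj s p H W) (hd : finrank F U = 1) (hd' : 2 < finrank F W) (hUW : IncLT s p U W) :
    ∃ L, IsObj s p H L ∧ finrank F L = 2 ∧ IncLT s p U L ∧ IncLT s p L W := by
  obtain ⟨a, hT⟩ := f.trace_point hU hd
  have ha : a ∈ f.trace W := ((f.incLT_iff hU hW).1 hUW).2.1 (by rw [hT]; rfl)
  obtain ⟨b, hb, hab, hj⟩ : ∃ b ∈ f.trace W, a ≠ b ∧ f.Joined W a b := by
    obtain ⟨c, hc, hca⟩ : ∃ c ∈ f.trace W, c ∉ ({a} : Set Coords) := by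
      refine Set.exists_mem_notMem_of_ncard_lt_ncard ?_
      have h1 := f.two_pow_finrank hW.1 hW.2.1
      have h2 : 2 ^ 3 ≤ 2 ^ finrank F W := Nat.pow_le_pow_right (by norm_num) hd'
      rw [Set.ncard_singleton]
      omega
    have hca : a ≠ c := fun e => hca e.symm
    rcases f.joined_or hW ha hca with h | ⟨z, hz, haz, -, h, -⟩
    exacts [⟨c, hc, hca, h⟩, ⟨z, hz, haz, h⟩]
  obtain ⟨L, hL, hdL, hTL⟩ := f.exists_line hab
  refine ⟨L, hL, hdL, f.point_lt hU hL hd (by omega) hT (by rw [hTL]; exact Or.inl rfl),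
    f.line_lt hL hW hdL hd' hTL ha hb hj⟩

theorem exists_line_gt (f : Frame s p H) {U : Submodule F V} (hU : IsObj s p H U)
    (hd : finrank F U = 1) : ∃ L, IsObj s p H L ∧ finrank F L = 2 ∧ IncLT s p U L := by
  obtain ⟨a, hT⟩ := f.trace_point hU hd
  have hab : a ≠ a + (1, 0) := by
    intro h
    have h : (1, 0) = (0 : Coords) := by simpa using h.symm
    revert h; decide
  obtain ⟨L, hL, hdL, hTL⟩ := f.exists_line hab
  exact ⟨L, hL, hdL, f.point_lt hU hL hd (by omega) hT (by rw [hTL]; exact Or.inl rfl)⟩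

theorem exists_plane_between (f : Frame s p H) {U W : Submodule F V} (hU : IsObj s p H U)
    (hW : IsObj s p H W) (hd : finrank F U = 2) (hd' : finrank F W = 4) (hUW : IncLT s p U W) :
    ∃ L, IsObj s p H L ∧ finrank F L = 3 ∧ IncLT s p U L ∧ IncLT s p L W := by
  obtain ⟨a, b, hab, hT⟩ := f.trace_line hU hd
  obtain ⟨t, ε, ht, hTW⟩ := f.exists_normal hW.1 hW.2.1 hd'
  obtain ⟨-, hsub, hj⟩ := (f.incLT_iff hU hW).1 hUW
  have ha : a ∈ f.trace U := by rw [hT]; exact Or.inl rfl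
  have hb : b ∈ f.trace U := by rw [hT]; exact Or.inr rfl
  have hj := hj a ha b hb hab
  rw [f.joined_iff hW.1 hd' ht hTW] at hj
  have haW := hsub ha
  have hbW := hsub hb
  rw [hTW] at haW hbW
  change form a t = ε at haW
  change form b t = ε at hbW
  have hε : ε + ε = 0 := by
    clear * -
    revert ε; decide
  -- The line is joined in the solid, so its direction `a + b` is not in the radical `⟨t⟩` of `t^⊥`;
  -- hence some direction `k` in `t^⊥` completes it to a hyperbolic plane.
  obtain ⟨k, hk, hk'⟩ : ∃ k, form k t = 0 ∧ form (a + b) k ≠ 0 := by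
    by_contra! hcon
    rcases eq_zero_or_eq_of_form t ht (a + b) (by rw [form_add_left, haW, hbW, hε]) hcon with h | h
    exacts [hj.1 h, hj.2 h]
  have hf : form (a + b) (a + (a + k)) = 1 := by
    rw [coords_add_add_cancel]
    exact zmod_two_ne_zero.1 hk'
  have hc : a + k ∈ f.trace W := by
    rw [hTW]
    change form (a + k) t = ε
    rw [form_add_left, haW, hk, add_zero]
  obtain ⟨L, hL, hdL, hTL⟩ := f.exists_plane hf
  exact ⟨L, hL, hdL, f.line_lt hU hL hd (by omega) hT (by rw [hTL]; simp) (by rw [hTL]; simp)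
    (f.joined_of_finrank_ne (by omega) _ _),
    f.plane_lt hL hW hdL hd' hf hTL (hsub ha) (hsub hb) hc⟩

theorem exists_plane_gt (f : Frame s p H) {U : Submodule F V} (hU : IsObj s p H U)
    (hd : finrank F U = 2) : ∃ L, IsObj s p H L ∧ finrank F L = 3 ∧ IncLT s p U L := by
  obtain ⟨a, b, hab, hT⟩ := f.trace_line hU hd
  obtain ⟨k, hk⟩ := exists_form_eq (fun h => hab (coords_add_eq_zero.1 h)) 1
  have hf : form (a + b) (a + (a + k)) = 1 := by
    rwa [coords_add_add_cancel, form_comm]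
  obtain ⟨L, hL, hdL, hTL⟩ := f.exists_plane hf
  exact ⟨L, hL, hdL, f.line_lt hU hL hd (by omega) hT (by rw [hTL]; simp) (by rw [hTL]; simp)
    (f.joined_of_finrank_ne (by omega) _ _)⟩

theorem exists_solid_gt (f : Frame s p H) {U : Submodule F V} (hU : IsObj s p H U)
    (hd : finrank F U = 3) : ∃ L, IsObj s p H L ∧ finrank F L = 4 ∧ IncLT s p U L := by
  obtain ⟨a, b, c, hf, hT⟩ := f.trace_plane hU hd
  -- A vector orthogonal to both directions of the plane is the normal of a solid through it.
  obtain ⟨t, ht, h1, h2⟩ := exists_form_eq_zero_zero (a + b) (a + c)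
  obtain ⟨L, hL, hdL, hTL⟩ := f.exists_solid ht (form a t)
  have key : ∀ x, form (a + x) t = 0 → x ∈ f.trace L := by
    intro x hx
    rw [hTL]
    change form x t = form a t
    rw [← coords_add_add_cancel a x, form_add_left, hx, add_zero]
  exact ⟨L, hL, hdL, f.plane_lt hU hL hd hdL hf hT
    (key a (by rw [coords_add_self, form_zero_left])) (key b h1) (key c h2)⟩

theorem flag_lt (_f : Frame s p H) {A : Set (residueGeometry s p H).Obj}
    (hA : (residueGeometry s p H).IsFlag A) {X Y : (residueGeometry s p H).Obj} (hX : X ∈ A)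
    (hY : Y ∈ A) (h : finrank F X.1 < finrank F Y.1) : IncLT s p X.1 Y.1 := by
  rcases hA X hX Y hY with rfl | h' | h'
  · exact absurd h (lt_irrefl _)
  · exact h'
  · exact absurd h'.1 h.asymm

theorem flag_eq (_f : Frame s p H) {A : Set (residueGeometry s p H).Obj}
    (hA : (residueGeometry s p H).IsFlag A) {X Y : (residueGeometry s p H).Obj} (hX : X ∈ A)
    (hY : Y ∈ A) (h : finrank F X.1 = finrank F Y.1) : X = Y := by
  rcases hA X hX Y hY with rfl | h' | h'
  · rfl
  · exact absurd h h'.1.ne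
  · exact absurd h h'.1.ne'

theorem flag_insert (_f : Frame s p H) {A : Set (residueGeometry s p H).Obj}
    (hA : (residueGeometry s p H).IsFlag A) {U : Submodule F V} (hU : IsObj s p H U)
    {d : ℕ} (hd : finrank F U = d) (h0 : ∀ Y ∈ A, finrank F Y.1 ≠ d)
    (h1 : ∀ Y ∈ A, finrank F Y.1 < d → IncLT s p Y.1 U)
    (h2 : ∀ Y ∈ A, d < finrank F Y.1 → IncLT s p U Y.1) :
    ∃ B, A ⊆ B ∧ (residueGeometry s p H).IsFlag B ∧ ∃ X ∈ B, finrank F X.1 = d := by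
  have key : ∀ Y ∈ A, (residueGeometry s p H).inc ⟨U, hU⟩ Y := by
    intro Y hY
    rcases lt_or_gt_of_ne (h0 Y hY) with h | h
    · exact Or.inr (Or.inr (h1 Y hY h))
    · exact Or.inr (Or.inl (h2 Y hY h))
  refine ⟨insert ⟨U, hU⟩ A, Set.subset_insert _ _, ?_, ⟨U, hU⟩, Set.mem_insert _ _, hd⟩
  rintro X (rfl | hX) Y (rfl | hY)
  · exact (residueGeometry s p H).inc_refl _
  · exact key Y hY
  · exact (residueGeometry s p H).inc_symm _ _ (key X hX)
  · exact hA X hX Y hY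

theorem finrank_le_four (f : Frame s p H) (X : (residueGeometry s p H).Obj) :
    1 ≤ finrank F X.1 ∧ finrank F X.1 ≤ 4 := by
  have := X.2.2.2.2.2.2
  rw [f.finrank_eq] at this
  exact this

theorem exists_lowest (B : Set (residueGeometry s p H).Obj) (hB : B.Nonempty) :
    ∃ Y ∈ B, ∀ Z ∈ B, finrank F Y.1 ≤ finrank F Z.1 := by
  obtain ⟨Y, hY, h⟩ := WellFounded.has_min
    (measure fun Z : (residueGeometry s p H).Obj => finrank F Z.1).wf B hB
  exact ⟨Y, hY, fun Z hZ => not_lt.1 (h Z hZ)⟩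

/-- A flag is a chain for a transitive relation, so a new member has to be compared only with its
neighbours in the chain. The missing dimensions are filled in from the bottom, so that the lower
neighbour is always available. -/
theorem flag_add_point (f : Frame s p H) {A : Set (residueGeometry s p H).Obj}
    (hA : (residueGeometry s p H).IsFlag A) :
    ∃ B, A ⊆ B ∧ (residueGeometry s p H).IsFlag B ∧ ∃ X ∈ B, finrank F X.1 = 1 := by
  by_cases h : ∃ X ∈ A, finrank F X.1 = 1
  · exact ⟨A, le_rfl, hA, h⟩
  push Not at h
  rcases A.eq_empty_or_nonempty with rfl | hne
  · obtain ⟨U, hU, hd, -⟩ := f.exists_point 0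
    exact f.flag_insert hA hU hd (by simp) (by simp) (by simp)
  · obtain ⟨Y, hY, hmin⟩ := exists_lowest A hne
    obtain ⟨U, hU, hd, hlt⟩ := f.exists_point_lt Y.2
      (lt_of_le_of_ne (f.finrank_le_four Y).1 (h Y hY).symm)
    refine f.flag_insert hA hU hd h (fun Z _ hZ => ?_) (fun Z hZ _ => ?_)
    · have := (f.finrank_le_four Z).1
      omega
    · rcases (hmin Z hZ).eq_or_lt with e | e
      · rwa [← f.flag_eq hA hY hZ e]
      · exact f.incLT_trans hU Y.2 Z.2 hlt (f.flag_lt hA hY hZ e)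

theorem flag_add_line (f : Frame s p H) {A : Set (residueGeometry s p H).Obj}
    (hA : (residueGeometry s p H).IsFlag A) (h1 : ∃ X ∈ A, finrank F X.1 = 1) :
    ∃ B, A ⊆ B ∧ (residueGeometry s p H).IsFlag B ∧ ∃ X ∈ B, finrank F X.1 = 2 := by
  by_cases h : ∃ X ∈ A, finrank F X.1 = 2
  · exact ⟨A, le_rfl, hA, h⟩
  push Not at h
  obtain ⟨P, hP, hdP⟩ := h1
  have hlow : ∀ U : Submodule F V, finrank F U = 2 → IncLT s p P.1 U → ∀ Z ∈ A, finrank F Z.1 < 2 →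
      IncLT s p Z.1 U := by
    intro U hd hPU Z hZ hlt
    have := (f.finrank_le_four Z).1
    rwa [f.flag_eq hA hZ hP (by omega)]
  by_cases hne : {Y | Y ∈ A ∧ 2 < finrank F Y.1}.Nonempty
  · obtain ⟨Y, ⟨hY, hY2⟩, hmin⟩ := exists_lowest _ hne
    obtain ⟨U, hU, hd, hPU, hUY⟩ := f.exists_line_between P.2 Y.2 hdP hY2
      (f.flag_lt hA hP hY (by omega))
    refine f.flag_insert hA hU hd h (hlow U hd hPU) (fun Z hZ hlt => ?_)
    rcases (hmin Z ⟨hZ, hlt⟩).eq_or_lt with e | e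
    · rwa [← f.flag_eq hA hY hZ e]
    · exact f.incLT_trans hU Y.2 Z.2 hUY (f.flag_lt hA hY hZ e)
  · obtain ⟨U, hU, hd, hPU⟩ := f.exists_line_gt P.2 hdP
    exact f.flag_insert hA hU hd h (hlow U hd hPU)
      (fun Z hZ hlt => absurd ⟨Z, hZ, hlt⟩ hne)

theorem flag_add_plane (f : Frame s p H) {A : Set (residueGeometry s p H).Obj}
    (hA : (residueGeometry s p H).IsFlag A) (h1 : ∃ X ∈ A, finrank F X.1 = 2) :
    ∃ B, A ⊆ B ∧ (residueGeometry s p H).IsFlag B ∧ ∃ X ∈ B, finrank F X.1 = 3 := by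
  by_cases h : ∃ X ∈ A, finrank F X.1 = 3
  · exact ⟨A, le_rfl, hA, h⟩
  push Not at h
  obtain ⟨L, hL, hdL⟩ := h1
  have hlow : ∀ U, IsObj s p H U → finrank F U = 3 → IncLT s p L.1 U → ∀ Z ∈ A,
      finrank F Z.1 < 3 → IncLT s p Z.1 U := by
    intro U hU hd hLU Z hZ hlt
    rcases (show finrank F Z.1 ≤ finrank F L.1 by omega).eq_or_lt with e | e
    · rwa [f.flag_eq hA hZ hL e]
    · exact f.incLT_trans Z.2 L.2 hU (f.flag_lt hA hZ hL e) hLU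
  by_cases hne : ∃ Y ∈ A, finrank F Y.1 = 4
  · obtain ⟨Y, hY, hY4⟩ := hne
    obtain ⟨U, hU, hd, hLU, hUY⟩ := f.exists_plane_between L.2 Y.2 hdL hY4
      (f.flag_lt hA hL hY (by omega))
    refine f.flag_insert hA hU hd h (hlow U hU hd hLU) (fun Z hZ hlt => ?_)
    have := (f.finrank_le_four Z).2
    rwa [f.flag_eq hA hZ hY (by omega)]
  · obtain ⟨U, hU, hd, hLU⟩ := f.exists_plane_gt L.2 hdL
    refine f.flag_insert hA hU hd h (hlow U hU hd hLU)
      (fun Z hZ hlt => absurd ⟨Z, hZ, ?_⟩ hne)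
    have := (f.finrank_le_four Z).2
    omega

theorem flag_add_solid (f : Frame s p H) {A : Set (residueGeometry s p H).Obj}
    (hA : (residueGeometry s p H).IsFlag A) (h1 : ∃ X ∈ A, finrank F X.1 = 3) :
    ∃ B, A ⊆ B ∧ (residueGeometry s p H).IsFlag B ∧ ∃ X ∈ B, finrank F X.1 = 4 := by
  by_cases h : ∃ X ∈ A, finrank F X.1 = 4
  · exact ⟨A, le_rfl, hA, h⟩
  push Not at h
  obtain ⟨Q, hQ, hdQ⟩ := h1
  obtain ⟨U, hU, hd, hQU⟩ := f.exists_solid_gt Q.2 hdQ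
  refine f.flag_insert hA hU hd h (fun Z hZ hlt => ?_) (fun Z hZ hlt => ?_)
  · rcases (show finrank F Z.1 ≤ finrank F Q.1 by omega).eq_or_lt with e | e
    · rwa [f.flag_eq hA hZ hQ e]
    · exact f.incLT_trans Z.2 Q.2 hU (f.flag_lt hA hZ hQ e) hQU
  · have := (f.finrank_le_four Z).2
    omega

theorem isGeometry (f : Frame s p H) : (residueGeometry s p H).IsGeometry := by
  have key : ∀ A, (residueGeometry s p H).IsFlag A →
      ∃ C, A ⊆ C ∧ (residueGeometry s p H).IsChamber C := by
    intro A hA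
    obtain ⟨B, hAB, hB, P, hP, hdP⟩ := f.flag_add_point hA
    obtain ⟨C, hBC, hC, L, hL, hdL⟩ := f.flag_add_line hB ⟨P, hP, hdP⟩
    obtain ⟨D, hCD, hD, Q, hQ, hdQ⟩ := f.flag_add_plane hC ⟨L, hL, hdL⟩
    obtain ⟨E, hDE, hE, S, hS, hdS⟩ := f.flag_add_solid hD ⟨Q, hQ, hdQ⟩
    refine ⟨E, hAB.trans (hBC.trans (hCD.trans hDE)), hE, Set.eq_univ_of_forall ?_⟩
    rintro ⟨i, hi⟩
    have hi' := hi
    rw [f.finrank_eq] at hi'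
    have : i = 1 ∨ i = 2 ∨ i = 3 ∨ i = 4 := by
      obtain ⟨h1, h2⟩ := hi'
      omega
    rcases this with rfl | rfl | rfl | rfl
    · exact ⟨P, hDE (hCD (hBC hP)), Subtype.ext hdP⟩
    · exact ⟨L, hDE (hCD hL), Subtype.ext hdL⟩
    · exact ⟨Q, hDE hQ, Subtype.ext hdQ⟩
    · exact ⟨S, hS, Subtype.ext hdS⟩
  refine ⟨fun i => ?_, key⟩
  obtain ⟨C, -, -, hC⟩ := key ∅ (fun x hx => hx.elim)
  have hi : i ∈ (residueGeometry s p H).typ '' C := by rw [hC]; trivial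
  obtain ⟨x, -, hx⟩ := hi
  exact ⟨x, hx⟩

/-! ### Points of the cover and the partitions of shadows -/

/-- The points of the cover. -/
def cpt (f : Frame s p H) (x : Coords) (ε : ZMod 2) : Submodule F V :=
  Submodule.span F {f.vec (ε, 1, x)}

theorem vec_ne_zero (f : Frame s p H) (x : Coords) (ε : ZMod 2) : f.vec (ε, 1, x) ≠ 0 := by
  rw [Ne, map_eq_zero_iff _ f.vec.injective]
  simp

theorem cpt_le (f : Frame s p H) {x : Coords} {ε : ZMod 2} {U : Submodule F V} :
    f.cpt x ε ≤ U ↔ f.vec (ε, 1, x) ∈ U := Submodule.span_singleton_le_iff_mem _ _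

theorem cpt_zero_le (f : Frame s p H) {x : Coords} {U : Submodule F V} :
    f.cpt x 0 ≤ U ↔ x ∈ f.trace U := f.cpt_le

theorem cpt_inj (f : Frame s p H) {x y : Coords} {ε δ : ZMod 2} :
    f.cpt x ε = f.cpt y δ ↔ x = y ∧ ε = δ := by
  constructor
  · intro h
    have h1 : f.vec (ε, 1, x) ∈ f.cpt y δ := f.cpt_le.1 h.le
    rw [cpt, f.mem_span_singleton] at h1
    have h2 := f.vec.injective (h1.resolve_left (f.vec_ne_zero x ε))
    simp only [Prod.mk.injEq, true_and] at h2
    exact h2.symm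
  · rintro ⟨rfl, rfl⟩
    rfl

theorem isPoint_iff (f : Frame s p H) {q : Submodule F V} :
    IsPoint s p q ↔ ∃ x ε, q = f.cpt x ε := by
  constructor
  · rintro ⟨h1, h2⟩
    obtain ⟨v, hv, hvp⟩ := SetLike.not_le_iff_exists.1 h2
    obtain ⟨⟨ε, β, x⟩, rfl⟩ := f.vec.surjective v
    rw [f.mem_orthogonal_p] at hvp
    have hβ : β = 1 := zmod_two_ne_zero.1 hvp
    subst hβ
    have := f.finiteDimensional
    refine ⟨x, ε, (Submodule.eq_of_le_of_finrank_eq (f.cpt_le.2 hv) ?_).symm⟩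
    rw [h1, cpt, finrank_span_singleton (f.vec_ne_zero x ε)]
  · rintro ⟨x, ε, rfl⟩
    refine ⟨finrank_span_singleton (f.vec_ne_zero x ε), ?_⟩
    rw [f.cpt_le, f.mem_orthogonal_p]
    exact one_ne_zero

/-- Adding the generator `vec (1, 0, 0)` of `p` changes only the first coordinate, so the fiber
consists of `cpt x 0` and `cpt x 1`. -/
theorem proj_cpt (f : Frame s p H) (x : Coords) (ε : ZMod 2) : proj p H (f.cpt x ε) = f.cpt x 0 := by
  have hp : ∀ v, v ∈ p ↔ v = 0 ∨ v = f.vec (1, 0, 0) := fun v => by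
    rw [← f.mem_span_singleton, ← f.p_eq]
  apply le_antisymm
  · rintro v ⟨hv, hvH⟩
    obtain ⟨a, ha, b, hb, rfl⟩ := Submodule.mem_sup.1 hv
    rw [cpt, f.mem_span_singleton] at hb ⊢
    rw [hp] at ha
    rcases ha with rfl | rfl <;> rcases hb with rfl | rfl
    · exact Or.inl (add_zero _)
    · rw [zero_add] at hvH ⊢
      have h : ε = 0 := (f.mem_H _).1 hvH
      exact Or.inr (by rw [h])
    · rw [add_zero] at hvH
      exact absurd ((f.mem_H _).1 hvH) one_ne_zero
    · rw [← map_add] at hvH ⊢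
      have h : 1 + ε = 0 := (f.mem_H _).1 hvH
      refine Or.inr (congrArg f.vec ?_)
      simp [h]
  · rw [f.cpt_le]
    refine ⟨?_, f.pt_mem_H x⟩
    have h1 : f.vec (ε, 1, x) ∈ p ⊔ f.cpt x ε :=
      (le_sup_right : f.cpt x ε ≤ _) (Submodule.mem_span_singleton_self _)
    rcases zmod_two_cases ε with rfl | rfl
    · exact h1
    · have h2 : f.vec (1, 0, 0) ∈ p ⊔ f.cpt x 1 :=
        (le_sup_left : p ≤ _) ((hp _).2 (Or.inr rfl))
      have h3 := Submodule.add_mem _ h1 h2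
      rw [← map_add] at h3
      have h4 : ((1 : ZMod 2), (1 : ZMod 2), x) + (1, 0, 0) = (0, 1, x) := by
        simp only [Prod.mk_add_mk, add_zero]
        rfl
      rwa [h4] at h3

theorem mem_shadow (f : Frame s p H) {X : Submodule F V} (hX : X ≤ H) {q : Submodule F V} :
    q ∈ shadow s p X ↔ ∃ x ∈ f.trace X, q = f.cpt x 0 := by
  constructor
  · rintro ⟨h1, h2⟩
    obtain ⟨x, ε, rfl⟩ := f.isPoint_iff.1 h1
    have h3 := f.cpt_le.1 h2
    have h4 : ε = 0 := (f.mem_H _).1 (hX h3)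
    subst h4
    exact ⟨x, h3, rfl⟩
  · rintro ⟨x, hx, rfl⟩
    exact ⟨f.isPoint_iff.2 ⟨x, 0, rfl⟩, f.cpt_zero_le.2 hx⟩

theorem cpt_mem_shadow (f : Frame s p H) {X : Submodule F V} (hX : X ≤ H) {x : Coords}
    {ε : ZMod 2} : f.cpt x ε ∈ shadow s p X ↔ x ∈ f.trace X ∧ ε = 0 := by
  rw [f.mem_shadow hX]
  constructor
  · rintro ⟨y, hy, e⟩
    obtain ⟨rfl, rfl⟩ := f.cpt_inj.1 e
    exact ⟨hy, rfl⟩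
  · rintro ⟨hx, rfl⟩
    exact ⟨x, hx, rfl⟩

theorem cpt_mem_upper (f : Frame s p H) {A : Set (Submodule F V)} {x : Coords} {ε : ZMod 2} :
    f.cpt x ε ∈ upper s p H A ↔ f.cpt x 0 ∈ A ∧ ε = 1 := by
  change (_ ∧ proj p H (f.cpt x ε) ∈ A ∧ f.cpt x ε ≠ proj p H (f.cpt x ε)) ↔ _
  rw [proj_cpt, Ne, cpt_inj, and_iff_right (f.isPoint_iff.2 ⟨x, ε, rfl⟩), eq_self_iff_true,
    true_and]
  exact and_congr_right fun _ => zmod_two_ne_zero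

theorem trace_eq_pair (f : Frame s p H) {X : Submodule F V} (hX : IsObj s p H X)
    (hd : finrank F X = 2) {x y : Coords} (hx : x ∈ f.trace X) (hy : y ∈ f.trace X) (hxy : x ≠ y) :
    f.trace X = {x, y} := by
  symm
  refine Set.eq_of_subset_of_ncard_le ?_ ?_ (Set.toFinite _)
  · rintro _ (rfl | rfl)
    exacts [hx, hy]
  · rw [f.ncard_of_finrank (k := 1) hX.1 hX.2.1 hd, Set.ncard_pair hxy, pow_one]

theorem form_add_form_of_joined (f : Frame s p H) {U : Submodule F V} (hU : IsObj s p H U)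
    {x y z : Coords} (hx : x ∈ f.trace U) (hy : y ∈ f.trace U) (hz : z ∈ f.trace U) (hxy : x ≠ y)
    (hxz : x ≠ z) (hyz : y ≠ z) (jxy : f.Joined U x y) (jxz : f.Joined U x z)
    (jyz : f.Joined U y z) : form x y + form y z + form x z = 1 :=
  form_add_add_eq_one_iff.1 (f.form_of_joined hU hx hy hz hxy hxz hyz jxy jxz jyz)

/-- Two radical points and a third point of the plane would have pairwise vanishing forms, against
the odd sum for joined points. -/
theorem plane_rad (f : Frame s p H) {X : Submodule F V} (hX : IsObj s p H X)
    (hd : finrank F X = 3) :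
    ∃ d ∈ f.trace X, rad s X = f.cpt d 0 ∧ ∀ y ∈ f.trace X, form d y = 0 := by
  obtain ⟨a, b, c, hf, hT⟩ := f.trace_plane hX hd
  obtain ⟨d, hd0, hd1⟩ := exists_plane_rad hf
  rw [← hT] at hd0 hd1
  refine ⟨d, hd0, ?_, hd1⟩
  have hdr : f.pt d ∈ rad s X := (f.pt_mem_rad hX.1).2 ⟨hd0, hd1⟩
  have huniq : ∀ x, f.pt x ∈ rad s X → x = d := by
    intro x hx
    obtain ⟨hx0, hx1⟩ := (f.pt_mem_rad hX.1).1 hx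
    by_contra hne
    obtain ⟨z, hz, hzx⟩ : ∃ z ∈ f.trace X, z ∉ ({x, d} : Set Coords) := by
      refine Set.exists_mem_notMem_of_ncard_lt_ncard ?_
      rw [f.ncard_of_finrank (k := 2) hX.1 hX.2.1 hd]
      exact (Set.ncard_insert_le _ _).trans_lt (by rw [Set.ncard_singleton]; norm_num)
    have hj : ∀ x y, f.Joined X x y := f.joined_of_finrank_ne (by omega)
    have := f.form_add_form_of_joined hX hx0 hd0 hz hne (fun e => hzx (Or.inl e.symm))
      (fun e => hzx (Or.inr e.symm)) (hj _ _) (hj _ _) (hj _ _)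
    rw [hx1 d hd0, hd1 z hz, hx1 z hz] at this
    revert this; decide
  apply le_antisymm
  · intro v hv
    rw [cpt, f.mem_span_singleton]
    rcases f.eq_pt_or_dir (hX.1 hv.1) with ⟨x, rfl⟩ | ⟨x, rfl⟩
    · rw [huniq x hv]
      exact Or.inr rfl
    · have h1 := Submodule.add_mem _ hdr hv
      rw [pt_add_dir] at h1
      have h2 : x = 0 := by simpa using huniq _ h1
      rw [h2]
      exact Or.inl f.dir_zero
  · exact f.cpt_le.2 hdr

theorem cpt_le_rad_sup (f : Frame s p H) {X : Submodule F V} (hX : X ≤ H) {c x : Coords} :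
    f.cpt x 0 ≤ rad s (X ⊓ s.orthogonal p) ⊔ f.cpt c 0 ↔
      f.dir (c + x) ∈ rad s (X ⊓ s.orthogonal p) := by
  rw [f.cpt_le]
  change f.pt x ∈ _ ↔ _
  constructor
  · intro h
    obtain ⟨w, hw, m, hm, e⟩ := Submodule.mem_sup.1 h
    obtain ⟨d, rfl⟩ := f.exists_eq_dir (hX hw.1.1) hw.1.2
    rw [cpt, f.mem_span_singleton] at hm
    rcases hm with rfl | rfl
    · rw [add_zero] at e
      exact absurd (e ▸ f.dir_mem_orthogonal d) (f.pt_notMem_orthogonal x)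
    · have e : f.dir d + f.pt c = f.pt x := e
      rw [add_comm, pt_add_dir] at e
      rw [← f.pt_injective e, coords_add_add_cancel]
      exact hw
  · intro h
    refine Submodule.mem_sup.2 ⟨_, h, f.pt c, Submodule.mem_span_singleton_self _, ?_⟩
    rw [add_comm, pt_add_dir, coords_add_add_cancel]

theorem cpt_le_orthogonal (f : Frame s p H) {c x : Coords} :
    f.cpt x 0 ≤ s.orthogonal (f.cpt c 0) ↔ form c x = 0 := by
  rw [f.cpt_le]
  change f.pt x ∈ _ ↔ _
  rw [LinearMap.BilinForm.mem_orthogonal_iff]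
  constructor
  · intro h
    have h1 : s (f.pt c) (f.pt x) = 0 := h _ (Submodule.mem_span_singleton_self _)
    rwa [s_pt_pt, map_eq_zero_iff _ f.φ.injective] at h1
  · intro h n hn
    change s n _ = 0
    rw [cpt, f.mem_span_singleton] at hn
    rcases hn with rfl | rfl
    · simp
    · change s (f.pt c) (f.pt x) = 0
      rw [s_pt_pt, h, map_zero]

theorem isPart_subset (f : Frame s p H) {X : Submodule F V} (hX : IsObj s p H X)
    {X₀ : Set (Submodule F V)} (h : IsPart s p X X₀) : X₀ ⊆ shadow s p X := by
  cases h with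
  | point => exact le_rfl
  | hyperbolicLine => exact le_rfl
  | isotropicLine _ _ x₀ hx₀ => exact Set.singleton_subset_iff.2 hx₀
  | plane hd =>
    obtain ⟨d, hd0, hd1, -⟩ := f.plane_rad hX hd
    rw [hd1]
    exact Set.singleton_subset_iff.2 ((f.cpt_mem_shadow hX.1).2 ⟨hd0, rfl⟩)
  | nondegenerateSolid => exact fun x hx => hx.1
  | degenerateSolid => exact fun x hx => hx.1

theorem exists_isPart (f : Frame s p H) {X : Submodule F V} (hX : IsObj s p H X) :
    ∃ X₀, IsPart s p X X₀ := by
  rcases f.shape hX with ⟨hd, -⟩ | ⟨hd, a, b, hab, hT⟩ | ⟨hd, -⟩ | ⟨hd, t, ε, ht, hT⟩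
  · exact ⟨_, .point hd⟩
  · obtain ⟨h0, h1⟩ := f.line_rad hX.1 hT
    rcases zmod_two_cases (form a b) with h | h
    · exact ⟨_, .isotropicLine hd (h0 h) (f.cpt a 0)
        ((f.cpt_mem_shadow hX.1).2 ⟨by rw [hT]; exact Or.inl rfl, rfl⟩)⟩
    · exact ⟨_, .hyperbolicLine hd (h1 h)⟩
  · exact ⟨_, .plane hd⟩
  · obtain ⟨h0, h1⟩ := f.solid_rad hX.1 ht hT
    rcases zmod_two_cases ε with h | h
    · exact ⟨_, .degenerateSolid hd (h0 h).2⟩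
    · obtain ⟨a, ha⟩ := f.trace_nonempty hX.1 hX.2.1
      exact ⟨_, .nondegenerateSolid hd (h1 h) (f.cpt a 0)
        ((f.cpt_mem_shadow hX.1).2 ⟨ha, rfl⟩)⟩

theorem zmod_two_sum : ∀ a b c : ZMod 2, a + b + c = 1 → (a = 1 ↔ (b = 1 ↔ c = 1)) := by
  decide

/-- The rule common to all the partitions: joined points are in the same part exactly when they are
non-perpendicular. It determines the partition up to exchanging the parts, so the choices made in it
do not matter. -/
theorem isPart_form (f : Frame s p H) {X : Submodule F V} (hX : IsObj s p H X)
    {X₀ : Set (Submodule F V)} (h : IsPart s p X X₀) {x y : Coords} (hx : x ∈ f.trace X)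
    (hy : y ∈ f.trace X) (hxy : x ≠ y) (hj : f.Joined X x y) :
    form x y = 1 ↔ (f.cpt x 0 ∈ X₀ ↔ f.cpt y 0 ∈ X₀) := by
  have hshx := (f.cpt_mem_shadow (ε := 0) hX.1).2 ⟨hx, rfl⟩
  have hshy := (f.cpt_mem_shadow (ε := 0) hX.1).2 ⟨hy, rfl⟩
  cases h with
  | point hd =>
    obtain ⟨a, ha⟩ := f.trace_point hX hd
    rw [ha] at hx hy
    exact absurd (hx.trans hy.symm) hxy
  | hyperbolicLine hd hr =>
    refine iff_of_true ?_ (iff_of_true hshx hshy)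
    obtain ⟨h0, -⟩ := f.line_rad hX.1 (f.trace_eq_pair hX hd hx hy hxy)
    refine zmod_two_ne_zero.1 fun h => ?_
    have h1 := h0 h
    rw [hr] at h1
    rw [← h1, finrank_bot] at hd
    omega
  | isotropicLine hd hr x₀ hx₀ =>
    have h0 : form x y = 0 := by
      have h1 := hx
      rw [mem_trace, ← hr, f.pt_mem_rad hX.1] at h1
      exact h1.2 y hy
    obtain ⟨z, hz, rfl⟩ := (f.mem_shadow hX.1).1 hx₀
    rw [f.trace_eq_pair hX hd hx hy hxy] at hz
    rw [h0, Set.mem_singleton_iff, Set.mem_singleton_iff, cpt_inj, cpt_inj]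
    simp only [zero_ne_one, and_true, false_iff]
    rcases hz with rfl | rfl
    · exact fun h => hxy (h.1 rfl).symm
    · exact fun h => hxy (h.2 rfl)
  | plane hd =>
    obtain ⟨d, hd0, hd1, hd2⟩ := f.plane_rad hX hd
    rw [hd1, Set.mem_singleton_iff, Set.mem_singleton_iff, cpt_inj, cpt_inj]
    simp only [and_true]
    by_cases hxd : x = d
    · subst hxd
      rw [hd2 y hy]
      simp [hxy.symm]
    · by_cases hyd : y = d
      · subst hyd
        rw [form_comm, hd2 x hx]
        simp [hxy]
      · have hj : ∀ x y, f.Joined X x y := f.joined_of_finrank_ne (by omega)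
        have := f.form_add_form_of_joined hX hx hy hd0 hxy hxd hyd (hj _ _) (hj _ _) (hj _ _)
        rw [form_comm y d, form_comm x d, hd2 x hx, hd2 y hy, add_zero, add_zero] at this
        simp [this, hxd, hyd]
  | nondegenerateSolid hd hr p₁ hp₁ =>
    obtain ⟨c, hc, rfl⟩ := (f.mem_shadow hX.1).1 hp₁
    obtain ⟨t, ε, ht, hT⟩ := f.exists_normal hX.1 hX.2.1 hd
    have hε : ε = 1 := by
      refine zmod_two_ne_zero.1 fun h => ?_
      have := ((f.solid_rad hX.1 ht hT).1 h).2
      rw [hr, finrank_bot] at this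
      omega
    subst hε
    -- With `p₁` the point over `c`, the first part consists of `c` and the points joined and
    -- non-perpendicular to `c`.
    have hmem : ∀ z ∈ f.trace X, (f.cpt z 0 ∈ {x | x ∈ shadow s p X ∧ (x = f.cpt c 0 ∨
        ¬ x ≤ rad s (X ⊓ s.orthogonal p) ⊔ f.cpt c 0 ∧ ¬ x ≤ s.orthogonal (f.cpt c 0))} ↔
        z = c ∨ (c + z ≠ 0 ∧ c + z ≠ t) ∧ form c z = 1) := by
      intro z hz
      rw [Set.mem_ofPred_eq, cpt_inj, f.cpt_le_rad_sup hX.1, f.dir_mem_rad_inf hX.1 ht hT,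
        f.cpt_le_orthogonal, f.cpt_mem_shadow hX.1, not_or,
        show ¬ form c z = 0 ↔ form c z = 1 from zmod_two_ne_zero]
      simp [hz]
    rw [hmem x hx, hmem y hy]
    rw [f.joined_iff hX.1 hd ht hT] at hj
    have hct : form c t = 1 := by rw [hT] at hc; exact hc
    -- This treats the partner `c + t` of `c`. As `form t y = 1` on the trace, perpendicularity to
    -- the partner is opposite to perpendicularity to `c`, as it should be for a point of the other
    -- part.
    have key : ∀ x y, c + x = t → form x y = form c y + form t y := by
      intro x y h
      rw [← coords_add_add_cancel c x, h, form_add_left]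
    by_cases hxc : x = c
    · subst hxc
      simp [hj.1, hj.2, hxy.symm]
    by_cases hyc : y = c
    · subst hyc
      rw [add_comm] at hj
      rw [form_comm]
      simp [hj.1, hj.2, hxc]
    have hxc0 : c + x ≠ 0 := fun h => hxc (coords_add_eq_zero.1 h).symm
    have hyc0 : c + y ≠ 0 := fun h => hyc (coords_add_eq_zero.1 h).symm
    have hxt : form x t = 1 := by rw [hT] at hx; exact hx
    have hyt : form y t = 1 := by rw [hT] at hy; exact hy
    have z1 : ∀ a : ZMod 2, (a + 1 = 1 ↔ ¬ a = 1) := by decide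
    by_cases hcx : c + x = t
    · have hcy : c + y ≠ t := fun h => hxy (add_left_cancel (hcx.trans h.symm))
      rw [key x y hcx, form_comm t y, hyt, z1]
      simp [hxc, hyc, hcx, hyc0, hcy]
    · by_cases hcy : c + y = t
      · rw [form_comm, key y x hcy, form_comm t x, hxt, z1]
        simp [hxc, hyc, hcx, hxc0, hcy]
      -- Now `c`, `x`, `y` are pairwise joined, and the odd sum gives `form x y = 1` exactly when
      -- `x` and `y` behave alike towards `c`.
      · have := f.form_add_form_of_joined hX hx hy hc hxy hxc hyc
          ((f.joined_iff hX.1 hd ht hT).2 hj)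
          (f.joined_comm.1 ((f.joined_iff hX.1 hd ht hT).2 ⟨hxc0, hcx⟩))
          (f.joined_comm.1 ((f.joined_iff hX.1 hd ht hT).2 ⟨hyc0, hcy⟩))
        rw [zmod_two_sum _ _ _ this, form_comm y c, form_comm x c]
        simp only [hxc, hyc, hcx, hxc0, hcy, hyc0, false_or, ne_eq, not_false_eq_true, true_and]
        exact iff_comm
  | degenerateSolid hd hr =>
    obtain ⟨t, ε, ht, hT⟩ := f.exists_normal hX.1 hX.2.1 hd
    have hε : ε = 0 := by
      by_contra h
      rw [(f.solid_rad hX.1 ht hT).2 (zmod_two_ne_zero.1 h), finrank_bot] at hr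
      omega
    have hrad := ((f.solid_rad hX.1 ht hT).1 hε).1
    have hmem : ∀ z ∈ f.trace X, (f.cpt z 0 ∈ {x | x ∈ shadow s p X ∧ x ≤ rad s X} ↔
        z = 0 ∨ z = t) := by
      intro z hz
      rw [Set.mem_ofPred_eq, f.cpt_zero_le, hrad, f.cpt_mem_shadow hX.1]
      simp [hz]
    rw [hmem x hx, hmem y hy]
    -- The radical point `0` serves as third point: two joined points outside the radical are both
    -- perpendicular to it, hence non-perpendicular to each other.
    have h00 : (0 : Coords) ∈ f.trace X := by
      rw [hT, hε]
      exact form_zero_left t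
    have hrf : ∀ x ∈ f.trace X, (x = 0 ∨ x = t) → ∀ y ∈ f.trace X, form x y = 0 := by
      intro x hx h y hy
      have h1 : x ∈ f.trace (rad s X) := by rw [hrad]; exact h
      exact ((f.pt_mem_rad hX.1).1 h1).2 y hy
    have hjj := hj
    rw [f.joined_iff hX.1 hd ht hT] at hj
    have hnot : (x = 0 ∨ x = t) → ¬ (y = 0 ∨ y = t) := by
      rintro (rfl | rfl) (rfl | rfl)
      · exact hxy rfl
      · exact hj.2 (zero_add _)
      · exact hj.2 (add_zero _)
      · exact hxy rfl
    by_cases hxr : x = 0 ∨ x = t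
    · rw [hrf x hx hxr y hy]
      simp [hxr, hnot hxr]
    · by_cases hyr : y = 0 ∨ y = t
      · rw [form_comm, hrf y hy hyr x hx]
        simp only [hyr, hxr]
        simp
      · have jz : ∀ z, ¬ (z = 0 ∨ z = t) → f.Joined X z 0 := by
          intro z hz
          rw [f.joined_iff hX.1 hd ht hT, add_zero]
          exact not_or.1 hz
        have := f.form_add_form_of_joined hX hx hy h00 hxy (fun e => hxr (Or.inl e))
          (fun e => hyr (Or.inl e)) hjj (jz x hxr) (jz y hyr)
        rw [form_zero_right, form_zero_right, add_zero, add_zero] at this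
        exact iff_of_true this (iff_of_false hxr hyr)

/-! ### Point-shadows of the cover as sections -/

/-- The point-shadows over `X` in the cover are the sections over the shadow of `X` in which joined
points are not perpendicular. -/
structure Section (f : Frame s p H) (X : Submodule F V) (S : Set (Submodule F V)) : Prop where
  exists_eq : ∀ q ∈ S, ∃ x ∈ f.trace X, ∃ ε, q = f.cpt x ε
  zero_iff : ∀ x ∈ f.trace X, (f.cpt x 0 ∈ S ↔ f.cpt x 1 ∉ S)
  form_eq : ∀ x y ε δ, f.cpt x ε ∈ S → f.cpt y δ ∈ S → x ≠ y → f.Joined X x y →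
    ε + δ + form x y = 1

theorem cpt_mem_lift (f : Frame s p H) {X : Submodule F V} (hX : X ≤ H)
    {X₀ : Set (Submodule F V)} (hX₀ : X₀ ⊆ shadow s p X) {x : Coords} {ε : ZMod 2} :
    (f.cpt x ε ∈ upper s p H X₀ ∪ lower (shadow s p X \ X₀) ↔
      x ∈ f.trace X ∧ (f.cpt x 0 ∈ X₀ ↔ ε = 1)) ∧
    (f.cpt x ε ∈ lower X₀ ∪ upper s p H (shadow s p X \ X₀) ↔
      x ∈ f.trace X ∧ (f.cpt x 0 ∈ X₀ ↔ ε = 0)) := by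
  have h1 : f.cpt x 0 ∈ X₀ → x ∈ f.trace X := fun h => ((f.cpt_mem_shadow hX).1 (hX₀ h)).1
  have h2 : f.cpt x 1 ∉ X₀ := fun h => one_ne_zero ((f.cpt_mem_shadow hX).1 (hX₀ h)).2
  simp only [lower, Set.mem_union, f.cpt_mem_upper, Set.mem_sdiff, f.cpt_mem_shadow hX]
  rcases zmod_two_cases ε with rfl | rfl <;> simp <;> tauto

theorem section_of_isLift (f : Frame s p H) {X : Submodule F V} (hX : IsObj s p H X)
    {S : Set (Submodule F V)} (h : IsLift s p H X S) : f.Section X S := by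
  obtain ⟨X₀, hpart, hS⟩ := h
  have hsub := f.isPart_subset hX hpart
  have hex : ∀ q ∈ S, ∃ x ε, q = f.cpt x ε := by
    intro q hq
    refine f.isPoint_iff.1 ?_
    rcases hS with rfl | rfl
    · rcases hq with hq | hq
      exacts [hq.1, hq.1.1]
    · rcases hq with hq | hq
      exacts [(hsub hq).1, hq.1]
  -- The value `η` is the coordinate of the lifts of points of the first part: `1` for `X_+` and `0`
  -- for `X_-`.
  obtain ⟨η, hη⟩ : ∃ η : ZMod 2, ∀ x ε, f.cpt x ε ∈ S ↔
      x ∈ f.trace X ∧ (f.cpt x 0 ∈ X₀ ↔ ε = η) := by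
    rcases hS with rfl | rfl
    · exact ⟨1, fun x ε => (f.cpt_mem_lift hX.1 hsub).1⟩
    · exact ⟨0, fun x ε => (f.cpt_mem_lift hX.1 hsub).2⟩
  refine ⟨fun q hq => ?_, fun x hx => ?_, fun x y ε δ hx hy hxy hj => ?_⟩
  · obtain ⟨x, ε, rfl⟩ := hex q hq
    exact ⟨x, ((hη x ε).1 hq).1, ε, rfl⟩
  · rw [hη, hη]
    by_cases hm : f.cpt x 0 ∈ X₀ <;> simp only [hm, hx, true_and, true_iff, false_iff] <;>
      clear * - <;> revert η <;> decide
  · rw [hη] at hx hy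
    have h1 := f.isPart_form hX hpart hx.1 hy.1 hxy hj
    rw [hx.2, hy.2] at h1
    generalize form x y = a at h1
    clear * - h1
    revert ε δ η a; decide

theorem exists_isLift_mem (f : Frame s p H) {X : Submodule F V} (hX : IsObj s p H X)
    {x : Coords} (hx : x ∈ f.trace X) (ε : ZMod 2) :
    ∃ S, IsLift s p H X S ∧ f.cpt x ε ∈ S := by
  obtain ⟨X₀, hpart⟩ := f.exists_isPart hX
  have hsub := f.isPart_subset hX hpart
  have h := f.cpt_mem_lift hX.1 hsub (x := x) (ε := ε)
  by_cases h1 : f.cpt x 0 ∈ X₀ ↔ ε = 1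
  · exact ⟨_, ⟨X₀, hpart, Or.inl rfl⟩, h.1.2 ⟨hx, h1⟩⟩
  · refine ⟨_, ⟨X₀, hpart, Or.inr rfl⟩, h.2.2 ⟨hx, ?_⟩⟩
    rcases zmod_two_cases ε with rfl | rfl <;> simp at h1 ⊢ <;> exact h1

theorem Section.unique {f : Frame s p H} {X : Submodule F V} {S : Set (Submodule F V)}
    (h : f.Section X S) {x : Coords} {ε δ : ZMod 2} (hε : f.cpt x ε ∈ S) (hδ : f.cpt x δ ∈ S) :
    ε = δ := by
  obtain ⟨y, hy, η, e⟩ := h.exists_eq _ hε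
  obtain ⟨rfl, rfl⟩ := f.cpt_inj.1 e
  have := h.zero_iff _ hy
  rcases zmod_two_cases ε with rfl | rfl <;> rcases zmod_two_cases δ with rfl | rfl
  · rfl
  · exact absurd hδ (this.1 hε)
  · exact absurd hε (this.1 hδ)
  · rfl

theorem Section.exists_mem {f : Frame s p H} {X : Submodule F V} {S : Set (Submodule F V)}
    (h : f.Section X S) {x : Coords} (hx : x ∈ f.trace X) : ∃ ε, f.cpt x ε ∈ S := by
  by_cases h1 : f.cpt x 1 ∈ S
  exacts [⟨1, h1⟩, ⟨0, (h.zero_iff x hx).2 h1⟩]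

theorem Section.mem_trace {f : Frame s p H} {X : Submodule F V} {S : Set (Submodule F V)}
    (h : f.Section X S) {x : Coords} {ε : ZMod 2} (hx : f.cpt x ε ∈ S) : x ∈ f.trace X := by
  obtain ⟨y, hy, η, e⟩ := h.exists_eq _ hx
  rwa [(f.cpt_inj.1 e).1]

theorem Section.mem_of_form_eq {f : Frame s p H} {X : Submodule F V} {S : Set (Submodule F V)}
    (h : f.Section X S) {x y : Coords} {ε δ : ZMod 2} (hx : f.cpt x ε ∈ S) (hy : y ∈ f.trace X)
    (hxy : x ≠ y) (hj : f.Joined X x y) (hf : ε + δ + form x y = 1) : f.cpt y δ ∈ S := by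
  obtain ⟨η, hη⟩ := h.exists_mem hy
  have h1 := h.form_eq x y ε η hx hη hxy hj
  have : δ = η := by
    rw [← hf] at h1
    simpa using h1.symm
  rwa [this]

/-- Two sections over incident or equal objects with a common point are comparable. -/
theorem Section.subset {f : Frame s p H} {X Y : Submodule F V} (hX : IsObj s p H X)
    {S T : Set (Submodule F V)} (hS : f.Section X S) (hT : f.Section Y T)
    (hsub : f.trace X ⊆ f.trace Y)
    (hj : ∀ x ∈ f.trace X, ∀ y ∈ f.trace X, x ≠ y → f.Joined X x y → f.Joined Y x y)
    {x : Coords} {ε : ZMod 2} (hxS : f.cpt x ε ∈ S) (hxT : f.cpt x ε ∈ T) : S ⊆ T := by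
  have key : ∀ x y ε δ, x ≠ y → f.Joined X x y → f.cpt x ε ∈ S → f.cpt x ε ∈ T →
      f.cpt y δ ∈ S → f.cpt y δ ∈ T := fun x y ε δ hxy hjx hxS hxT hyS =>
    hT.mem_of_form_eq hxT (hsub (hS.mem_trace hyS)) hxy
      (hj x (hS.mem_trace hxS) y (hS.mem_trace hyS) hxy hjx) (hS.form_eq x y ε δ hxS hyS hxy hjx)
  intro q hq
  obtain ⟨y, hy, δ, rfl⟩ := hS.exists_eq q hq
  by_cases hxy : x = y
  · subst hxy
    rwa [← hS.unique hxS hq]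
  -- The common point spreads along joined pairs, if necessary through an intermediate point.
  · rcases f.joined_or hX (hS.mem_trace hxS) hxy with h | ⟨z, hz, hxz, hzy, h1, h2⟩
    · exact key x y ε δ hxy h hxS hxT hq
    · obtain ⟨η, hη⟩ := hS.exists_mem hz
      exact key z y η δ hzy h2 hη (key x z ε η hxz h1 hxS hxT hη) hq

end Frame

/-! ### Triangles generate the cycles of the collinearity graph of the cover -/

/-- Non-perpendicularity of points of the cover over different points of `Π(p,H)`. -/
def CoverAdj (v w : Coords × ZMod 2) : Prop := v.1 ≠ w.1 ∧ v.2 + w.2 + form v.1 w.1 = 1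

set_option synthInstance.maxSize 1000 in
theorem exists_common_perp : ∀ x y : Coords, form x y = 1 → ∃ a, a ≠ 0 ∧ a ≠ x ∧ a ≠ y ∧
    form a x = 0 ∧ form a y = 0 := by
  decide +kernel

set_option synthInstance.maxSize 1000 in
theorem exists_perp : ∀ b : Coords, ∃ a, a ≠ 0 ∧ a ≠ b ∧ form a b = 0 := by
  decide +kernel

-- Non-perpendicularity is a connected relation on the nonzero vectors. This compares any two edges
-- from the layer of the `(b, 0)` to `(0, 1)`.
set_option synthInstance.maxSize 1000 in
theorem exists_common_nonperp : ∀ b c : Coords, b ≠ 0 → c ≠ 0 →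
    ∃ d, d ≠ 0 ∧ form b d = 1 ∧ form d c = 1 := by
  decide +kernel

-- Non-perpendicularity is a connected relation on `b^⊥` without `0` and `b`. This compares any two
-- edges into `(b, 0)` from the preceding layer.
set_option synthInstance.maxSize 2000 in
theorem exists_perp_nonperp : ∀ b : Coords, b ≠ 0 → ∀ a, a ≠ 0 → a ≠ b → form a b = 0 →
    ∀ c, c ≠ 0 → c ≠ b → form c b = 0 → form a c = 0 →
    ∃ d, d ≠ 0 ∧ d ≠ b ∧ form d b = 0 ∧ form a d = 1 ∧ form d c = 1 := by
  decide +kernel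

/-- Compatible bijections along the edges of the collinearity graph of the cover, trivial on
triangles, admit a potential. -/
theorem exists_potential {C : Coords × ZMod 2 → Type w} (E : ∀ v w, CoverAdj v w → C v → C w)
    (hsymm : ∀ v w (h : CoverAdj v w) (h' : CoverAdj w v) c, E w v h' (E v w h c) = c)
    (htri : ∀ v w u (h : CoverAdj v w) (h' : CoverAdj w u) (h'' : CoverAdj v u) c,
      E w u h' (E v w h c) = E v u h'' c) (c₀ : C (0, 0)) :
    ∃ g : ∀ v, C v, ∀ v w (h : CoverAdj v w), E v w h (g v) = g w := by
  have adj01 : ∀ {x : Coords}, x ≠ 0 → CoverAdj (0, 0) (x, 1) := fun hx =>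
    ⟨hx.symm, by simp [form_zero_left]⟩
  have adj10 : ∀ {x y : Coords}, x ≠ y → form x y = 0 → CoverAdj (x, 1) (y, 0) := fun hx h =>
    ⟨hx, by simp [h]⟩
  have adj11 : ∀ {x y : Coords}, form x y = 1 → ∀ ε, CoverAdj (x, ε) (y, ε) := by
    intro x y h ε
    refine ⟨?_, ?_⟩
    · rintro rfl
      exact zero_ne_one ((form_self x).symm.trans h)
    · simp only [h]
      clear * -
      revert ε; decide
  have adj00 : ∀ {x : Coords}, x ≠ 0 → CoverAdj (x, 0) (0, 1) := fun hx =>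
    ⟨hx, by simp [form_zero_right]⟩
  -- Around `(0, 0)` the graph has three layers: the points `(x, 1)` with `x ≠ 0`, the points `(x,
  -- 0)` with `x ≠ 0`, and the single point `(0, 1)`. The potential is defined layer by layer; edges
  -- within the first layer form triangles with `(0, 0)`.
  let n : ∀ x (hx : x ≠ 0), C (x, 1) := fun x hx => E _ _ (adj01 hx) c₀
  have hn : ∀ x y (hx : x ≠ 0) (hy : y ≠ 0) (h : form x y = 1),
      E _ _ (adj11 h 1) (n x hx) = n y hy := fun x y hx hy h => htri _ _ _ _ _ _ _
  -- The neighbours of `(b, 0)` in the first layer are the `(a, 1)` with `a` orthogonal to `b`.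
  -- Adjacent ones give the same value by a triangle, and any two are linked through at most one
  -- more.
  have claim1 : ∀ b : Coords, b ≠ 0 → ∃ m : C (b, 0), ∀ a (ha : a ≠ 0) (hab : a ≠ b)
      (h : form a b = 0), E _ _ (adj10 hab h) (n a ha) = m := by
    intro b hb
    have step : ∀ a c (ha : a ≠ 0) (hab : a ≠ b) (h : form a b = 0) (hc : c ≠ 0) (hcb : c ≠ b)
        (h' : form c b = 0), form a c = 1 →
        E _ _ (adj10 hcb h') (n c hc) = E _ _ (adj10 hab h) (n a ha) := by
      intro a c ha hab h hc hcb h' hac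
      rw [← hn a c ha hc hac]
      exact htri _ _ _ _ _ _ _
    obtain ⟨a, ha, hab, h⟩ := exists_perp b
    refine ⟨E _ _ (adj10 hab h) (n a ha), fun c hc hcb h' => ?_⟩
    rcases zmod_two_cases (form a c) with hac | hac
    · obtain ⟨d, hd, hdb, h'', had, hdc⟩ := exists_perp_nonperp b hb a ha hab h c hc hcb h' hac
      rw [step d c hd hdb h'' hc hcb h' hdc, step a d ha hab h hd hdb h'' had]
    · exact step a c ha hab h hc hcb h' hac
  choose m hm using claim1
  -- An edge of the second layer is in a triangle with a point `(a, 1)`, where `a` is orthogonal to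
  -- both of its ends.
  have hmm : ∀ x y (hx : x ≠ 0) (hy : y ≠ 0) (h : form x y = 1),
      E _ _ (adj11 h 0) (m x hx) = m y hy := by
    intro x y hx hy h
    obtain ⟨a, ha, hax, hay, h1, h2⟩ := exists_common_perp x y h
    rw [← hm x hx a ha hax h1, ← hm y hy a ha hay h2]
    exact htri _ _ _ _ _ _ _
  have claim2 : ∃ z : C (0, 1), ∀ b (hb : b ≠ 0), E _ _ (adj00 hb) (m b hb) = z := by
    have step : ∀ b c (hb : b ≠ 0) (hc : c ≠ 0), form b c = 1 →
        E _ _ (adj00 hc) (m c hc) = E _ _ (adj00 hb) (m b hb) := by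
      intro b c hb hc h
      rw [← hmm b c hb hc h]
      exact htri _ _ _ _ _ _ _
    have hb : ((1, 0) : Coords) ≠ 0 := by decide
    refine ⟨E _ _ (adj00 hb) (m _ hb), fun c hc => ?_⟩
    obtain ⟨d, hd, h1, h2⟩ := exists_common_nonperp _ c hb hc
    rw [step d c hd hc h2, step _ d hb hd h1]
  obtain ⟨z, hz⟩ := claim2
  -- The base point and the three layers partition the vertices, so the four partial definitions
  -- combine to one function.
  have hex : ∀ v, ∃ c : C v, (v = (0, 0) → HEq c c₀) ∧ (v = (0, 1) → HEq c z) ∧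
      (∀ x (hx : x ≠ 0), v = (x, 0) → HEq c (m x hx)) ∧
      (∀ x (hx : x ≠ 0), v = (x, 1) → HEq c (n x hx)) := by
    rintro ⟨x, ε⟩
    by_cases hx : x = 0
    · subst hx
      rcases zmod_two_cases ε with rfl | rfl
      · refine ⟨c₀, fun _ => HEq.rfl, fun h => by simp at h, fun x hx h => ?_, fun x hx h => ?_⟩
        · exact absurd (congrArg Prod.fst h).symm hx
        · exact absurd (congrArg Prod.fst h).symm hx
      · refine ⟨z, fun h => by simp at h, fun _ => HEq.rfl, fun x hx h => ?_, fun x hx h => ?_⟩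
        · exact absurd (congrArg Prod.fst h).symm hx
        · exact absurd (congrArg Prod.fst h).symm hx
    · rcases zmod_two_cases ε with rfl | rfl
      · refine ⟨m x hx, fun h => absurd (congrArg Prod.fst h) hx,
          fun h => absurd (congrArg Prod.fst h) hx, fun y hy h => ?_, fun y hy h => ?_⟩
        · obtain rfl : x = y := congrArg Prod.fst h
          exact HEq.rfl
        · simp at h
      · refine ⟨n x hx, fun h => absurd (congrArg Prod.fst h) hx,
          fun h => absurd (congrArg Prod.fst h) hx, fun y hy h => ?_, fun y hy h => ?_⟩
        · simp at h
        · obtain rfl : x = y := congrArg Prod.fst h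
          exact HEq.rfl
  choose g hg using hex
  have g00 : g (0, 0) = c₀ := eq_of_heq ((hg _).1 rfl)
  have g01 : g (0, 1) = z := eq_of_heq ((hg _).2.1 rfl)
  have gm : ∀ x (hx : x ≠ 0), g (x, 0) = m x hx := fun x hx => eq_of_heq ((hg _).2.2.1 x hx rfl)
  have gn : ∀ x (hx : x ≠ 0), g (x, 1) = n x hx := fun x hx => eq_of_heq ((hg _).2.2.2 x hx rfl)
  have back : ∀ v w (h : CoverAdj v w), E v w h (g v) = g w →
      ∀ h' : CoverAdj w v, E w v h' (g w) = g v := by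
    intro v w h e h'
    rw [← e, hsymm]
  have h0n : ∀ x (hx : x ≠ 0), E _ _ (adj01 hx) (g (0, 0)) = g (x, 1) := by
    intro x hx
    rw [g00, gn x hx]
  have hm1 : ∀ x (hx : x ≠ 0), E _ _ (adj00 hx) (g (x, 0)) = g (0, 1) := by
    intro x hx
    rw [g01, gm x hx, hz]
  have hnm : ∀ x y (hx : x ≠ 0) (hy : y ≠ 0) (hxy : x ≠ y) (h : form x y = 0),
      E _ _ (adj10 hxy h) (g (x, 1)) = g (y, 0) := by
    intro x y hx hy hxy h
    rw [gn x hx, gm y hy, hm y hy x hx hxy h]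
  refine ⟨g, ?_⟩
  rintro ⟨x, ε⟩ ⟨y, δ⟩ h
  have hh := h
  obtain ⟨hxy, hf⟩ := hh
  have hxy : x ≠ y := hxy
  have hf : ε + δ + form x y = 1 := hf
  have h11 : (1 : ZMod 2) + 1 = 0 := by decide
  by_cases hx : x = 0
  · subst hx
    have hy : y ≠ 0 := hxy.symm
    rw [form_zero_left, add_zero] at hf
    rcases zmod_two_cases ε with rfl | rfl <;> rcases zmod_two_cases δ with rfl | rfl
    · simp at hf
    · exact h0n y hy
    · exact back _ _ (adj00 hy) (hm1 y hy) h
    · simp [h11] at hf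
  by_cases hy : y = 0
  · subst hy
    rw [form_zero_right, add_zero] at hf
    rcases zmod_two_cases ε with rfl | rfl <;> rcases zmod_two_cases δ with rfl | rfl
    · simp at hf
    · exact hm1 x hx
    · exact back _ _ (adj01 hx) (h0n x hx) h
    · simp [h11] at hf
  rcases zmod_two_cases ε with rfl | rfl <;> rcases zmod_two_cases δ with rfl | rfl
  · rw [gm x hx, gm y hy]
    exact hmm x y hx hy (by simpa using hf)
  · have hf' : form y x = 0 := by rw [form_comm]; simpa using hf
    exact back _ _ (adj10 hxy.symm hf') (hnm y x hy hx hxy.symm hf') h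
  · exact hnm x y hx hy hxy (by simpa using hf)
  · rw [gn x hx, gn y hy]
    rw [h11, zero_add] at hf
    exact hn x y hx hy hf

/-! ### The double cover and its simple connectedness -/

namespace Frame

variable {s : LinearMap.BilinForm F V} {p H : Submodule F V}

/-- A point of the cover lies in the point-shadow of an object of the cover. -/
def Mem (f : Frame s p H) (X : (doubleCover s p H).Obj) (v : Coords × ZMod 2) : Prop :=
  f.cpt v.1 v.2 ∈ X.1.2

theorem sect (f : Frame s p H) (X : (doubleCover s p H).Obj) : f.Section X.1.1.1 X.1.2 :=
  f.section_of_isLift X.1.1.2 X.2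

theorem Mem.mem_trace {f : Frame s p H} {X : (doubleCover s p H).Obj} {v : Coords × ZMod 2}
    (h : f.Mem X v) : v.1 ∈ f.trace X.1.1.1 := (f.sect X).mem_trace h

theorem exists_lift_mem (f : Frame s p H) (X : (residueGeometry s p H).Obj) {v : Coords × ZMod 2}
    (hv : v.1 ∈ f.trace X.1) : ∃ X' : (doubleCover s p H).Obj, X'.1.1 = X ∧ f.Mem X' v := by
  obtain ⟨S, hS, hvS⟩ := f.exists_isLift_mem X.2 hv v.2
  exact ⟨⟨(X, S), hS⟩, rfl, hvS⟩

theorem trace_comparable (f : Frame s p H) {X Y : (residueGeometry s p H).Obj}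
    (h : (residueGeometry s p H).inc X Y) :
    f.trace X.1 ⊆ f.trace Y.1 ∨ f.trace Y.1 ⊆ f.trace X.1 := by
  rcases h with rfl | h | h
  · exact Or.inl le_rfl
  · exact Or.inl ((f.incLT_iff X.2 Y.2).1 h).2.1
  · exact Or.inr ((f.incLT_iff Y.2 X.2).1 h).2.1

theorem subset_of_mem (f : Frame s p H) {X Y : (doubleCover s p H).Obj}
    (h : X.1.1 = Y.1.1 ∨ IncLT s p X.1.1.1 Y.1.1.1) {v : Coords × ZMod 2} (hX : f.Mem X v)
    (hY : f.Mem Y v) : X.1.2 ⊆ Y.1.2 := by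
  rcases h with h | h
  · refine Section.subset X.1.1.2 (f.sect X) (f.sect Y) ?_ ?_ hX hY
    · rw [h]
    · rw [h]
      exact fun _ _ _ _ _ hj => hj
  · obtain ⟨-, h1, h2⟩ := (f.incLT_iff X.1.1.2 Y.1.1.2).1 h
    exact Section.subset X.1.1.2 (f.sect X) (f.sect Y) h1
      (fun x hx y hy hxy _ => h2 x hx y hy hxy) hX hY

theorem eq_of_mem (f : Frame s p H) {X Y : (doubleCover s p H).Obj} (h : X.1.1 = Y.1.1)
    {v : Coords × ZMod 2} (hX : f.Mem X v) (hY : f.Mem Y v) : X = Y :=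
  Subtype.ext (Prod.ext h ((f.subset_of_mem (Or.inl h) hX hY).antisymm
    (f.subset_of_mem (Or.inl h.symm) hY hX)))

/-- A section is determined by one of its points, so lifts of incident objects are comparable as
soon as they share a point of the cover. -/
theorem inc_of_mem (f : Frame s p H) {X Y : (doubleCover s p H).Obj}
    (h : (residueGeometry s p H).inc X.1.1 Y.1.1) {v : Coords × ZMod 2} (hX : f.Mem X v)
    (hY : f.Mem Y v) : (doubleCover s p H).inc X Y := by
  have h' := h
  rcases h with h | h | h
  · exact Or.inl (f.eq_of_mem h hX hY)
  · refine Or.inr ⟨fun e => ?_, h', Or.inl (f.subset_of_mem (Or.inr h) hX hY)⟩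
    rw [e] at h
    exact h.1.ne rfl
  · refine Or.inr ⟨fun e => ?_, h', Or.inr (f.subset_of_mem (Or.inr h) hY hX)⟩
    rw [e] at h
    exact h.1.ne rfl

theorem mem_of_subset (f : Frame s p H) {X Y : (doubleCover s p H).Obj}
    (h : X.1.2 ⊆ Y.1.2) {v : Coords × ZMod 2} (hX : v.1 ∈ f.trace X.1.1.1) :
    f.Mem X v ↔ f.Mem Y v := by
  refine ⟨fun hv => h hv, fun hv => ?_⟩
  obtain ⟨ε, hε⟩ := (f.sect X).exists_mem hX
  have := (f.sect Y).unique (h hε) hv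
  rw [this] at hε
  exact hε

theorem mem_iff_of_inc (f : Frame s p H) {X Y : (doubleCover s p H).Obj}
    (h : (doubleCover s p H).inc X Y) {v : Coords × ZMod 2} (hX : v.1 ∈ f.trace X.1.1.1)
    (hY : v.1 ∈ f.trace Y.1.1.1) : f.Mem X v ↔ f.Mem Y v := by
  rcases h with rfl | ⟨-, -, h | h⟩
  · rfl
  · exact f.mem_of_subset h hX
  · exact (f.mem_of_subset h hY).symm

theorem inc_base {X Y : (doubleCover s p H).Obj} (h : (doubleCover s p H).inc X Y) :
    (residueGeometry s p H).inc X.1.1 Y.1.1 := by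
  rcases h with rfl | h
  · exact (residueGeometry s p H).inc_refl _
  · exact h.2.1

theorem isDoubleCover (f : Frame s p H) :
    PreGeometry.IsDoubleCover (doubleCover s p H) (residueGeometry s p H) (coverMap s p H) where
  map_typ _ := rfl
  map_inc _ _ h := inc_base h
  fiber_two X := by
    obtain ⟨x, hx⟩ := f.trace_nonempty X.2.1 X.2.2.1
    obtain ⟨A, hA, hA'⟩ := f.exists_lift_mem X (v := (x, 0)) hx
    obtain ⟨B, hB, hB'⟩ := f.exists_lift_mem X (v := (x, 1)) hx
    refine ⟨A, B, ?_, fun Y => ⟨fun hY => ?_, ?_⟩⟩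
    · rintro rfl
      have hA0 : f.cpt x 0 ∈ A.1.2 := hA'
      have hA1 : f.cpt x 1 ∈ A.1.2 := hB'
      exact zero_ne_one ((f.sect A).unique hA0 hA1)
    · have hY : Y.1.1 = X := hY
      obtain ⟨ε, hε⟩ := (f.sect Y).exists_mem (show x ∈ f.trace Y.1.1.1 by rwa [hY])
      rcases zmod_two_cases ε with rfl | rfl
      · exact Or.inl (f.eq_of_mem (v := (x, 0)) (hY.trans hA.symm) hε hA')
      · exact Or.inr (f.eq_of_mem (v := (x, 1)) (hY.trans hB.symm) hε hB')
    · rintro (rfl | rfl)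
      exacts [hA, hB]
  lift X Y h := by
    obtain ⟨x, hx, hy⟩ : ∃ x, x ∈ f.trace X.1.1.1 ∧ x ∈ f.trace Y.1 := by
      rcases f.trace_comparable h with h1 | h1
      · obtain ⟨x, hx⟩ := f.trace_nonempty X.1.1.2.1 X.1.1.2.2.1
        exact ⟨x, hx, h1 hx⟩
      · obtain ⟨x, hx⟩ := f.trace_nonempty Y.2.1 Y.2.2.1
        exact ⟨x, h1 hx, hx⟩
    obtain ⟨ε, hε⟩ := (f.sect X).exists_mem hx
    obtain ⟨Y', rfl, hY'⟩ := f.exists_lift_mem Y (v := (x, ε)) hy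
    exact ⟨Y', rfl, f.inc_of_mem (v := (x, ε)) h hε hY'⟩
  triangle X Y Z h h' h'' := by
    -- The three traces are pairwise comparable and non-empty, so a smallest one lies in the other
    -- two.
    obtain ⟨x, hx, hy, hz⟩ : ∃ x, x ∈ f.trace X.1.1.1 ∧ x ∈ f.trace Y.1.1.1 ∧
        x ∈ f.trace Z.1.1.1 := by
      obtain ⟨x, hx⟩ := f.trace_nonempty X.1.1.2.1 X.1.1.2.2.1
      obtain ⟨y, hy⟩ := f.trace_nonempty Y.1.1.2.1 Y.1.1.2.2.1
      obtain ⟨z, hz⟩ := f.trace_nonempty Z.1.1.2.1 Z.1.1.2.2.1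
      rcases f.trace_comparable (inc_base h) with h1 | h1 <;>
        rcases f.trace_comparable (inc_base h') with h2 | h2 <;>
        rcases f.trace_comparable h'' with h3 | h3
      · exact ⟨x, hx, h1 hx, h3 hx⟩
      · exact ⟨x, hx, h1 hx, h2 (h1 hx)⟩
      · exact ⟨x, hx, h1 hx, h3 hx⟩
      · exact ⟨z, h3 hz, h2 hz, hz⟩
      · exact ⟨y, h1 hy, hy, h2 hy⟩
      · exact ⟨y, h1 hy, hy, h2 hy⟩
      · exact ⟨z, h1 (h2 hz), h2 hz, hz⟩
      · exact ⟨z, h3 hz, h2 hz, hz⟩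
    obtain ⟨ε, hε⟩ := (f.sect X).exists_mem hx
    have hY : f.Mem Y (x, ε) := (f.mem_iff_of_inc h hx hy).1 hε
    have hZ : f.Mem Z (x, ε) := (f.mem_iff_of_inc h' hy hz).1 hY
    exact f.inc_of_mem (v := (x, ε)) h'' hε hZ

theorem exists_pointObj (f : Frame s p H) (v : Coords × ZMod 2) :
    ∃ P : (doubleCover s p H).Obj, f.Mem P v ∧ ∀ X, f.Mem X v → (doubleCover s p H).inc P X := by
  obtain ⟨U, hU, hd, hT⟩ := f.exists_point v.1
  obtain ⟨P, hP, hPv⟩ := f.exists_lift_mem ⟨U, hU⟩ (v := v) (by rw [hT]; rfl)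
  refine ⟨P, hPv, fun X hX => f.inc_of_mem ?_ hPv hX⟩
  rw [hP]
  rcases (f.finrank_le_four X.1.1).1.eq_or_lt with h | h
  · left
    obtain ⟨a, ha⟩ := f.trace_point X.1.1.2 h.symm
    have hv := hX.mem_trace
    rw [ha] at hv
    have hv : v.1 = a := hv
    rw [← hv, ← hT] at ha
    refine Subtype.ext (le_antisymm ?_ ?_)
    · exact (f.le_iff_trace_subset hU.1 hU.2.1).2 ha.ge
    · exact (f.le_iff_trace_subset X.1.1.2.1 X.1.1.2.2.1).2 ha.le
  · exact Or.inr (Or.inl (f.point_lt hU X.1.1.2 hd h hT hX.mem_trace))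

/-- This line is incident with, or equal to, every object in which `v` and `w` are joined. Hence
passing from `v` to `w` through any such object gives the same homotopy class. -/
theorem exists_lineObj (f : Frame s p H) {v w : Coords × ZMod 2} (h : CoverAdj v w) :
    ∃ L : (doubleCover s p H).Obj, f.Mem L v ∧ f.Mem L w ∧ f.Joined L.1.1.1 v.1 w.1 ∧
      ∀ X, f.Mem X v → f.Mem X w → f.Joined X.1.1.1 v.1 w.1 → (doubleCover s p H).inc L X := by
  obtain ⟨U, hU, hd, hT⟩ := f.exists_line h.1
  obtain ⟨L, hL, hLv⟩ := f.exists_lift_mem ⟨U, hU⟩ (v := v) (by rw [hT]; exact Or.inl rfl)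
  have hLU : L.1.1.1 = U := congrArg Subtype.val hL
  have hj : f.Joined L.1.1.1 v.1 w.1 := f.joined_of_finrank_ne (by rw [hLU]; omega) _ _
  have hLw : f.Mem L w :=
    (f.sect L).mem_of_form_eq hLv (by rw [hLU, hT]; exact Or.inr rfl) h.1 hj h.2
  refine ⟨L, hLv, hLw, hj, fun X hX hX' hj => f.inc_of_mem ?_ hLv hX⟩
  rw [hL]
  have hX1 := hX.mem_trace
  have hX2 := hX'.mem_trace
  have h1 := (f.finrank_le_four X.1.1).1
  have : finrank F X.1.1.1 = 1 ∨ finrank F X.1.1.1 = 2 ∨ 2 < finrank F X.1.1.1 := by omega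
  rcases this with h2 | h2 | h2
  · obtain ⟨a, ha⟩ := f.trace_point X.1.1.2 h2
    rw [ha] at hX1 hX2
    exact absurd (hX1.trans hX2.symm) h.1
  · left
    have ha := f.trace_eq_pair X.1.1.2 h2 hX1 hX2 h.1
    rw [← hT] at ha
    refine Subtype.ext (le_antisymm ?_ ?_)
    · exact (f.le_iff_trace_subset hU.1 hU.2.1).2 ha.ge
    · exact (f.le_iff_trace_subset X.1.1.2.1 X.1.1.2.2.1).2 ha.le
  · exact Or.inr (Or.inl (f.line_lt hU X.1.1.2 hd h2 hT hX1 hX2 hj))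

/-- Adding the three adjacency equations cancels the fiber coordinates and leaves the odd sum that
characterizes hyperbolic direction spaces. Thus every triangle of the collinearity graph lies in a
plane. -/
theorem exists_planeObj (f : Frame s p H) {v w u : Coords × ZMod 2} (h : CoverAdj v w)
    (h' : CoverAdj w u) (h'' : CoverAdj v u) : ∃ X : (doubleCover s p H).Obj,
      f.Mem X v ∧ f.Mem X w ∧ f.Mem X u ∧ ∀ x y, f.Joined X.1.1.1 x y := by
  have hf : form (v.1 + w.1) (v.1 + u.1) = 1 := by
    rw [form_add_add_eq_one_iff]
    have h1 := h.2
    have h2 := h'.2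
    have h3 := h''.2
    generalize form v.1 w.1 = a at *
    generalize form w.1 u.1 = b at *
    generalize form v.1 u.1 = c at *
    generalize v.2 = α at *
    generalize w.2 = β at *
    generalize u.2 = γ at *
    clear * - h1 h2 h3
    revert a b c α β γ
    decide
  obtain ⟨U, hU, hd, hT⟩ := f.exists_plane hf
  obtain ⟨X, hX, hXv⟩ := f.exists_lift_mem ⟨U, hU⟩ (v := v) (by rw [hT]; exact Or.inl rfl)
  have hXU : X.1.1.1 = U := congrArg Subtype.val hX
  have hj : ∀ x y, f.Joined X.1.1.1 x y := f.joined_of_finrank_ne (by rw [hXU]; omega)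
  refine ⟨X, hXv, ?_, ?_, hj⟩
  · exact (f.sect X).mem_of_form_eq hXv (by rw [hXU, hT]; simp) h.1 (hj _ _) h.2
  · exact (f.sect X).mem_of_form_eq hXv (by rw [hXU, hT]; simp) h''.1 (hj _ _) h''.2

theorem coverAdj_of_mem (f : Frame s p H) {X : (doubleCover s p H).Obj} {v w : Coords × ZMod 2}
    (hv : f.Mem X v) (hw : f.Mem X w) (hvw : v.1 ≠ w.1) (hj : f.Joined X.1.1.1 v.1 w.1) :
    CoverAdj v w :=
  ⟨hvw, (f.sect X).form_eq _ _ _ _ hv hw hvw hj⟩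

open PreGeometry in
theorem simplyConnected (f : Frame s p H) : (doubleCover s p H).SimplyConnected := by
  choose P hPv hP using f.exists_pointObj
  have hP' : ∀ v X, f.Mem X v → (doubleCover s p H).inc X (P v) := fun v X h =>
    (doubleCover s p H).inc_symm _ _ (hP v X h)
  choose L hLv hLw hLj hL using fun (v w : Coords × ZMod 2) (h : CoverAdj v w) => f.exists_lineObj h
  let x₀ := P (0, 0)
  -- An edge transports homotopy classes from one point object to the next by way of the line
  -- through them.
  let E : ∀ v w, CoverAdj v w → (doubleCover s p H).PathClass x₀ (P v) →
      (doubleCover s p H).PathClass x₀ (P w) := fun v w h c =>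
    (c.move (hP v _ (hLv v w h))).move (hP' w _ (hLw v w h))
  have hE : ∀ v w (h : CoverAdj v w) X (hv : f.Mem X v) (hw : f.Mem X w),
      f.Joined X.1.1.1 v.1 w.1 → ∀ c, E v w h c = (c.move (hP v X hv)).move (hP' w X hw) := by
    intro v w h X hv hw hj c
    have hLX := hL v w h X hv hw hj
    rw [← PathClass.move_move c (hP v _ (hLv v w h)) hLX (hP v X hv),
      PathClass.move_move _ hLX (hP' w X hw) (hP' w _ (hLw v w h))]
  obtain ⟨g, hg⟩ := exists_potential E
    (by
      intro v w h h' c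
      rw [hE w v h' (L v w h) (hLw v w h) (hLv v w h) (f.joined_comm.1 (hLj v w h))]
      change PathClass.move (PathClass.move (PathClass.move (PathClass.move c _) _) _) _ = c
      rw [PathClass.move_move_symm, PathClass.move_move_symm])
    (by
      intro v w u h h' h'' c
      -- All three edges of the triangle may be passed through the same plane object, where the two
      -- intermediate moves cancel.
      obtain ⟨X, hv, hw, hu, hj⟩ := f.exists_planeObj h h' h''
      rw [hE v w h X hv hw (hj _ _), hE w u h' X hw hu (hj _ _), hE v u h'' X hv hu (hj _ _),
        PathClass.move_move_symm])
    (Quotient.mk _ SimpleGraph.Walk.nil)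
  have hmem : ∀ X : (doubleCover s p H).Obj, ∃ v, f.Mem X v := by
    intro X
    obtain ⟨x, hx⟩ := f.trace_nonempty X.1.1.2.1 X.1.1.2.2.1
    obtain ⟨ε, hε⟩ := (f.sect X).exists_mem hx
    exact ⟨(x, ε), hε⟩
  have step : ∀ X v w (hv : f.Mem X v) (hw : f.Mem X w), v.1 ≠ w.1 → f.Joined X.1.1.1 v.1 w.1 →
      (g v).move (hP v X hv) = (g w).move (hP w X hw) := by
    intro X v w hv hw hvw hj
    rw [← hg v w (f.coverAdj_of_mem hv hw hvw hj), hE v w _ X hv hw hj, PathClass.move_move_symm]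
  -- The class induced on `X` does not depend on the point used, because any two points of `X` are
  -- linked by at most two joined pairs.
  have indep : ∀ X v w (hv : f.Mem X v) (hw : f.Mem X w),
      (g v).move (hP v X hv) = (g w).move (hP w X hw) := by
    intro X v w hv hw
    by_cases hvw : v.1 = w.1
    · obtain ⟨x, ε⟩ := v
      obtain ⟨y, δ⟩ := w
      obtain rfl : x = y := hvw
      obtain rfl : ε = δ := (f.sect X).unique hv hw
      rfl
    · rcases f.joined_or X.1.1.2 hv.mem_trace hvw with h | ⟨z, hz, h1, h2, h3, h4⟩
      · exact step X v w hv hw hvw h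
      · obtain ⟨η, hη⟩ := (f.sect X).exists_mem hz
        rw [step X v (z, η) hv hη h1 h3, step X (z, η) w hη hw h2 h4]
  choose pt hpt using hmem
  refine simplyConnected_of_potential x₀ (fun X => (g (pt X)).move (hP _ X (hpt X))) ?_
  intro X Y h
  -- Incident objects have a common point `v`; computed from `v`, the classes on `X` and `Y` differ
  -- by one move.
  obtain ⟨v, hX, hY⟩ : ∃ v, f.Mem X v ∧ f.Mem Y v := by
    rcases f.trace_comparable (inc_base h) with h1 | h1
    · have hY := h1 (hpt X).mem_trace
      exact ⟨pt X, hpt X, (f.mem_iff_of_inc h (hpt X).mem_trace hY).1 (hpt X)⟩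
    · have hX := h1 (hpt Y).mem_trace
      exact ⟨pt Y, (f.mem_iff_of_inc h hX (hpt Y).mem_trace).2 (hpt Y), hpt Y⟩
  rw [indep X _ v (hpt X) hX, indep Y _ v (hpt Y) hY]
  exact PathClass.move_move _ _ _ _

end Frame

end SymplecticResidue

theorem mainTheorem6 {F : Type*} {V : Type*} [Field F] [AddCommGroup V] [Module F V]
    (hF : Nat.card F = 2) (hV : Module.finrank F V = 6)
    (s : LinearMap.BilinForm F V) (hs : s.IsAlt) (hnd : s.Nondegenerate)
    (p H : Submodule F V) (hp : Module.finrank F p = 1) (hpH : IsCompl p H) :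
    (SymplecticResidue.residueGeometry s p H).Connected ∧
    (∀ x : (SymplecticResidue.residueGeometry s p H).Obj,
      Nonempty ((SymplecticResidue.residueGeometry s p H).FundamentalGroup x ≃*
        Multiplicative (ZMod 2))) ∧
    PreGeometry.IsCovering 2 (SymplecticResidue.doubleCover s p H)
      (SymplecticResidue.residueGeometry s p H) (SymplecticResidue.coverMap s p H) ∧
    (SymplecticResidue.doubleCover s p H).SimplyConnected := by
  obtain ⟨f⟩ := SymplecticResidue.exists_frame hF hV s hs hnd p H hp hpH
  have hc := f.isDoubleCover
  have hs := f.simplyConnected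
  exact ⟨hc.connected hs, hc.fundamentalGroup_equiv hs, hc.isCovering f.isGeometry, hs⟩
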